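/- Let $1\le k<d$ be integers, $p=\frac{d+1}{k+1}$, $q=d+1$. Write points of $\mathbb R^{d+1}$ as $\zeta=(\zeta',\zeta_{d+1})\in\mathbb R^d\times\mathbb R$ and let $$\mathbb S^d=\{\zeta_{d+1}^2+|\zeta'|^2=1\},\qquad \mathbb H^d=\{\zeta_{d+1}^2-|\zeta'|^2=1,\ \zeta_{d+1}>0\},$$ with the Riemannian metrics induced by the Euclidean metric and by the Minkowski metric $|d\zeta'|^2-d\zeta_{d+1}^2$ respectively. A $k$-plane in $\mathbb R^d$ is an affine subspace of dimension $k$; a $k$-plane in $\mathbb S^d$ or $\mathbb H^d$ is a $k$-dimensional (complete, connected) totally geodesic submanifold, that is, a nonempty intersection with a linear subspace of $\mathbb R^{d+1}$ of dimension $k+1$. Denote by $\mathcal R_0,\mathcal R_+,\mathcal R_-$ the $k$-plane transforms $\mathcal R f(\pi)=\int_\pi f\,d\lambda_\pi$ on $\mathbb R^d,\mathbb S^d,\mathbb H^d$, where $\lambda_\pi$ is the Riemannian measure of the $k$-plane $\pi$. For $f:\mathbb R^d\to\mathbb R$ put $$P_\pm f(\zeta)=\langle x\rangle_\pm^{k+1}f(x),\qquad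 x=-\frac{\zeta'}{\zeta_{d+1}},\qquad \langle x\rangle_\pm=\sqrt{1\pm|x|^2},$$ a function on $\mathbb S^d$ (almost everywhere) for the sign $+$ and on $\mathbb H^d$ for the sign $-$. The norm $|\cdot|_p$ is taken with respect to Lebesgue measure on $\mathbb R^d$, the Riemannian measure on $\mathbb H^d$, and half the Riemannian measure on $\mathbb S^d$ (the map $\zeta\mapsto-\zeta'/\zeta_{d+1}$ being two-to-one on $\mathbb S^d$). On the set of $k$-planes of each of $\mathbb R^d$, $\mathbb S^d$, $\mathbb H^d$ there is a nonzero $\sigma$-finite Borel measure invariant under the isometry group. Let $\mu_0,\mu_+,\mu_-$ be any such measures. After multiplication of $\mu_+$ and of $\mu_-$ by suitable constants in $(0,\infty)$, which do not depend on $f$, the following holds, with $|\cdot|_q$ taken with respect to these measures. (i) If $f\in L^p(\mathbb R^d)$, then $P_+f\in L^p(\mathbb S^d)$, the transforms $\mathcal R_0f$ and $\mathcal R_+P_+f$ are defined almost everywhere (by absolutely convergent integrals) and measurable, and $$|P_+f|_p=|f|_p,\qquad |\mathcal R_+P_+f|_q=|\mathcal R_0f|_q .$$ (ii) If $f\in L^p(\mathbb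 R^d)$ vanishes almost everywhere outside the unit ball, then $P_-f\in L^p(\mathbb H^d)$, the transforms $\mathcal R_0f$ and $\mathcal R_-P_-f$ are defined almost everywhere (by absolutely convergent integrals) and measurable, and $$|P_-f|_p=|f|_p,\qquad |\mathcal R_-P_-f|_q=|\mathcal R_0f|_q .$$ -/

import Mathlib

open MeasureTheory
open scoped ENNReal

noncomputable section

namespace KPlane

/-- `ℝⁿ` with its Euclidean structure. -/
abbrev E (n : ℕ) := EuclideanSpace ℝ (Fin n)

/-- The two signs: `plus` for the sphere, `minus` for hyperbolic space. -/
inductive Curv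
  | plus
  | minus

/-- The curvature `+1` or `-1`. -/
def Curv.sgn : Curv → ℝ
  | .plus => 1
  | .minus => -1

/-- The first `d` coordinates `ζ'` of `ζ = (ζ', ζ_{d+1})`. -/
def fstPart {d : ℕ} (ζ : E (d + 1)) : E d := WithLp.toLp 2 fun i => ζ i.castSucc

/-- The last coordinate `ζ_{d+1}` of `ζ = (ζ', ζ_{d+1})`. -/
def lastCoord {d : ℕ} (ζ : E (d + 1)) : ℝ := ζ (Fin.last d)

/-- The bilinear form `ζ_{d+1} η_{d+1} ± ζ' ⬝ η'` (Euclidean for `plus`, Minkowski for `minus`). -/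
def form (ν : Curv) {d : ℕ} (ζ η : E (d + 1)) : ℝ :=
  lastCoord ζ * lastCoord η + ν.sgn * inner ℝ (fstPart ζ) (fstPart η)

/-- The sphere `ζ_{d+1}² + |ζ'|² = 1`, respectively hyperbolic space, the (connected) upper sheet
`ζ_{d+1} > 0` of the hyperboloid `ζ_{d+1}² - |ζ'|² = 1`. -/
def space (ν : Curv) (d : ℕ) : Set (E (d + 1)) :=
  match ν with
  | .plus => {ζ | form .plus ζ ζ = 1}
  | .minus => {ζ | form .minus ζ ζ = 1 ∧ 0 < lastCoord ζ}

/-! ### `k`-planes and their σ-algebras -/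

/-- Affine `k`-planes of `ℝᵈ`. -/
structure FlatPlane (d k : ℕ) where
  carrier : AffineSubspace ℝ (E d)
  nonempty : (carrier : Set (E d)).Nonempty
  finrank_direction : Module.finrank ℝ carrier.direction = k

/-- `k`-planes of the sphere or of hyperbolic space: the `k`-dimensional (complete, connected)
totally geodesic submanifolds, that is, the nonempty sections by linear subspaces of
dimension `k + 1`. -/
structure Plane (ν : Curv) (d k : ℕ) where
  carrier : Set (E (d + 1))
  nonempty : carrier.Nonempty
  exists_section : ∃ W : Submodule ℝ (E (d + 1)),
    Module.finrank ℝ W = k + 1 ∧ carrier = (W : Set (E (d + 1))) ∩ space ν d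

/-- The Effros (Borel) σ-algebra on the set of `k`-planes, generated by the sets of planes that hit
a given open set. -/
instance (d k : ℕ) : MeasurableSpace (FlatPlane d k) :=
  MeasurableSpace.generateFrom
    {A | ∃ U : Set (E d), IsOpen U ∧ A = {π | ((π.carrier : Set (E d)) ∩ U).Nonempty}}

/-- The Effros (Borel) σ-algebra on the set of `k`-planes, generated by the sets of planes that hit
a given open set. -/
instance (ν : Curv) (d k : ℕ) : MeasurableSpace (Plane ν d k) :=
  MeasurableSpace.generateFrom
    {A | ∃ U : Set (E (d + 1)), IsOpen U ∧ A = {π | (π.carrier ∩ U).Nonempty}}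

/-! ### Isometry groups and invariant measures -/

/-- The action of a rigid motion of `ℝᵈ` on affine `k`-planes. -/
def FlatPlane.move {d k : ℕ} (T : E d ≃ᵃⁱ[ℝ] E d) (π : FlatPlane d k) : FlatPlane d k where
  carrier := π.carrier.map T.toAffineEquiv.toAffineMap
  nonempty := by
    rw [AffineSubspace.coe_map]
    exact π.nonempty.image _
  finrank_direction := by
    rw [AffineSubspace.map_direction]
    exact (LinearEquiv.finrank_map_eq T.toAffineEquiv.linear π.carrier.direction).trans
      π.finrank_direction

/-- The isometries of the sphere (`O(d+1)`), respectively of hyperbolic space (the elements of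
`O(d,1)` that preserve the upper sheet), as linear automorphisms of `ℝᵈ⁺¹`. -/
structure Isom (ν : Curv) (d : ℕ) where
  toEquiv : E (d + 1) ≃ₗ[ℝ] E (d + 1)
  form_map : ∀ ζ η, form ν (toEquiv ζ) (toEquiv η) = form ν ζ η
  image_space : toEquiv '' space ν d = space ν d

/-- The action of an isometry on `k`-planes. -/
def Plane.move {ν : Curv} {d k : ℕ} (T : Isom ν d) (π : Plane ν d k) : Plane ν d k where
  carrier := T.toEquiv '' π.carrier
  nonempty := π.nonempty.image _
  exists_section := by
    obtain ⟨W, hW, h⟩ := π.exists_section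
    refine ⟨W.map (T.toEquiv : E (d + 1) →ₗ[ℝ] E (d + 1)), ?_, ?_⟩
    · rw [← hW]
      exact LinearEquiv.finrank_map_eq T.toEquiv W
    · rw [h, Set.image_inter T.toEquiv.injective, T.image_space]
      rfl

/-- `μ` is an invariant measure on the affine `k`-planes of `ℝᵈ`
(nonzero, σ-finite, invariant under rigid motions). -/
structure IsInvariantFlat {d k : ℕ} (μ : Measure (FlatPlane d k)) : Prop where
  ne_zero : μ ≠ 0
  sigmaFinite : SigmaFinite μ
  map_move : ∀ T : E d ≃ᵃⁱ[ℝ] E d, μ.map (FlatPlane.move T) = μ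

/-- `μ` is an invariant measure on the `k`-planes of the sphere or of hyperbolic space
(nonzero, σ-finite, invariant under isometries). -/
structure IsInvariant {ν : Curv} {d k : ℕ} (μ : Measure (Plane ν d k)) : Prop where
  ne_zero : μ ≠ 0
  sigmaFinite : SigmaFinite μ
  map_move : ∀ T : Isom ν d, μ.map (Plane.move T) = μ

/-! ### Riemannian measures and the `k`-plane transforms -/

/-- The Lebesgue measure of an affine plane, as a measure on `ℝᵈ`. -/
def FlatPlane.measure {d k : ℕ} (π : FlatPlane d k) : Measure (E d) :=
  (stdOrthonormalBasis ℝ π.carrier.direction).toBasis.addHaar.map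
    fun v : π.carrier.direction => (v : E d) + π.nonempty.some

/-- The Lebesgue measure of a linear subspace `W` of `ℝᵈ⁺¹`, normalized by the restriction of the
bilinear form to `W`: it is `√|det (form bᵢ bⱼ)|` times the Lebesgue measure in the coordinates of a
basis `b` of `W`, whatever the basis. -/
def formVolume (ν : Curv) {d : ℕ} (W : Submodule ℝ (E (d + 1))) : Measure W :=
  ENNReal.ofReal (Real.sqrt |(Matrix.of fun i j =>
    form ν (Module.finBasis ℝ W i : E (d + 1)) (Module.finBasis ℝ W j : E (d + 1))).det|) •
      (Module.finBasis ℝ W).addHaar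

/-- The radial projection `w ↦ w / √(form w w)`. -/
def radial (ν : Curv) {d : ℕ} (w : E (d + 1)) : E (d + 1) := (Real.sqrt (form ν w w))⁻¹ • w

/-- The Riemannian measure of `W ∩ space ν d`, as a measure on `ℝᵈ⁺¹`, where the Riemannian metric
is the restriction of the Euclidean metric (sphere) or of the Minkowski metric `dζ'² - dζ_{d+1}²`
(hyperbolic space). Since the position vector is a unit normal, the volume of `W` reads
`r ^ (n - 1) dr dλ(ω)` in polar coordinates `w = r ω`, `n = dim W`. Thus the Riemannian measure
`λ A` is `n` times the volume of the cone `(0, 1) • A`, as for the measure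
`MeasureTheory.Measure.toSphere` on spheres. -/
def sectionMeasure (ν : Curv) {d : ℕ} (W : Submodule ℝ (E (d + 1))) : Measure (E (d + 1)) :=
  (Module.finrank ℝ W : ℝ≥0∞) •
    ((formVolume ν W).restrict
      {w : W | 0 < form ν (w : E (d + 1)) w ∧ form ν (w : E (d + 1)) w < 1 ∧
        radial ν (w : E (d + 1)) ∈ space ν d}).map fun w : W => radial ν (w : E (d + 1))

/-- The Riemannian measure of the sphere or of hyperbolic space, as a measure on `ℝᵈ⁺¹`. -/
def spaceMeasure (ν : Curv) (d : ℕ) : Measure (E (d + 1)) := sectionMeasure ν ⊤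

/-- The Riemannian measure of a `k`-plane, as a measure on `ℝᵈ⁺¹`. -/
def Plane.measure {ν : Curv} {d k : ℕ} (π : Plane ν d k) : Measure (E (d + 1)) :=
  sectionMeasure ν (Submodule.span ℝ π.carrier)

/-- The `k`-plane transform on `ℝᵈ`. -/
def flatTransform {d k : ℕ} (f : E d → ℝ) (π : FlatPlane d k) : ℝ := ∫ x, f x ∂π.measure

/-- The `k`-plane transform on the sphere or on hyperbolic space. -/
def transform {ν : Curv} {d k : ℕ} (g : E (d + 1) → ℝ) (π : Plane ν d k) : ℝ :=
  ∫ ζ, g ζ ∂π.measure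

/-! ### The projection and the weighted pullback -/

/-- The non-conformal stereographic projection `ζ ↦ - ζ' / ζ_{d+1}`. -/
def proj {d : ℕ} (ζ : E (d + 1)) : E d := -((lastCoord ζ)⁻¹ • fstPart ζ)

/-- The bracket `⟨x⟩_± = √(1 ± |x|²)`. -/
def bracket (ν : Curv) {d : ℕ} (x : E d) : ℝ := Real.sqrt (1 + ν.sgn * ‖x‖ ^ 2)

/-- The weighted pullback `P_± f = p_±^* (⟨x⟩_±^{k+1} f)`; only its values on `space ν d` matter. -/
def pull (ν : Curv) (k : ℕ) {d : ℕ} (f : E d → ℝ) (ζ : E (d + 1)) : ℝ :=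
  bracket ν (proj ζ) ^ (k + 1) * f (proj ζ)

end KPlane

end

noncomputable section

namespace KPlane

open scoped Matrix

/-! ### Lebesgue measure on spaces of matrices -/

/-! All three kinds of planes are linear subspaces `W` of `ℝᵈ⁺¹` of dimension `k + 1`. A curved
plane is recorded by its span, an affine plane by the span of the points `(-x, 1)` over it, and `ζ ↦
-ζ' / ζ_{d+1}` carries the section of `W` by the curved space to the affine plane of `W` (in the
hyperbolic case, to its part in the unit ball). So everything can be compared on one Grassmannian.
Let `κ = ±1` be the curvature and `ρ` the distance of the affine plane from the origin. Two
Jacobians appear, and they cancel.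

Along a plane: the Riemannian measure of a section is `dim W` times the volume of a cone. In the
basis of `W` made of the lift of the foot point and an orthonormal basis of the direction, the Gram
determinant of the form is `1 + κρ²` up to sign, and integrating out the radial variable over `|s| <
⟨x⟩⁻¹` produces `⟨x⟩^{-(k+1)}`. Hence `⟨x⟩^{k+1}` times the Riemannian measure projects to `N √(1 +
κρ²)` times Lebesgue measure, with `N = 2` for the sphere and `N = 1` for hyperbolic space
(`lintegral_sectionMeasure_flatSpan`). The transform of the pullback is therefore `N √(1 + κρ²)`
times the flat transform. For `W = ℝᵈ⁺¹` one has `ρ = 0`, and `(k + 1) p = d + 1` gives the equality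
of the `L^p` norms.

Across planes: write `W = ker u` with `u` a matrix with `d - k` rows, and consider on row vectors
the forms `diag (1, …, 1, κ)`, where now `κ = 0` is allowed. Lebesgue measure on the matrices whose
Gram matrix is positive definite and close to the identity, pushed forward by `u ↦ ker u`, is
invariant under the isometries of the form. Averaging over left multiplication by invertible
matrices shows that the measures of two forms differ by the ratio of the Gram determinants to the
power `(d + 1) / 2` (`exists_lintegral_gram_eq`). By the matrix determinant lemma this ratio is `1 +
κρ²` (`det_gram_J`). Thus `dμ_κ = c (1 + κρ²)^{-(d+1)/2} dμ₀` where both make sense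
(`exists_lintegral_grMeasure_eq`), and this density compensates the `q`-th power of `√(1 + κρ²)`
exactly when `q = d + 1`.

That arbitrary invariant measures may be replaced by these follows from transitivity (products of
reflections) and uniqueness of σ-finite invariant measures on an orbit of a locally compact group.

Existence almost everywhere and measurability of the transforms come from the sphere. Its sections
have finite measures forming a measurable kernel, whose average over the Grassmannian is a multiple
of the measure of the sphere, again by uniqueness. There `L^p ⊂ L¹`, so the pullback is integrable
on almost every section. The density formula moves null sets from the sphere to the flat case and
from there to hyperbolic space. -/

instance matrixMeasureSpace (m n : ℕ) : MeasureSpace (Matrix (Fin m) (Fin n) ℝ) :=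
  inferInstanceAs (MeasureSpace (Fin m → Fin n → ℝ))

instance matrixBorelSpace (m n : ℕ) : BorelSpace (Matrix (Fin m) (Fin n) ℝ) :=
  inferInstanceAs (BorelSpace (Fin m → Fin n → ℝ))

instance matrixSecondCountable (m n : ℕ) : SecondCountableTopology (Matrix (Fin m) (Fin n) ℝ) :=
  inferInstanceAs (SecondCountableTopology (Fin m → Fin n → ℝ))

instance matrixSigmaFinite (m n : ℕ) :
    SigmaFinite (volume : Measure (Matrix (Fin m) (Fin n) ℝ)) :=
  inferInstanceAs (SigmaFinite (volume : Measure (Fin m → Fin n → ℝ)))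

instance matrixOpenPos (m n : ℕ) :
    Measure.IsOpenPosMeasure (volume : Measure (Matrix (Fin m) (Fin n) ℝ)) :=
  inferInstanceAs (Measure.IsOpenPosMeasure (volume : Measure (Fin m → Fin n → ℝ)))

instance matrixFiniteOnCompacts (m n : ℕ) :
    IsFiniteMeasureOnCompacts (volume : Measure (Matrix (Fin m) (Fin n) ℝ)) :=
  inferInstanceAs (IsFiniteMeasureOnCompacts (volume : Measure (Fin m → Fin n → ℝ)))

/-- A linear automorphism of a space of matrices scales the volume by its determinant. -/
theorem lintegral_comp_linearMap_matrix {m n : ℕ}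
    (L : Matrix (Fin m) (Fin n) ℝ →ₗ[ℝ] Matrix (Fin m) (Fin n) ℝ)
    (hL : LinearMap.det L ≠ 0) {F : Matrix (Fin m) (Fin n) ℝ → ℝ≥0∞} (hF : Measurable F) :
    ENNReal.ofReal |LinearMap.det L| * ∫⁻ u, F (L u) = ∫⁻ u, F u := by
  have hmap : Measure.map L (volume : Measure (Matrix (Fin m) (Fin n) ℝ)) =
      ENNReal.ofReal |(LinearMap.det L)⁻¹| • volume :=
    Measure.map_linearMap_addHaar_eq_smul_addHaar (E := Fin m → Fin n → ℝ) volume hL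
  have hLm : Measurable L :=
    let L' : (Fin m → Fin n → ℝ) →ₗ[ℝ] (Fin m → Fin n → ℝ) := L
    (LinearMap.continuous_of_finiteDimensional L').measurable
  rw [← lintegral_map hF hLm, hmap, lintegral_smul_measure, smul_eq_mul, ← mul_assoc,
    ← ENNReal.ofReal_mul (abs_nonneg _), ← abs_mul, mul_inv_cancel₀ hL]
  simp

/-- Left multiplication by a square matrix, as a linear endomorphism of a space of matrices. -/
def mulLeftLin {m : ℕ} (n : ℕ) (S : Matrix (Fin m) (Fin m) ℝ) :
    Matrix (Fin m) (Fin n) ℝ →ₗ[ℝ] Matrix (Fin m) (Fin n) ℝ where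
  toFun u := S * u
  map_add' := Matrix.mul_add S
  map_smul' c u := Matrix.mul_smul S c u

/-- Right multiplication by a square matrix, as a linear endomorphism of a space of matrices. -/
def mulRightLin (m : ℕ) {n : ℕ} (M : Matrix (Fin n) (Fin n) ℝ) :
    Matrix (Fin m) (Fin n) ℝ →ₗ[ℝ] Matrix (Fin m) (Fin n) ℝ where
  toFun u := u * M
  map_add' u v := Matrix.add_mul u v M
  map_smul' c u := Matrix.smul_mul c u M

/-- Each of the `m` rows is transformed separately by `Mᵀ`, so the map is a product of `m` copies of
one endomorphism. -/
theorem det_mulRightLin (m : ℕ) {n : ℕ} (M : Matrix (Fin n) (Fin n) ℝ) :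
    LinearMap.det (mulRightLin m M) = M.det ^ m := by
  have h := LinearMap.det_pi (R := ℝ) (ι := Fin m) (fun _ => Matrix.toLin' Mᵀ)
  have e : (LinearMap.pi fun i : Fin m => (Matrix.toLin' Mᵀ).comp (LinearMap.proj i)) =
      (mulRightLin m M : (Fin m → Fin n → ℝ) →ₗ[ℝ] (Fin m → Fin n → ℝ)) := by
    ext u i j
    simp [mulRightLin, Matrix.mulVec]
    rw [dotProduct_comm]; rfl
  rw [e] at h
  exact h.trans (by simp)

/-- Transposition conjugates left multiplication to right multiplication by `Sᵀ`. -/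
theorem det_mulLeftLin {m : ℕ} (n : ℕ) (S : Matrix (Fin m) (Fin m) ℝ) :
    LinearMap.det (mulLeftLin n S) = S.det ^ n := by
  have h := LinearMap.det_conj (mulRightLin n Sᵀ) (Matrix.transposeLinearEquiv (Fin n) (Fin m) ℝ ℝ)
  rw [det_mulRightLin, Matrix.det_transpose] at h
  rw [← h]
  congr 1
  ext u : 1
  simp [mulRightLin, mulLeftLin, Matrix.transpose_mul]

/-! ### Haar measure of the general linear group -/

/-- The absolute value of the determinant, in `ℝ≥0∞`. -/
def absDet {m : ℕ} (S : Matrix (Fin m) (Fin m) ℝ) : ℝ≥0∞ := ENNReal.ofReal |S.det|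

theorem absDet_mul {m : ℕ} (S R : Matrix (Fin m) (Fin m) ℝ) :
    absDet (S * R) = absDet S * absDet R := by
  simp [absDet, abs_mul, ENNReal.ofReal_mul]

theorem absDet_ne_top {m : ℕ} (S : Matrix (Fin m) (Fin m) ℝ) : absDet S ≠ ∞ := by
  simp [absDet]

theorem absDet_ne_zero {m : ℕ} {S : Matrix (Fin m) (Fin m) ℝ} (hS : S.det ≠ 0) :
    absDet S ≠ 0 := by
  simp [absDet, hS]

theorem measurable_absDet {m : ℕ} : Measurable (absDet (m := m)) := by
  have : Continuous fun S : Matrix (Fin m) (Fin m) ℝ => S.det := continuous_id.matrix_det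
  exact ENNReal.measurable_ofReal.comp this.abs.measurable

theorem lintegral_mul_left {m n : ℕ} {S : Matrix (Fin m) (Fin m) ℝ} (hS : S.det ≠ 0)
    {F : Matrix (Fin m) (Fin n) ℝ → ℝ≥0∞} (hF : Measurable F) :
    absDet S ^ n * ∫⁻ u : Matrix (Fin m) (Fin n) ℝ, F (S * u) = ∫⁻ u, F u := by
  have h := lintegral_comp_linearMap_matrix (mulLeftLin n S)
    (by rw [det_mulLeftLin]; exact pow_ne_zero _ hS) hF
  rw [det_mulLeftLin, abs_pow, ENNReal.ofReal_pow (abs_nonneg _)] at h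
  exact h

theorem lintegral_mul_right {m n : ℕ} {M : Matrix (Fin n) (Fin n) ℝ} (hM : M.det ≠ 0)
    {F : Matrix (Fin m) (Fin n) ℝ → ℝ≥0∞} (hF : Measurable F) :
    absDet M ^ m * ∫⁻ u : Matrix (Fin m) (Fin n) ℝ, F (u * M) = ∫⁻ u, F u := by
  have h := lintegral_comp_linearMap_matrix (mulRightLin m M)
    (by rw [det_mulRightLin]; exact pow_ne_zero _ hM) hF
  rw [det_mulRightLin, abs_pow, ENNReal.ofReal_pow (abs_nonneg _)] at h
  exact h

theorem measurable_mul_left {m l n : ℕ} (S : Matrix (Fin m) (Fin l) ℝ) :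
    Measurable fun u : Matrix (Fin l) (Fin n) ℝ => S * u :=
  (continuous_const.matrix_mul continuous_id).measurable

theorem measurable_mul_right {m l n : ℕ} (M : Matrix (Fin l) (Fin n) ℝ) :
    Measurable fun u : Matrix (Fin m) (Fin l) ℝ => u * M :=
  (continuous_id.matrix_mul continuous_const).measurable

/-- The density `|det S|^{-m}` of the Haar measure of the general linear group
(zero where `det S = 0`). -/
def glDensity {m : ℕ} (S : Matrix (Fin m) (Fin m) ℝ) : ℝ≥0∞ := absDet S * (absDet S ^ (m + 1))⁻¹

/-- The Haar measure `|det S|^{-m} dS` of the general linear group, as a measure on matrices. -/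
def glHaar (m : ℕ) : Measure (Matrix (Fin m) (Fin m) ℝ) := volume.withDensity glDensity

theorem measurable_glDensity {m : ℕ} : Measurable (glDensity (m := m)) :=
  measurable_absDet.mul (measurable_absDet.pow_const _).inv

theorem lintegral_glHaar {m : ℕ} {F : Matrix (Fin m) (Fin m) ℝ → ℝ≥0∞} (hF : Measurable F) :
    ∫⁻ S, F S ∂glHaar m = ∫⁻ S, glDensity S * F S :=
  lintegral_withDensity_eq_lintegral_mul _ measurable_glDensity hF

instance (m : ℕ) : SFinite (glHaar m) := by unfold glHaar; infer_instance

/-- The numerator in `glDensity` is there for this: at a singular matrix `0 * ∞ = 0`, so singular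
matrices are null by construction and no argument about the Lebesgue measure of `det = 0` is needed.
-/
theorem ae_glHaar_det_ne_zero (m : ℕ) : ∀ᵐ S ∂glHaar m, S.det ≠ 0 := by
  rw [glHaar, ae_withDensity_iff measurable_glDensity]
  refine Filter.Eventually.of_forall fun S hS h => hS ?_
  simp [glDensity, absDet, h]

/-- The factor `absDet R ^ m` is the Jacobian of `S ↦ S * R` on square matrices, so this identity is
the invariance of `glHaar` in infinitesimal form. -/
theorem glDensity_eq_mul {m : ℕ} {R : Matrix (Fin m) (Fin m) ℝ} (hR : R.det ≠ 0)
    (S : Matrix (Fin m) (Fin m) ℝ) :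
    glDensity S = absDet R ^ m * glDensity (S * R) := by
  have h0 := absDet_ne_zero hR
  have ht := absDet_ne_top R
  have h0' := pow_ne_zero (m + 1) h0
  have ht' := ENNReal.pow_ne_top (n := m + 1) ht
  have h : absDet R ^ m * absDet R * (absDet R ^ (m + 1))⁻¹ = 1 := by
    rw [← pow_succ, ENNReal.mul_inv_cancel h0' ht']
  rw [glDensity, glDensity, absDet_mul, mul_pow, ENNReal.mul_inv (Or.inr ht') (Or.inr h0')]
  calc absDet S * (absDet S ^ (m + 1))⁻¹
      = absDet S * (absDet S ^ (m + 1))⁻¹ * 1 := (mul_one _).symm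
    _ = _ := by rw [← h]; ring

theorem lintegral_glHaar_mul_right {m : ℕ} {R : Matrix (Fin m) (Fin m) ℝ} (hR : R.det ≠ 0)
    {F : Matrix (Fin m) (Fin m) ℝ → ℝ≥0∞} (hF : Measurable F) :
    ∫⁻ S, F (S * R) ∂glHaar m = ∫⁻ S, F S ∂glHaar m := by
  have hd : Measurable fun S => glDensity S * F S := measurable_glDensity.mul hF
  rw [lintegral_glHaar hF,
    lintegral_glHaar (F := fun S => F (S * R)) (hF.comp (measurable_mul_right R)),
    ← lintegral_mul_right hR hd, ← lintegral_const_mul]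
  · refine lintegral_congr fun S => ?_
    rw [glDensity_eq_mul hR S, mul_assoc]
  · exact hd.comp (measurable_mul_right R)

/-- Left and right translations of square matrices have the same Jacobian, and `absDet` does not see
the order of the factors: the group is unimodular. -/
theorem lintegral_glHaar_mul_left {m : ℕ} {R : Matrix (Fin m) (Fin m) ℝ} (hR : R.det ≠ 0)
    {F : Matrix (Fin m) (Fin m) ℝ → ℝ≥0∞} (hF : Measurable F) :
    ∫⁻ S, F (R * S) ∂glHaar m = ∫⁻ S, F S ∂glHaar m := by
  have hd : Measurable fun S => glDensity S * F S := measurable_glDensity.mul hF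
  rw [lintegral_glHaar hF,
    lintegral_glHaar (F := fun S => F (R * S)) (hF.comp (measurable_mul_left R)),
    ← lintegral_mul_left hR hd, ← lintegral_const_mul]
  · refine lintegral_congr fun S => ?_
    rw [glDensity_eq_mul hR S, mul_assoc]
    simp only [glDensity, absDet_mul, mul_comm]
  · exact hd.comp (measurable_mul_left R)

theorem measurable_matrix_inv {m : ℕ} : Measurable fun S : Matrix (Fin m) (Fin m) ℝ => S⁻¹ := by
  have : (fun S : Matrix (Fin m) (Fin m) ℝ => S⁻¹) = fun S => (S.det)⁻¹ • S.adjugate := by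
    ext1 S; rw [Matrix.inv_def, Ring.inverse_eq_inv']
  rw [this]
  have hd : Measurable fun S : Matrix (Fin m) (Fin m) ℝ => S.det :=
    (Continuous.matrix_det continuous_id).measurable
  have hadj : Measurable fun S : Matrix (Fin m) (Fin m) ℝ => S.adjugate :=
    (Continuous.matrix_adjugate continuous_id).measurable
  refine measurable_pi_iff.2 fun i => measurable_pi_iff.2 fun j => ?_
  exact hd.inv.mul ((measurable_pi_apply j).comp ((measurable_pi_apply i).comp hadj))

theorem continuous_conj {m : ℕ} (G : Matrix (Fin m) (Fin m) ℝ) :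
    Continuous fun S : Matrix (Fin m) (Fin m) ℝ => S * G * Sᵀ :=
  (continuous_id.matrix_mul continuous_const).matrix_mul continuous_id.matrix_transpose

theorem continuous_mul_transpose {m : ℕ} :
    Continuous fun S : Matrix (Fin m) (Fin m) ℝ => S * Sᵀ :=
  continuous_id.matrix_mul continuous_id.matrix_transpose

/-! ### Gram matrices and averages over the general linear group -/

/-- The Gram matrix of the rows of `u` with respect to the form with matrix `A`. -/
def gram {m n : ℕ} (A : Matrix (Fin n) (Fin n) ℝ) (u : Matrix (Fin m) (Fin n) ℝ) :
    Matrix (Fin m) (Fin m) ℝ := u * A * uᵀ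

theorem gram_mul {m n : ℕ} (A : Matrix (Fin n) (Fin n) ℝ) (S : Matrix (Fin m) (Fin m) ℝ)
    (u : Matrix (Fin m) (Fin n) ℝ) : gram A (S * u) = S * gram A u * Sᵀ := by
  simp [gram, Matrix.transpose_mul, Matrix.mul_assoc]

theorem continuous_gram {m n : ℕ} (A : Matrix (Fin n) (Fin n) ℝ) :
    Continuous (gram A : Matrix (Fin m) (Fin n) ℝ → _) :=
  (continuous_id.matrix_mul continuous_const).matrix_mul continuous_id.matrix_transpose

theorem exists_eq_mul_transpose {m : ℕ} {G : Matrix (Fin m) (Fin m) ℝ} (hG : G.PosDef) :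
    ∃ R : Matrix (Fin m) (Fin m) ℝ, R.det ≠ 0 ∧ G = R * Rᵀ := by
  open scoped MatrixOrder in
  obtain ⟨B, hB⟩ := CStarAlgebra.nonneg_iff_eq_star_mul_self.mp hG.posSemidef.nonneg
  have hB' : G = Bᵀ * B := by
    rw [hB, Matrix.star_eq_conjTranspose, Matrix.conjTranspose_eq_transpose_of_trivial]
  refine ⟨Bᵀ, fun h => ?_, by simpa using hB'⟩
  have := hG.det_pos
  rw [hB', Matrix.det_mul, h, zero_mul] at this
  exact lt_irrefl _ this

/-- `√det`, in `ℝ≥0∞`. -/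
def sqrtDet {m : ℕ} (G : Matrix (Fin m) (Fin m) ℝ) : ℝ≥0∞ := ENNReal.ofReal √G.det

theorem sqrtDet_mul_transpose {m : ℕ} (R : Matrix (Fin m) (Fin m) ℝ) :
    sqrtDet (R * Rᵀ) = absDet R := by
  rw [sqrtDet, absDet, Matrix.det_mul, Matrix.det_transpose, Real.sqrt_mul_self_eq_abs]

theorem measurable_sqrtDet {m : ℕ} : Measurable (sqrtDet (m := m)) := by
  have : Continuous fun S : Matrix (Fin m) (Fin m) ℝ => S.det := continuous_id.matrix_det
  exact ENNReal.measurable_ofReal.comp this.sqrt.measurable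

/-- With `G = R * Rᵀ`, the translation `S ↦ S * R` absorbs `R`; the price is `absDet R ^ n`, which
equals `sqrtDet G ^ n`. -/
theorem lintegral_glHaar_conj {m : ℕ} (n : ℕ) {G : Matrix (Fin m) (Fin m) ℝ} (hG : G.PosDef)
    {b : Matrix (Fin m) (Fin m) ℝ → ℝ≥0∞} (hb : Measurable b) :
    ∫⁻ S, absDet S ^ n * b (S * G * Sᵀ) ∂glHaar m =
      (∫⁻ S, absDet S ^ n * b (S * Sᵀ) ∂glHaar m) * (sqrtDet G ^ n)⁻¹ := by
  obtain ⟨R, hR, rfl⟩ := exists_eq_mul_transpose hG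
  have hF : Measurable fun S : Matrix (Fin m) (Fin m) ℝ => absDet S ^ n * b (S * Sᵀ) :=
    (measurable_absDet.pow_const n).mul (hb.comp continuous_mul_transpose.measurable)
  rw [← lintegral_glHaar_mul_right hR hF, sqrtDet_mul_transpose, ← lintegral_mul_const]
  · refine lintegral_congr fun S => ?_
    rw [Matrix.transpose_mul, absDet_mul, mul_pow, mul_right_comm, mul_assoc (absDet S ^ n),
      ENNReal.mul_inv_cancel (pow_ne_zero n (absDet_ne_zero hR))
        (ENNReal.pow_ne_top (absDet_ne_top R)), mul_one]
    simp only [Matrix.mul_assoc]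
  · exact hF.comp (measurable_mul_right R)

/-- With `G = R * Rᵀ`, the translation `S ↦ R * S` cancels both factors of `G`. There is no
determinant in the integrand, hence no correction. -/
theorem lintegral_glHaar_inv_conj {m : ℕ} {G : Matrix (Fin m) (Fin m) ℝ} (hG : G.PosDef)
    {a : Matrix (Fin m) (Fin m) ℝ → ℝ≥0∞} (ha : Measurable a) :
    ∫⁻ S, a (S⁻¹ * G * S⁻¹ᵀ) ∂glHaar m = ∫⁻ S, a (S⁻¹ * S⁻¹ᵀ) ∂glHaar m := by
  obtain ⟨R, hR, rfl⟩ := exists_eq_mul_transpose hG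
  have hF : Measurable fun S : Matrix (Fin m) (Fin m) ℝ => a (S⁻¹ * (R * Rᵀ) * S⁻¹ᵀ) :=
    ha.comp ((continuous_conj (R * Rᵀ)).measurable.comp measurable_matrix_inv)
  rw [← lintegral_glHaar_mul_left hR hF]
  refine lintegral_congr fun S => ?_
  have h1 : R⁻¹ * R = 1 := Matrix.nonsing_inv_mul R (isUnit_iff_ne_zero.2 hR)
  have h2 : Rᵀ * R⁻¹ᵀ = 1 := by rw [← Matrix.transpose_mul, h1, Matrix.transpose_one]
  congr 1
  rw [Matrix.mul_inv_rev, Matrix.transpose_mul]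
  calc S⁻¹ * R⁻¹ * (R * Rᵀ) * (R⁻¹ᵀ * S⁻¹ᵀ)
      = S⁻¹ * (R⁻¹ * R) * (Rᵀ * R⁻¹ᵀ) * S⁻¹ᵀ := by simp only [Matrix.mul_assoc]
    _ = S⁻¹ * S⁻¹ᵀ := by rw [h1, h2]; simp

theorem continuous_gram_conj {m n : ℕ} (A : Matrix (Fin n) (Fin n) ℝ) :
    Continuous fun p : Matrix (Fin m) (Fin n) ℝ × Matrix (Fin m) (Fin m) ℝ =>
      p.2 * gram A p.1 * p.2ᵀ :=
  (continuous_snd.matrix_mul ((continuous_gram A).comp continuous_fst)).matrix_mul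
    continuous_snd.matrix_transpose

/-- For fixed `S` this is the substitution `u ↦ S * u`: `φ` does not change, Gram matrices are
conjugated, and `absDet S ^ n` is the Jacobian on matrices with `n` columns. -/
theorem lintegral_gram_slice {m n : ℕ} {A B : Matrix (Fin n) (Fin n) ℝ}
    {φ : Matrix (Fin m) (Fin n) ℝ → ℝ≥0∞} (hφ : Measurable φ)
    (hinv : ∀ (S : Matrix (Fin m) (Fin m) ℝ) (u : Matrix (Fin m) (Fin n) ℝ),
      S.det ≠ 0 → φ (S * u) = φ u)
    {a b : Matrix (Fin m) (Fin m) ℝ → ℝ≥0∞} (ha : Measurable a) (hb : Measurable b)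
    {S : Matrix (Fin m) (Fin m) ℝ} (hS : S.det ≠ 0) :
    ∫⁻ u, φ u * a (gram A u) * (absDet S ^ n * b (S * gram B u * Sᵀ)) =
      ∫⁻ u, φ u * b (gram B u) * a (S⁻¹ * gram A u * S⁻¹ᵀ) := by
  have hF : Measurable fun u : Matrix (Fin m) (Fin n) ℝ =>
      φ u * b (gram B u) * a (S⁻¹ * gram A u * S⁻¹ᵀ) :=
    (hφ.mul (hb.comp (continuous_gram B).measurable)).mul (ha.comp
      ((measurable_mul_right S⁻¹ᵀ).comp
        ((measurable_mul_left S⁻¹).comp (continuous_gram A).measurable)))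
  rw [← lintegral_mul_left hS hF, ← lintegral_const_mul]
  · refine lintegral_congr fun u => ?_
    have h1 : S⁻¹ * S = 1 := Matrix.nonsing_inv_mul S (isUnit_iff_ne_zero.2 hS)
    have h2 : S⁻¹ * gram A (S * u) * S⁻¹ᵀ = gram A u := by
      rw [← gram_mul, ← Matrix.mul_assoc, h1, Matrix.one_mul]
    rw [hinv S u hS, h2, gram_mul]
    ring
  · exact hF.comp (measurable_mul_left S)

theorem measurable_gram_pair {m n : ℕ} {A B : Matrix (Fin n) (Fin n) ℝ}
    {φ : Matrix (Fin m) (Fin n) ℝ → ℝ≥0∞} (hφ : Measurable φ)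
    {a b : Matrix (Fin m) (Fin m) ℝ → ℝ≥0∞} (ha : Measurable a) (hb : Measurable b) :
    Measurable fun p : Matrix (Fin m) (Fin n) ℝ × Matrix (Fin m) (Fin m) ℝ =>
      φ p.1 * a (gram A p.1) * (absDet p.2 ^ n * b (p.2 * gram B p.1 * p.2ᵀ)) := by
  have hgA := (continuous_gram (m := m) A).measurable
  have h1 : Measurable fun p : Matrix (Fin m) (Fin n) ℝ × Matrix (Fin m) (Fin m) ℝ =>
      φ p.1 * a (gram A p.1) := (hφ.mul (ha.comp hgA)).comp measurable_fst
  have h2 : Measurable fun p : Matrix (Fin m) (Fin n) ℝ × Matrix (Fin m) (Fin m) ℝ =>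
      absDet p.2 ^ n := (measurable_absDet.pow_const n).comp measurable_snd
  exact h1.mul (h2.mul (hb.comp (continuous_gram_conj B).measurable))

theorem measurable_gram_pair_inv {m n : ℕ} {A B : Matrix (Fin n) (Fin n) ℝ}
    {φ : Matrix (Fin m) (Fin n) ℝ → ℝ≥0∞} (hφ : Measurable φ)
    {a b : Matrix (Fin m) (Fin m) ℝ → ℝ≥0∞} (ha : Measurable a) (hb : Measurable b) :
    Measurable fun p : Matrix (Fin m) (Fin n) ℝ × Matrix (Fin m) (Fin m) ℝ =>
      φ p.1 * b (gram B p.1) * a (p.2⁻¹ * gram A p.1 * p.2⁻¹ᵀ) := by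
  have hgB := (continuous_gram (m := m) B).measurable
  have h1 : Measurable fun p : Matrix (Fin m) (Fin n) ℝ × Matrix (Fin m) (Fin m) ℝ =>
      φ p.1 * b (gram B p.1) := (hφ.mul (hb.comp hgB)).comp measurable_fst
  have h2 : Measurable fun p : Matrix (Fin m) (Fin n) ℝ × Matrix (Fin m) (Fin m) ℝ => p.2⁻¹ :=
    measurable_matrix_inv.comp measurable_snd
  have h3 : Measurable fun p : Matrix (Fin m) (Fin n) ℝ × Matrix (Fin m) (Fin m) ℝ =>
      a (p.2⁻¹ * gram A p.1 * p.2⁻¹ᵀ) := by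
    have := (ha.comp (continuous_gram_conj (m := m) A).measurable).comp (measurable_fst.prodMk h2)
    simpa only [Function.comp_def] using this
  exact h1.mul h3

/-- Two ways of computing an average over the row space: integrals against functions of the Gram
matrices of two different forms are proportional. -/
theorem lintegral_gram_swap {m n : ℕ} {A B : Matrix (Fin n) (Fin n) ℝ}
    {φ : Matrix (Fin m) (Fin n) ℝ → ℝ≥0∞} (hφ : Measurable φ)
    (hinv : ∀ (S : Matrix (Fin m) (Fin m) ℝ) (u : Matrix (Fin m) (Fin n) ℝ),
      S.det ≠ 0 → φ (S * u) = φ u)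
    (hA : ∀ u, φ u ≠ 0 → (gram A u).PosDef) (hB : ∀ u, φ u ≠ 0 → (gram B u).PosDef)
    {a b : Matrix (Fin m) (Fin m) ℝ → ℝ≥0∞} (ha : Measurable a) (hb : Measurable b) :
    (∫⁻ S, absDet S ^ n * b (S * Sᵀ) ∂glHaar m) *
        ∫⁻ u, φ u * (a (gram A u) * (sqrtDet (gram B u) ^ n)⁻¹) =
      (∫⁻ S, a (S⁻¹ * S⁻¹ᵀ) ∂glHaar m) * ∫⁻ u, φ u * b (gram B u) := by
  have hgA := (continuous_gram (m := m) A).measurable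
  have hgB := (continuous_gram (m := m) B).measurable
  have h1 : ∀ u, ∫⁻ S, φ u * a (gram A u) * (absDet S ^ n * b (S * gram B u * Sᵀ)) ∂glHaar m =
      (∫⁻ S, absDet S ^ n * b (S * Sᵀ) ∂glHaar m) *
        (φ u * (a (gram A u) * (sqrtDet (gram B u) ^ n)⁻¹)) := by
    intro u
    have hm : Measurable fun S : Matrix (Fin m) (Fin m) ℝ =>
        absDet S ^ n * b (S * gram B u * Sᵀ) :=
      (measurable_absDet.pow_const n).mul (hb.comp (continuous_conj (gram B u)).measurable)
    rw [lintegral_const_mul _ hm]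
    by_cases hu : φ u = 0
    · simp [hu]
    · rw [lintegral_glHaar_conj n (hB u hu) hb]; ring
  have h2 : ∀ u, ∫⁻ S, φ u * b (gram B u) * a (S⁻¹ * gram A u * S⁻¹ᵀ) ∂glHaar m =
      (∫⁻ S, a (S⁻¹ * S⁻¹ᵀ) ∂glHaar m) * (φ u * b (gram B u)) := by
    intro u
    have hm : Measurable fun S : Matrix (Fin m) (Fin m) ℝ => a (S⁻¹ * gram A u * S⁻¹ᵀ) :=
      ha.comp ((continuous_conj (gram A u)).measurable.comp measurable_matrix_inv)
    rw [lintegral_const_mul _ hm]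
    by_cases hu : φ u = 0
    · simp [hu]
    · rw [lintegral_glHaar_inv_conj (hA u hu) ha]; ring
  have hm1 : Measurable fun u => φ u * (a (gram A u) * (sqrtDet (gram B u) ^ n)⁻¹) :=
    hφ.mul ((ha.comp hgA).mul ((measurable_sqrtDet.comp hgB).pow_const n).inv)
  have hm2 : Measurable fun u => φ u * b (gram B u) := hφ.mul (hb.comp hgB)
  rw [← lintegral_const_mul _ hm1, ← lintegral_const_mul _ hm2, ← lintegral_congr h1,
    ← lintegral_congr h2]
  -- Both sides are now double integrals over `u` and `S`. After Fubini they agree for almost every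
  -- `S` by the slice identity.
  refine (lintegral_lintegral_swap (measurable_gram_pair hφ ha hb).aemeasurable).trans
    (Eq.trans ?_ (lintegral_lintegral_swap (measurable_gram_pair_inv hφ ha hb).aemeasurable).symm)
  exact lintegral_congr_ae ((ae_glHaar_det_ne_zero m).mono
    fun S hS => lintegral_gram_slice hφ hinv ha hb hS)

/-! ### Cut-off near the identity: the constants are positive and finite -/

/-- A compact neighbourhood of the identity matrix. -/
def nearOne (m : ℕ) : Set (Matrix (Fin m) (Fin m) ℝ) :=
  {G | 1 / 2 ≤ G.det ∧ ∀ i j, |G i j| ≤ 2}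

theorem isClosed_nearOne (m : ℕ) : IsClosed (nearOne m) := by
  have h : nearOne m = {G | 1 / 2 ≤ G.det} ∩ ⋂ i, ⋂ j, {G | |G i j| ≤ 2} := by
    ext G; simp [nearOne]
  rw [h]
  refine (isClosed_le continuous_const (Continuous.matrix_det continuous_id)).inter
    (isClosed_iInter fun i => isClosed_iInter fun j =>
      isClosed_le (Continuous.matrix_elem continuous_id i j).abs continuous_const)

/-- The interior part of `nearOne`. -/
theorem exists_isOpen_subset_nearOne (m : ℕ) : ∃ O ⊆ nearOne m, IsOpen O ∧ 1 ∈ O := by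
  refine ⟨{G | 1 / 2 < G.det} ∩ ⋂ i, ⋂ j, {G | |G i j| < 2}, ?_, ?_, ?_⟩
  · rintro G ⟨h1, h2⟩
    simp only [Set.mem_iInter, Set.mem_ofPred_eq] at h1 h2
    exact ⟨h1.le, fun i j => (h2 i j).le⟩
  · exact (isOpen_lt continuous_const (Continuous.matrix_det continuous_id)).inter
      (isOpen_iInter_of_finite fun i => isOpen_iInter_of_finite fun j =>
      isOpen_lt (Continuous.matrix_elem continuous_id i j).abs continuous_const)
  · simp only [Set.mem_inter_iff, Set.mem_ofPred_eq, Matrix.det_one, Set.mem_iInter]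
    refine ⟨by norm_num, fun i j => ?_⟩
    rw [Matrix.one_apply]
    split_ifs <;> norm_num

/-- The factors of the matrices of `nearOne`. -/
def nearOrtho (m : ℕ) : Set (Matrix (Fin m) (Fin m) ℝ) := {S | S * Sᵀ ∈ nearOne m}

theorem det_ne_zero_of_mem_nearOrtho {m : ℕ} {S : Matrix (Fin m) (Fin m) ℝ}
    (hS : S ∈ nearOrtho m) : S.det ≠ 0 := by
  intro h
  have := hS.1
  rw [Matrix.det_mul, h, zero_mul] at this
  norm_num at this

theorem isCompact_of_isClosed_of_abs_le {m n : ℕ} {s : Set (Matrix (Fin m) (Fin n) ℝ)}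
    (hs : IsClosed s) (C : ℝ) (hC : ∀ u ∈ s, ∀ i j, |u i j| ≤ C) : IsCompact s := by
  have h : IsCompact (Set.univ.pi fun _ : Fin m => Set.univ.pi fun _ : Fin n => Set.Icc (-C) C) :=
    isCompact_univ_pi fun _ => isCompact_univ_pi fun _ => isCompact_Icc
  refine h.of_isClosed_subset hs fun u hu i _ j _ => abs_le.1 (hC u hu i j)

/-- The diagonal entries of `S * Sᵀ` are the squared lengths of the rows of `S`. They are at most
`2`, which bounds every entry of `S`. -/
theorem isCompact_nearOrtho (m : ℕ) : IsCompact (nearOrtho m) := by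
  refine isCompact_of_isClosed_of_abs_le
    ((isClosed_nearOne m).preimage continuous_mul_transpose) 2 fun S hS i j => ?_
  have h := (abs_le.1 (hS.2 i i)).2
  rw [Matrix.mul_apply] at h
  have h2 : S i j * Sᵀ j i ≤ ∑ l, S i l * Sᵀ l i :=
    Finset.single_le_sum (f := fun l => S i l * Sᵀ l i)
      (fun l _ => by simpa using mul_self_nonneg (S i l)) (Finset.mem_univ j)
  rw [Matrix.transpose_apply] at h2
  exact abs_le_of_sq_le_sq (by nlinarith) (by norm_num)

theorem continuousOn_matrix_inv {m : ℕ} :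
    ContinuousOn (fun S : Matrix (Fin m) (Fin m) ℝ => S⁻¹) {S | S.det ≠ 0} := by
  have : (fun S : Matrix (Fin m) (Fin m) ℝ => S⁻¹) = fun S => (S.det)⁻¹ • S.adjugate := by
    ext1 S; rw [Matrix.inv_def, Ring.inverse_eq_inv']
  rw [this]
  exact ((Continuous.matrix_det continuous_id).continuousOn.inv₀ fun S hS => hS).smul
    (Continuous.matrix_adjugate continuous_id).continuousOn

theorem glHaar_lt_top_of_isCompact {m : ℕ} {s : Set (Matrix (Fin m) (Fin m) ℝ)} (hs : IsCompact s)
    (h0 : ∀ S ∈ s, S.det ≠ 0) : glHaar m s < ∞ := by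
  have hc : ContinuousOn (fun S : Matrix (Fin m) (Fin m) ℝ => |S.det| * (|S.det| ^ (m + 1))⁻¹) s :=
    have hd := (Continuous.matrix_det (continuous_id (X := Matrix (Fin m) (Fin m) ℝ))).abs
    hd.continuousOn.mul ((hd.pow _).continuousOn.inv₀
      fun S hS => pow_ne_zero _ (abs_ne_zero.2 (h0 S hS)))
  obtain ⟨C, hC⟩ := hs.exists_bound_of_continuousOn hc
  have hm := hs.isClosed.measurableSet
  rw [glHaar, withDensity_apply _ hm]
  refine lt_of_le_of_lt (setLIntegral_mono' (g := fun _ => ENNReal.ofReal C) hm fun S hS => ?_) ?_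
  · have hp : 0 < |S.det| := abs_pos.2 (h0 S hS)
    rw [glDensity, absDet, ← ENNReal.ofReal_pow (abs_nonneg _),
      ← ENNReal.ofReal_inv_of_pos (pow_pos hp _), ← ENNReal.ofReal_mul (abs_nonneg _)]
    exact ENNReal.ofReal_le_ofReal ((le_abs_self _).trans (hC S hS))
  · rw [setLIntegral_const]
    exact ENNReal.mul_lt_top ENNReal.ofReal_lt_top hs.measure_lt_top

theorem glHaar_pos_of_isOpen {m : ℕ} {s : Set (Matrix (Fin m) (Fin m) ℝ)} (hs : IsOpen s)
    (h1 : 1 ∈ s) : glHaar m s ≠ 0 := by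
  intro h
  rw [glHaar, withDensity_apply_eq_zero measurable_glDensity] at h
  have hset : {S : Matrix (Fin m) (Fin m) ℝ | glDensity S ≠ 0} ∩ s =
      {S : Matrix (Fin m) (Fin m) ℝ | S.det ≠ 0} ∩ s := by
    ext S
    simp only [Set.mem_inter_iff, Set.mem_ofPred_eq, and_congr_left_iff]
    intro _
    constructor
    · intro h h'; simp [glDensity, absDet, h'] at h
    · intro h
      exact mul_ne_zero (absDet_ne_zero h)
        (ENNReal.inv_ne_zero.2 (ENNReal.pow_ne_top (absDet_ne_top S)))
  rw [hset] at h
  have ho : IsOpen ({S : Matrix (Fin m) (Fin m) ℝ | S.det ≠ 0} ∩ s) :=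
    ((isOpen_ne).preimage (Continuous.matrix_det continuous_id)).inter hs
  exact ho.measure_ne_zero volume ⟨1, by simp, h1⟩ h

theorem lintegral_glHaar_ne_zero {m : ℕ} {s : Set (Matrix (Fin m) (Fin m) ℝ)} (hs : IsOpen s)
    (h1 : 1 ∈ s) {F : Matrix (Fin m) (Fin m) ℝ → ℝ≥0∞} (hF : Measurable F)
    (h : ∀ S ∈ s, F S ≠ 0) : ∫⁻ S, F S ∂glHaar m ≠ 0 := by
  intro h0
  rw [lintegral_eq_zero_iff hF] at h0
  exact glHaar_pos_of_isOpen hs h1 (measure_mono_null (fun S hS => h S hS) (ae_iff.1 h0))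

theorem lintegral_glHaar_ne_top {m : ℕ} {s : Set (Matrix (Fin m) (Fin m) ℝ)} (hs : IsCompact s)
    (hdet : ∀ S ∈ s, S.det ≠ 0) {F : Matrix (Fin m) (Fin m) ℝ → ℝ≥0∞} {C : ℝ}
    (h : ∀ S ∈ s, F S ≤ ENNReal.ofReal C) (h0 : ∀ S, S ∉ s → F S = 0) :
    ∫⁻ S, F S ∂glHaar m ≠ ∞ := by
  have hm := hs.isClosed.measurableSet
  refine ((lintegral_mono (g := s.indicator fun _ => ENNReal.ofReal C) fun S => ?_).trans_lt
    ?_).ne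
  · by_cases hS : S ∈ s
    · simpa [hS] using h S hS
    · simp [h0 S hS]
  · rw [lintegral_indicator_const hm]
    exact ENNReal.mul_lt_top ENNReal.ofReal_lt_top (glHaar_lt_top_of_isCompact hs hdet)

theorem exists_absDet_le_of_isCompact {m : ℕ} (n : ℕ) {s : Set (Matrix (Fin m) (Fin m) ℝ)}
    (hs : IsCompact s) : ∃ C : ℝ, ∀ S ∈ s, absDet S ^ n ≤ ENNReal.ofReal C := by
  obtain ⟨C, hC⟩ := hs.exists_bound_of_continuousOn
    (f := fun S : Matrix (Fin m) (Fin m) ℝ => |S.det| ^ n)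
    ((Continuous.matrix_det continuous_id).abs.pow n).continuousOn
  refine ⟨C, fun S hS => ?_⟩
  rw [absDet, ← ENNReal.ofReal_pow (abs_nonneg _)]
  exact ENNReal.ofReal_le_ofReal ((le_abs_self _).trans (hC S hS))

/-- The volumes attached to two forms on the tuples of row vectors are proportional, after
integration along the row spaces, with a density given by the ratio of Gram determinants. -/
theorem exists_lintegral_gram_eq (m n : ℕ) : ∃ c : ℝ≥0∞, c ≠ 0 ∧ c ≠ ∞ ∧
    ∀ (A B : Matrix (Fin n) (Fin n) ℝ) (φ : Matrix (Fin m) (Fin n) ℝ → ℝ≥0∞), Measurable φ →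
    (∀ (S : Matrix (Fin m) (Fin m) ℝ) (u : Matrix (Fin m) (Fin n) ℝ),
      S.det ≠ 0 → φ (S * u) = φ u) →
    (∀ u, φ u ≠ 0 → (gram A u).PosDef) → (∀ u, φ u ≠ 0 → (gram B u).PosDef) →
    c * ∫⁻ u in {u | gram A u ∈ nearOne m},
        φ u * (sqrtDet (gram A u) ^ n * (sqrtDet (gram B u) ^ n)⁻¹) =
      ∫⁻ u in {u | gram B u ∈ nearOne m}, φ u := by
  have hK := (isClosed_nearOne m).measurableSet
  -- The indicators cut the orbits of the general linear group down to sets of finite nonzero Haar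
  -- measure. The factor `sqrtDet G ^ n` in `a` creates the ratio of the two Gram determinants,
  -- which depends on the row space only.
  set a : Matrix (Fin m) (Fin m) ℝ → ℝ≥0∞ := (nearOne m).indicator fun G => sqrtDet G ^ n with ha'
  set b : Matrix (Fin m) (Fin m) ℝ → ℝ≥0∞ := (nearOne m).indicator 1 with hb'
  have ha : Measurable a := (measurable_sqrtDet.pow_const n).indicator hK
  have hb : Measurable b := measurable_one.indicator hK
  obtain ⟨O, hOK, hO, h1O⟩ := exists_isOpen_subset_nearOne m
  have hFb : Measurable fun S : Matrix (Fin m) (Fin m) ℝ => absDet S ^ n * b (S * Sᵀ) :=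
    (measurable_absDet.pow_const n).mul (hb.comp continuous_mul_transpose.measurable)
  have hFa : Measurable fun S : Matrix (Fin m) (Fin m) ℝ => a (S⁻¹ * S⁻¹ᵀ) :=
    ha.comp (continuous_mul_transpose.measurable.comp measurable_matrix_inv)
  have hcomp := isCompact_nearOrtho m
  have hcomp' : IsCompact ((fun S : Matrix (Fin m) (Fin m) ℝ => S⁻¹) '' nearOrtho m) :=
    hcomp.image_of_continuousOn (continuousOn_matrix_inv.mono
      fun S hS => det_ne_zero_of_mem_nearOrtho hS)
  obtain ⟨C, hC⟩ := exists_absDet_le_of_isCompact n hcomp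
  have hb0 : ∫⁻ S, absDet S ^ n * b (S * Sᵀ) ∂glHaar m ≠ 0 := by
    refine lintegral_glHaar_ne_zero (hO.preimage continuous_mul_transpose) (by simpa using h1O)
      hFb fun S hS => ?_
    have hS' : S * Sᵀ ∈ nearOne m := hOK hS
    rw [hb', Set.indicator_of_mem hS']
    simpa using fun h => absurd h (absDet_ne_zero (det_ne_zero_of_mem_nearOrtho hS'))
  have hbt : ∫⁻ S, absDet S ^ n * b (S * Sᵀ) ∂glHaar m ≠ ∞ := by
    refine lintegral_glHaar_ne_top hcomp (fun S hS => det_ne_zero_of_mem_nearOrtho hS)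
      (C := C) (fun S hS => ?_) fun S hS => ?_
    · have hS' : S * Sᵀ ∈ nearOne m := hS
      rw [hb', Set.indicator_of_mem hS']
      simpa using hC S hS
    · have hS' : S * Sᵀ ∉ nearOne m := hS
      rw [hb', Set.indicator_of_notMem hS', mul_zero]
  have ha0 : ∫⁻ S, a (S⁻¹ * S⁻¹ᵀ) ∂glHaar m ≠ 0 := by
    have ho : IsOpen ({S : Matrix (Fin m) (Fin m) ℝ | S.det ≠ 0} ∩
        (fun S => S⁻¹) ⁻¹' {S | S * Sᵀ ∈ O}) :=
      continuousOn_matrix_inv.isOpen_inter_preimage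
        ((isOpen_ne).preimage (Continuous.matrix_det continuous_id))
        (hO.preimage continuous_mul_transpose)
    refine lintegral_glHaar_ne_zero ho ⟨by simp, by simpa using h1O⟩ hFa fun S hS => ?_
    have hS' : S⁻¹ * S⁻¹ᵀ ∈ nearOne m := hOK hS.2
    rw [ha', Set.indicator_of_mem hS', sqrtDet_mul_transpose]
    exact pow_ne_zero _ (absDet_ne_zero (det_ne_zero_of_mem_nearOrtho hS'))
  have hat : ∫⁻ S, a (S⁻¹ * S⁻¹ᵀ) ∂glHaar m ≠ ∞ := by
    refine lintegral_glHaar_ne_top hcomp' ?_ (C := C) ?_ fun S hS => ?_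
    · rintro _ ⟨S, hS, rfl⟩
      have := det_ne_zero_of_mem_nearOrtho hS
      simpa [Matrix.det_nonsing_inv] using this
    · rintro _ ⟨S, hS, rfl⟩
      have hd := det_ne_zero_of_mem_nearOrtho hS
      have hS' : S * Sᵀ ∈ nearOne m := hS
      simp only [Matrix.nonsing_inv_nonsing_inv S (isUnit_iff_ne_zero.2 hd)]
      rw [ha', Set.indicator_of_mem hS', sqrtDet_mul_transpose]
      exact hC S hS
    · refine Set.indicator_of_notMem (s := nearOne m) (a := S⁻¹ * S⁻¹ᵀ)
        (fun h => hS ⟨S⁻¹, h, ?_⟩) _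
      have hd := det_ne_zero_of_mem_nearOrtho (S := S⁻¹) h
      refine Matrix.nonsing_inv_nonsing_inv S (isUnit_iff_ne_zero.2 fun h0 => hd ?_)
      simp [Matrix.det_nonsing_inv, h0]
  -- The constant involves only `m` and `n`, neither of the forms nor `φ`; one constant will serve
  -- all curvatures.
  refine ⟨(∫⁻ S, absDet S ^ n * b (S * Sᵀ) ∂glHaar m) / ∫⁻ S, a (S⁻¹ * S⁻¹ᵀ) ∂glHaar m,
    ENNReal.div_ne_zero.2 ⟨hb0, hat⟩, ENNReal.div_ne_top hbt ha0,
    fun A B φ hφ hinv hA hB => ?_⟩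
  have hmA : MeasurableSet {u : Matrix (Fin m) (Fin n) ℝ | gram A u ∈ nearOne m} :=
    (continuous_gram A).measurable hK
  have hmB : MeasurableSet {u : Matrix (Fin m) (Fin n) ℝ | gram B u ∈ nearOne m} :=
    (continuous_gram B).measurable hK
  have key := lintegral_gram_swap hφ hinv hA hB ha hb
  rw [← lintegral_indicator hmA, ← lintegral_indicator hmB]
  have e1 : ∀ u, φ u * (a (gram A u) * (sqrtDet (gram B u) ^ n)⁻¹) =
      {u | gram A u ∈ nearOne m}.indicator
        (fun u => φ u * (sqrtDet (gram A u) ^ n * (sqrtDet (gram B u) ^ n)⁻¹)) u := by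
    intro u
    by_cases h : gram A u ∈ nearOne m
    · rw [ha', Set.indicator_of_mem h, Set.indicator_of_mem (by exact h)]
    · rw [ha', Set.indicator_of_notMem h, Set.indicator_of_notMem (by exact h)]; simp
  have e2 : ∀ u, φ u * b (gram B u) = {u | gram B u ∈ nearOne m}.indicator φ u := by
    intro u
    by_cases h : gram B u ∈ nearOne m
    · rw [hb', Set.indicator_of_mem h, Set.indicator_of_mem (by exact h)]; simp
    · rw [hb', Set.indicator_of_notMem h, Set.indicator_of_notMem (by exact h)]; simp
  rw [lintegral_congr e1, lintegral_congr e2] at key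
  rw [ENNReal.div_eq_inv_mul, mul_assoc, key, ← mul_assoc, ENNReal.inv_mul_cancel ha0 hat, one_mul]

end KPlane

end

noncomputable section

namespace KPlane

/-! ### Uniqueness of invariant measures -/

section Uniqueness

variable {G X : Type*} [MeasurableSpace G] [MeasurableSpace X]

/-- If the orbit maps `γ ↦ a γ x`, `x ∈ S`, have the same null sets, then these are the null sets of
every invariant measure. -/
theorem measure_eq_zero_iff_of_invariant (l : Measure G) [SFinite l] (hl : l ≠ 0) {a : G → X → X}
    (ha : Measurable (Function.uncurry a)) {S : Set X} (μ : Measure X) [SFinite μ] (hμ0 : μ ≠ 0)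
    (hμS : ∀ᵐ x ∂μ, x ∈ S) (hμ : ∀ γ, μ.map (a γ) = μ)
    (hnull : ∀ x ∈ S, ∀ y ∈ S, ∀ A, MeasurableSet A →
      l {γ | a γ x ∈ A} = 0 → l {γ | a γ y ∈ A} = 0) {A : Set X} (hA : MeasurableSet A) :
    μ A = 0 ↔ ∀ x ∈ S, l {γ | a γ x ∈ A} = 0 := by
  have hP : MeasurableSet (Function.uncurry a ⁻¹' A) := ha hA
  have hγ : ∀ γ, Measurable (a γ) := fun γ => ha.comp measurable_prodMk_left
  -- The set of pairs `(γ, x)` with `a γ x ∈ A` is measured in two ways. Its slice at `γ` has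
  -- measure `μ A` by invariance; its slice at `x` is a preimage under an orbit map.
  have h1 : l.prod μ (Function.uncurry a ⁻¹' A) = μ A * l Set.univ := by
    rw [Measure.prod_apply hP, ← lintegral_const]
    refine lintegral_congr fun γ => ?_
    conv_rhs => rw [← hμ γ, Measure.map_apply (hγ γ) hA]
    rfl
  have h2 : l.prod μ (Function.uncurry a ⁻¹' A) = ∫⁻ x, l {γ | a γ x ∈ A} ∂μ :=
    Measure.prod_apply_symm hP
  have hm : Measurable fun x => l {γ | a γ x ∈ A} := measurable_measure_prodMk_right hP
  constructor
  · intro h x hx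
    rw [h, zero_mul, h2, lintegral_eq_zero_iff hm] at h1
    have : NeZero μ := ⟨hμ0⟩
    obtain ⟨y, hy, hyS⟩ := (h1.and hμS).exists
    exact hnull y hyS x hx A hA hy
  · intro h
    rw [h2, lintegral_congr_ae (g := 0) (hμS.mono fun x hx => h x hx), Pi.zero_def,
      lintegral_zero] at h1
    rcases mul_eq_zero.1 h1.symm with hA0 | hl0
    · exact hA0
    · exact absurd (Measure.measure_univ_eq_zero.1 hl0) hl

/-- Two invariant σ-finite measures are proportional if the orbit maps have the same null sets. -/
theorem exists_eq_smul_of_invariant (l : Measure G) [SFinite l] (hl : l ≠ 0) {a : G → X → X}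
    (ha : Measurable (Function.uncurry a)) (hinv : ∀ γ, ∃ γ', ∀ x, a γ' (a γ x) = x)
    {S : Set X} (μ ν : Measure X) [SigmaFinite μ] [SigmaFinite ν] (hμ0 : μ ≠ 0) (hν0 : ν ≠ 0)
    (hμS : ∀ᵐ x ∂μ, x ∈ S) (hνS : ∀ᵐ x ∂ν, x ∈ S)
    (hμ : ∀ γ, μ.map (a γ) = μ) (hν : ∀ γ, ν.map (a γ) = ν)
    (hnull : ∀ x ∈ S, ∀ y ∈ S, ∀ A, MeasurableSet A →
      l {γ | a γ x ∈ A} = 0 → l {γ | a γ y ∈ A} = 0) :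
    ∃ c : ℝ≥0∞, c ≠ 0 ∧ c ≠ ∞ ∧ μ = c • ν := by
  have hγ : ∀ γ, Measurable (a γ) := fun γ => ha.comp measurable_prodMk_left
  have hac : μ ≪ ν := Measure.AbsolutelyContinuous.mk fun A hA h =>
    (measure_eq_zero_iff_of_invariant l hl ha μ hμ0 hμS hμ hnull hA).2
      ((measure_eq_zero_iff_of_invariant l hl ha ν hν0 hνS hν hnull hA).1 h)
  set ρ := μ.rnDeriv ν with hρ
  have hρm : Measurable ρ := Measure.measurable_rnDeriv μ ν
  have hdens : ν.withDensity ρ = μ := Measure.withDensity_rnDeriv_eq μ ν hac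
  -- By invariance of both measures `ρ ∘ a γ` is again a density of `μ` with respect to `ν`, and
  -- densities are unique almost everywhere.
  have hρinv : ∀ γ, ∀ᵐ x ∂ν, ρ (a γ x) = ρ x := by
    intro γ
    obtain ⟨γ', hγ'⟩ := hinv γ
    have e : ν.withDensity (fun x => ρ (a γ x)) = ν.withDensity ρ := by
      rw [hdens]
      ext B hB
      have hB' : MeasurableSet (a γ' ⁻¹' B) := hγ γ' hB
      have hBB : B = a γ ⁻¹' (a γ' ⁻¹' B) := by ext x; simp [hγ']
      rw [withDensity_apply _ hB]
      conv_lhs => rw [hBB]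
      rw [← setLIntegral_map hB' hρm (hγ γ), hν γ, ← withDensity_apply _ hB', hdens,
        ← Measure.map_apply (hγ γ') hB, hμ γ']
    exact (withDensity_eq_iff_of_sigmaFinite (hρm.comp (hγ γ)).aemeasurable hρm.aemeasurable).1 e
  have hset : MeasurableSet {p : G × X | ρ (a p.1 p.2) = ρ p.2} :=
    measurableSet_eq_fun (hρm.comp ha) (hρm.comp measurable_snd)
  -- Fubini exchanges the quantifiers: for almost every `x` the density is almost everywhere
  -- constant along the orbit of `x`. One such `x` in `S` suffices, because all orbit maps have the
  -- same null sets.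
  have hsw : ∀ᵐ x ∂ν, ∀ᵐ γ ∂l, ρ (a γ x) = ρ x := by
    have h1 : ∀ᵐ p ∂l.prod ν, ρ (a p.1 p.2) = ρ p.2 :=
      (Measure.ae_prod_iff_ae_ae hset).2 (Filter.Eventually.of_forall hρinv)
    have h2 : ∀ᵐ p ∂ν.prod l, ρ (a p.2 p.1) = ρ p.1 := by
      have := Measure.prod_swap (μ := ν) (ν := l)
      rw [← this] at h1
      exact ae_of_ae_map measurable_swap.aemeasurable h1
    exact Measure.ae_ae_of_ae_prod h2
  have : NeZero ν := ⟨hν0⟩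
  obtain ⟨x, hx, hxS⟩ := (hsw.and hνS).exists
  have hA : MeasurableSet {y | ρ y ≠ ρ x} := (measurableSet_eq_fun hρm measurable_const).compl
  have hae : ∀ᵐ y ∂ν, ρ y = ρ x := by
    rw [ae_iff]
    refine (measure_eq_zero_iff_of_invariant l hl ha ν hν0 hνS hν hnull hA).2 fun y hy => ?_
    exact hnull x hxS y hy _ hA (ae_iff.1 hx)
  have heq : μ = ρ x • ν := by
    rw [← hdens, withDensity_congr_ae hae, withDensity_const]
  refine ⟨ρ x, ?_, ?_, heq⟩
  · intro h
    rw [h, zero_smul] at heq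
    exact hμ0 heq
  · intro h
    obtain ⟨y, hy, hy'⟩ := (hae.and (Measure.rnDeriv_lt_top μ ν)).exists
    exact hy'.ne (hy.trans h)

/-- Two σ-finite measures that are invariant under a locally compact group, and concentrated on an
orbit, are proportional. -/
theorem exists_eq_smul_of_transitive {H : Type*} [Group H] [TopologicalSpace H]
    [IsTopologicalGroup H] [LocallyCompactSpace H] [SecondCountableTopology H] [MeasurableSpace H]
    [BorelSpace H] {a : H → X → X}
    (ha : Measurable (Function.uncurry a)) (hone : ∀ x, a 1 x = x)
    (hmul : ∀ g h x, a (g * h) x = a g (a h x)) {S : Set X} (hS : ∀ x ∈ S, ∀ y ∈ S, ∃ g, a g x = y)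
    (μ ν : Measure X) [SigmaFinite μ] [SigmaFinite ν] (hμ0 : μ ≠ 0) (hν0 : ν ≠ 0)
    (hμS : ∀ᵐ x ∂μ, x ∈ S) (hνS : ∀ᵐ x ∂ν, x ∈ S)
    (hμ : ∀ g, μ.map (a g) = μ) (hν : ∀ g, ν.map (a g) = ν) :
    ∃ c : ℝ≥0∞, c ≠ 0 ∧ c ≠ ∞ ∧ μ = c • ν := by
  -- The action is through `g⁻¹`, so that the orbit maps of `x` and of `g x` differ by a left
  -- translation of the group, under which Haar measure is invariant.
  refine exists_eq_smul_of_invariant (G := H) Measure.haar (NeZero.ne _) (a := fun g => a g⁻¹)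
    (ha.comp (measurable_fst.inv.prodMk measurable_snd))
    (fun g => ⟨g⁻¹, fun x => by rw [← hmul]; simp [hone]⟩) μ ν hμ0 hν0 hμS hνS
    (fun g => hμ g⁻¹) (fun g => hν g⁻¹) fun x hx y hy A _ h => ?_
  obtain ⟨g, rfl⟩ := hS x hx y hy
  have : {γ | a γ⁻¹ (a g x) ∈ A} = (fun γ => g⁻¹ * γ) ⁻¹' {γ | a γ⁻¹ x ∈ A} := by
    ext γ; simp [← hmul]
  rw [this, measure_preimage_mul]
  exact h

end Uniqueness

end KPlane

end

noncomputable section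

namespace KPlane

open scoped Matrix

/-! ### Matrices acting on column vectors -/

/-- A matrix acting on Euclidean column vectors. -/
def mv {m n : ℕ} (A : Matrix (Fin m) (Fin n) ℝ) : E n →ₗ[ℝ] E m where
  toFun x := WithLp.toLp 2 (A *ᵥ x.ofLp)
  map_add' x y := by simp [Matrix.mulVec_add]
  map_smul' c x := by simp [Matrix.mulVec_smul]

theorem mv_apply {m n : ℕ} (A : Matrix (Fin m) (Fin n) ℝ) (x : E n) (i : Fin m) :
    mv A x i = ∑ j, A i j * x j := rfl

theorem mv_mul {l m n : ℕ} (A : Matrix (Fin l) (Fin m) ℝ) (B : Matrix (Fin m) (Fin n) ℝ) (x : E n) :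
    mv (A * B) x = mv A (mv B x) := by
  simp [mv, Matrix.mulVec_mulVec]

@[simp] theorem mv_one {n : ℕ} (x : E n) : mv (1 : Matrix (Fin n) (Fin n) ℝ) x = x := by
  simp [mv]

theorem continuous_mv {m n : ℕ} :
    Continuous fun p : Matrix (Fin m) (Fin n) ℝ × E n => mv p.1 p.2 := by
  refine (PiLp.continuous_toLp 2 _).comp ?_
  exact continuous_fst.matrix_mulVec ((PiLp.continuous_ofLp 2 _).comp continuous_snd)

theorem mv_inv_mv {n : ℕ} (g : GL (Fin n) ℝ) (x : E n) :
    mv (g⁻¹).val (mv g.val x) = x := by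
  rw [← mv_mul, Units.inv_mul, mv_one]

theorem mv_mv_inv {n : ℕ} (g : GL (Fin n) ℝ) (x : E n) :
    mv g.val (mv (g⁻¹).val x) = x := by
  rw [← mv_mul, Units.mul_inv, mv_one]

theorem mv_injective {n : ℕ} (g : GL (Fin n) ℝ) :
    Function.Injective (mv g.val) :=
  Function.LeftInverse.injective (mv_inv_mv g)

/-! ### The Grassmannian -/

/-- The Grassmannian of linear subspaces of dimension `k + 1` of `ℝᵈ⁺¹`. -/
abbrev Gr (d k : ℕ) : Type := {W : Submodule ℝ (E (d + 1)) // Module.finrank ℝ W = k + 1}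

/-- The set of subspaces that hit a given set. -/
def hits {d : ℕ} (k : ℕ) (O : Set (E (d + 1))) : Set (Gr d k) :=
  {W | ((W.1 : Set (E (d + 1))) ∩ O).Nonempty}

instance (d k : ℕ) : MeasurableSpace (Gr d k) :=
  MeasurableSpace.generateFrom {A | ∃ O : Set (E (d + 1)), IsOpen O ∧ A = hits k O}

theorem measurableSet_hits {d k : ℕ} {O : Set (E (d + 1))} (hO : IsOpen O) :
    MeasurableSet (hits k O) :=
  MeasurableSpace.measurableSet_generateFrom ⟨O, hO, rfl⟩

theorem measurable_of_hits {X : Type*} [MeasurableSpace X] {d k : ℕ} {f : X → Gr d k}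
    (h : ∀ O : Set (E (d + 1)), IsOpen O → MeasurableSet (f ⁻¹' hits k O)) : Measurable f := by
  refine measurable_generateFrom ?_
  rintro _ ⟨O, hO, rfl⟩
  exact h O hO

/-- The action of the general linear group on the Grassmannian. -/
def act {d k : ℕ} (g : GL (Fin (d + 1)) ℝ) (W : Gr d k) : Gr d k :=
  ⟨W.1.map (mv g.val),
    (LinearEquiv.finrank_eq (Submodule.equivMapOfInjective (mv g.val) (mv_injective g) W.1)).symm.trans W.2⟩

theorem act_one {d k : ℕ} (W : Gr d k) : act 1 W = W := by
  refine Subtype.ext ?_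
  ext x
  simp [act]

theorem act_mul {d k : ℕ} (g h : GL (Fin (d + 1)) ℝ) (W : Gr d k) :
    act (g * h) W = act g (act h W) := by
  refine Subtype.ext ?_
  ext x
  simp [act, mv_mul]

theorem mem_act {d k : ℕ} {g : GL (Fin (d + 1)) ℝ} {W : Gr d k} {x : E (d + 1)} :
    x ∈ (act g W).1 ↔ mv (g⁻¹).val x ∈ W.1 := by
  constructor
  · rintro ⟨y, hy, rfl⟩
    rw [mv_inv_mv]; exact hy
  · intro h
    exact ⟨_, h, mv_mv_inv g x⟩

/-- The tube lemma. -/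
theorem isOpen_forall_mem_of_isCompact {X Y Z : Type*} [TopologicalSpace X] [TopologicalSpace Y]
    [TopologicalSpace Z] {f : X → Y → Z} (hf : Continuous (Function.uncurry f)) {K : Set Y}
    (hK : IsCompact K) {O : Set Z} (hO : IsOpen O) : IsOpen {x | ∀ y ∈ K, f x y ∈ O} := by
  rw [isOpen_iff_eventually]
  intro x hx
  refine hK.eventually_forall_of_forall_eventually fun y hy => ?_
  exact (hO.preimage hf).mem_nhds (hx y hy)

/-- The action on the Grassmannian is jointly measurable. -/
theorem measurable_act {H : Type*} [TopologicalSpace H] [MeasurableSpace H] [BorelSpace H] {d k : ℕ}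
    {ι : H → GL (Fin (d + 1)) ℝ} (hι : Continuous ι) :
    Measurable fun p : H × Gr d k => act (ι p.1) p.2 := by
  refine measurable_of_hits fun O hO => ?_
  set B := TopologicalSpace.countableBasis (E (d + 1))
  have hB := TopologicalSpace.isBasis_countableBasis (E (d + 1))
  have hf : Continuous (Function.uncurry fun (g : H) (x : E (d + 1)) =>
      mv (ι g).val x) :=
    continuous_mv.comp ((Units.continuous_val.comp (hι.comp continuous_fst)).prodMk continuous_snd)
  -- The image of `W` meets `O` iff `W` meets a basic open set whose closure is compact and is
  -- mapped into `O`. This separates the two variables: the preimage is a countable union of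
  -- rectangles.
  have hset : (fun p : H × Gr d k => act (ι p.1) p.2) ⁻¹' hits k O =
      ⋃ b ∈ {b ∈ B | IsCompact (closure b)},
        {g : H | ∀ x ∈ closure b, mv (ι g).val x ∈ O} ×ˢ
          hits k b := by
    ext ⟨g, W⟩
    simp only [Set.mem_preimage, Set.mem_iUnion, Set.mem_prod, exists_prop]
    constructor
    · rintro ⟨_, ⟨x, hx, rfl⟩, hxO⟩
      have ho : IsOpen {y | mv (ι g).val y ∈ O} :=
        hO.preimage (hf.comp (Continuous.prodMk_right g))
      obtain ⟨K, hK, hxK, hKO⟩ := exists_compact_subset ho hxO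
      obtain ⟨b, hb, hxb, hbK⟩ := hB.exists_subset_of_mem_open hxK isOpen_interior
      have hcl : closure b ⊆ K := closure_minimal (hbK.trans interior_subset) hK.isClosed
      exact ⟨b, ⟨hb, hK.of_isClosed_subset isClosed_closure hcl⟩, fun y hy => hKO (hcl hy),
        x, hx, hxb⟩
    · rintro ⟨b, -, hg, x, hx, hxb⟩
      exact ⟨_, ⟨x, hx, rfl⟩, hg x (subset_closure hxb)⟩
  rw [hset]
  refine MeasurableSet.biUnion
    ((TopologicalSpace.countable_countableBasis (E (d + 1))).mono (Set.sep_subset _ _))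
    fun b hb => ?_
  exact (isOpen_forall_mem_of_isCompact hf hb.2 hO).measurableSet.prod
    (measurableSet_hits (hB.isOpen hb.1))

theorem measurable_act_right {d k : ℕ} (g : GL (Fin (d + 1)) ℝ) :
    Measurable (act g : Gr d k → Gr d k) := by
  refine measurable_of_hits fun O hO => ?_
  have : act g ⁻¹' hits k O = hits k (mv g.val ⁻¹' O) := by
    ext W
    constructor
    · rintro ⟨_, ⟨x, hx, rfl⟩, hxO⟩
      exact ⟨x, hx, hxO⟩
    · rintro ⟨x, hx, hxO⟩
      exact ⟨_, ⟨x, hx, rfl⟩, hxO⟩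
  rw [this]
  exact measurableSet_hits (hO.preimage (continuous_mv.comp (Continuous.prodMk_right _)))

/-- Subspaces are closed, so a point of one outside the other has a basic neighbourhood that misses
the other. Countable separation allows measurability on the Grassmannian to be tested along a Borel
surjection from a Polish space. -/
instance countablySeparated_Gr (d k : ℕ) : MeasurableSpace.CountablySeparated (Gr d k) := by
  refine ⟨⟨hits k '' TopologicalSpace.countableBasis (E (d + 1)),
    (TopologicalSpace.countable_countableBasis _).image _, ?_, ?_⟩⟩
  · rintro _ ⟨b, hb, rfl⟩
    exact measurableSet_hits ((TopologicalSpace.isBasis_countableBasis _).isOpen hb)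
  · intro W _ W' _ h
    have key : ∀ V V' : Gr d k,
        (∀ s ∈ hits k '' TopologicalSpace.countableBasis (E (d + 1)), V ∈ s ↔ V' ∈ s) →
        V.1 ≤ V'.1 := by
      intro V V' h x hx
      by_contra hx'
      have ho : IsOpen ((V'.1 : Set (E (d + 1)))ᶜ) :=
        (Submodule.closed_of_finiteDimensional V'.1).isOpen_compl
      obtain ⟨b, hb, hxb, hbV⟩ :=
        (TopologicalSpace.isBasis_countableBasis (E (d + 1))).exists_subset_of_mem_open
          (show x ∈ (V'.1 : Set (E (d + 1)))ᶜ from hx') ho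
      obtain ⟨y, hy, hyb⟩ := (h _ ⟨b, hb, rfl⟩).1 ⟨x, hx, hxb⟩
      exact hbV hyb hy
    exact Subtype.ext (le_antisymm (key W W' h) (key W' W fun s hs => (h s hs).symm))

/-! ### The forms and their isometry groups -/

/-- The matrix `diag (1, …, 1, κ)`. -/
def J (d : ℕ) (κ : ℝ) : Matrix (Fin (d + 1)) (Fin (d + 1)) ℝ :=
  Matrix.diagonal fun i => if i = Fin.last d then κ else 1

theorem J_transpose (d : ℕ) (κ : ℝ) : (J d κ)ᵀ = J d κ := Matrix.diagonal_transpose _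

/-- The group of all unimodular matrices that preserve the form `J d κ` on row vectors. -/
def isoGroup (d : ℕ) (κ : ℝ) : Subgroup (GL (Fin (d + 1)) ℝ) where
  -- The determinant condition follows from the first one if `κ ≠ 0`. If `κ = 0` the form is
  -- degenerate and leaves the scale of the last row free; the determinant fixes it up to sign.
  carrier := {g | g.val * J d κ * g.valᵀ = J d κ ∧
    g.val.det ^ 2 = 1}
  mul_mem' := by
    rintro g h ⟨hg, hg'⟩ ⟨hh, hh'⟩
    refine ⟨?_, ?_⟩
    · rw [Units.val_mul, Matrix.transpose_mul]
      calc g.val * h.val * J d κ * (h.valᵀ * g.valᵀ)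
          = g.val * (h.val * J d κ * h.valᵀ) * g.valᵀ := by
            simp only [Matrix.mul_assoc]
        _ = J d κ := by rw [hh, hg]
    · rw [Units.val_mul, Matrix.det_mul, mul_pow, hg', hh', one_mul]
  one_mem' := by simp
  inv_mem' := by
    rintro g ⟨hg, hg'⟩
    refine ⟨?_, ?_⟩
    · have h1 : (g⁻¹).val * g.val = 1 := Units.inv_mul g
      have h2 : g.valᵀ * (g⁻¹).valᵀ = 1 := by
        rw [← Matrix.transpose_mul, h1, Matrix.transpose_one]
      calc (g⁻¹).val * J d κ * (g⁻¹).valᵀ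
          = (g⁻¹).val * (g.val * J d κ * g.valᵀ) * (g⁻¹).valᵀ := by rw [hg]
        _ = ((g⁻¹).val * g.val) * J d κ * (g.valᵀ * (g⁻¹).valᵀ) := by
            simp only [Matrix.mul_assoc]
        _ = J d κ := by rw [h1, h2]; simp
    · have h1 : (g⁻¹).val.det * g.val.det = 1 := by
        rw [← Matrix.det_mul, Units.inv_mul, Matrix.det_one]
      have h2 : ((g⁻¹).val.det * g.val.det) ^ 2 = 1 := by rw [h1]; simp
      rwa [mul_pow, hg', mul_one] at h2

theorem mem_isoGroup {d : ℕ} {κ : ℝ} {g : GL (Fin (d + 1)) ℝ} :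
    g ∈ isoGroup d κ ↔ g.val * J d κ * g.valᵀ = J d κ ∧
      g.val.det ^ 2 = 1 := Iff.rfl

theorem isClosed_isoGroup (d : ℕ) (κ : ℝ) : IsClosed (isoGroup d κ : Set (GL (Fin (d + 1)) ℝ)) := by
  have hv : Continuous fun g : GL (Fin (d + 1)) ℝ => g.val :=
    Units.continuous_val
  exact (isClosed_eq ((hv.matrix_mul continuous_const).matrix_mul hv.matrix_transpose)
    continuous_const).inter (isClosed_eq (continuous_pow 2 |>.comp hv.matrix_det) continuous_const)

instance (d : ℕ) (κ : ℝ) : MeasurableSpace (isoGroup d κ) := borel _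

instance (d : ℕ) (κ : ℝ) : BorelSpace (isoGroup d κ) := ⟨rfl⟩

instance (n : ℕ) : LocallyCompactSpace (Matrix (Fin n) (Fin n) ℝ) :=
  inferInstanceAs (LocallyCompactSpace (Fin n → Fin n → ℝ))

instance (n : ℕ) : PolishSpace (Matrix (Fin n) (Fin n) ℝ) :=
  inferInstanceAs (PolishSpace (Fin n → Fin n → ℝ))

instance (d : ℕ) (κ : ℝ) : LocallyCompactSpace (isoGroup d κ) :=
  (isClosed_isoGroup d κ).isClosedEmbedding_subtypeVal.locallyCompactSpace

instance (d : ℕ) (κ : ℝ) : PolishSpace (isoGroup d κ) := by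
  have h : Topology.IsClosedEmbedding (Units.embedProduct (Matrix (Fin (d + 1)) (Fin (d + 1)) ℝ)) :=
    Units.isClosedEmbedding_embedProduct
  have : PolishSpace (Matrix (Fin (d + 1)) (Fin (d + 1)) ℝ)ᵐᵒᵖ :=
    (MulOpposite.opHomeomorph.symm).isClosedEmbedding.polishSpace
  exact (h.comp (isClosed_isoGroup d κ).isClosedEmbedding_subtypeVal).polishSpace


end KPlane

end

noncomputable section

namespace KPlane

open scoped Matrix

/-! ### Subspaces as kernels of matrices -/

theorem dotProduct_gram {m n : ℕ} (A : Matrix (Fin n) (Fin n) ℝ) (u : Matrix (Fin m) (Fin n) ℝ)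
    (x y : Fin m → ℝ) : x ⬝ᵥ (gram A u *ᵥ y) = (x ᵥ* u) ⬝ᵥ (A *ᵥ (y ᵥ* u)) := by
  rw [gram, ← Matrix.mulVec_mulVec, ← Matrix.mulVec_mulVec, Matrix.mulVec_transpose,
    Matrix.dotProduct_mulVec]

theorem posDef_gram_iff {m n : ℕ} {A : Matrix (Fin n) (Fin n) ℝ} (hA : Aᵀ = A)
    (u : Matrix (Fin m) (Fin n) ℝ) :
    (gram A u).PosDef ↔ ∀ x : Fin m → ℝ, x ≠ 0 → 0 < (x ᵥ* u) ⬝ᵥ (A *ᵥ (x ᵥ* u)) := by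
  have hs : (gram A u).IsHermitian := by
    rw [Matrix.IsHermitian, Matrix.conjTranspose_eq_transpose_of_trivial, gram]
    simp [Matrix.transpose_mul, hA, Matrix.mul_assoc]
  rw [Matrix.posDef_iff_dotProduct_mulVec]
  simp only [hs, true_and, star_trivial, dotProduct_gram]

theorem det_gram_one_ne_zero_of_injective {m n : ℕ} {u : Matrix (Fin m) (Fin n) ℝ}
    (h : ∀ x : Fin m → ℝ, x ᵥ* u = 0 → x = 0) : (gram 1 u).det ≠ 0 := by
  intro h0
  obtain ⟨x, hx, hx0⟩ := Matrix.exists_mulVec_eq_zero_iff.2 h0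
  have h1 := dotProduct_gram 1 u x x
  rw [hx0, dotProduct_zero, Matrix.one_mulVec] at h1
  exact hx (h x (dotProduct_self_eq_zero.1 h1.symm))

theorem det_gram_one_ne_zero_of_posDef {m n : ℕ} {A : Matrix (Fin n) (Fin n) ℝ}
    {u : Matrix (Fin m) (Fin n) ℝ} (h : (gram A u).PosDef) : (gram 1 u).det ≠ 0 := by
  refine det_gram_one_ne_zero_of_injective fun x hx => ?_
  by_contra h0
  have h1 := h.dotProduct_mulVec_pos h0
  rw [star_trivial, dotProduct_gram, hx] at h1
  simp at h1

theorem dotProduct_mv {m n : ℕ} (u : Matrix (Fin m) (Fin n) ℝ) (x : Fin m → ℝ) (ζ : E n) :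
    x ⬝ᵥ (mv u ζ).ofLp = (x ᵥ* u) ⬝ᵥ ζ.ofLp :=
  Matrix.dotProduct_mulVec x u ζ.ofLp

/-- The matrix `uᵀ (u uᵀ)⁻¹` is a right inverse of `u`. -/
theorem mv_surjective_of_det {m n : ℕ} {u : Matrix (Fin m) (Fin n) ℝ} (h : (gram 1 u).det ≠ 0) :
    Function.Surjective (mv u) := by
  intro y
  refine ⟨mv (uᵀ * (gram 1 u)⁻¹) y, ?_⟩
  have h1 : gram 1 u * (gram 1 u)⁻¹ = 1 := Matrix.mul_nonsing_inv _ (isUnit_iff_ne_zero.2 h)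
  have h2 : u * (uᵀ * (gram 1 u)⁻¹) = 1 := by
    rw [← Matrix.mul_assoc]
    conv_rhs => rw [← h1]
    rw [gram, Matrix.mul_one]
  rw [← mv_mul, h2, mv_one]

theorem vecMul_injective_of_surjective {m n : ℕ} {u : Matrix (Fin m) (Fin n) ℝ}
    (h : Function.Surjective (mv u)) (x : Fin m → ℝ) (hx : x ᵥ* u = 0) : x = 0 := by
  obtain ⟨ζ, hζ⟩ := h (WithLp.toLp 2 x)
  have h1 := dotProduct_mv u x ζ
  rw [hx, zero_dotProduct, hζ] at h1
  exact dotProduct_self_eq_zero.1 h1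

theorem finrank_ker_mv_eq_iff {d k m : ℕ} (hm : m + k = d) (u : Matrix (Fin m) (Fin (d + 1)) ℝ) :
    Module.finrank ℝ (LinearMap.ker (mv u)) = k + 1 ↔ (gram 1 u).det ≠ 0 := by
  have hr := LinearMap.finrank_range_add_finrank_ker (mv u)
  rw [finrank_euclideanSpace_fin] at hr
  constructor
  · intro h
    refine det_gram_one_ne_zero_of_injective (vecMul_injective_of_surjective ?_)
    rw [← LinearMap.range_eq_top]
    refine Submodule.eq_top_of_finrank_eq ?_
    rw [finrank_euclideanSpace_fin]
    omega
  · intro h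
    rw [LinearMap.range_eq_top.2 (mv_surjective_of_det h), finrank_top,
      finrank_euclideanSpace_fin] at hr
    omega

/-- The kernel of a matrix, as a point of the Grassmannian (an arbitrary point if the matrix is not
of full rank). -/
def kerGr {d k m : ℕ} [Nonempty (Gr d k)] (u : Matrix (Fin m) (Fin (d + 1)) ℝ) : Gr d k :=
  open Classical in
  if h : Module.finrank ℝ (LinearMap.ker (mv u)) = k + 1 then ⟨LinearMap.ker (mv u), h⟩
  else Classical.arbitrary _

theorem kerGr_val {d k m : ℕ} [Nonempty (Gr d k)] (hm : m + k = d)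
    {u : Matrix (Fin m) (Fin (d + 1)) ℝ} (h : (gram 1 u).det ≠ 0) :
    (kerGr u : Gr d k).1 = LinearMap.ker (mv u) := by
  rw [kerGr, dif_pos ((finrank_ker_mv_eq_iff hm u).2 h)]

/-- With `v⁺ = vᵀ (v vᵀ)⁻¹`, the vector `ζ - v⁺ v ζ` is the orthogonal projection of `ζ` to the
kernel of `v`. It depends continuously on `v` and equals `ζ` at `v = u`, so it stays in `O` for `v`
near `u`. -/
theorem isOpen_ker_hits {m n : ℕ} {O : Set (E n)} (hO : IsOpen O) :
    IsOpen {u : Matrix (Fin m) (Fin n) ℝ | (gram 1 u).det ≠ 0 ∧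
      ((LinearMap.ker (mv u) : Set (E n)) ∩ O).Nonempty} := by
  have hdet : Continuous fun u : Matrix (Fin m) (Fin n) ℝ => (gram 1 u).det :=
    (continuous_gram 1).matrix_det
  rw [isOpen_iff_eventually]
  rintro u ⟨hd, ζ, hζ, hζO⟩
  have hinv : ContinuousAt (fun v : Matrix (Fin m) (Fin n) ℝ => (gram 1 v)⁻¹) u := by
    refine ContinuousAt.comp (f := gram (1 : Matrix (Fin n) (Fin n) ℝ)) (x := u)
      (g := fun S : Matrix (Fin m) (Fin m) ℝ => S⁻¹) ?_ (continuous_gram 1).continuousAt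
    exact continuousOn_matrix_inv.continuousAt
      (((isOpen_ne).preimage (Continuous.matrix_det continuous_id)).mem_nhds hd)
  have hz : ContinuousAt (fun v : Matrix (Fin m) (Fin n) ℝ =>
      ζ - mv (vᵀ * (gram 1 v)⁻¹) (mv v ζ)) u := by
    refine continuousAt_const.sub ?_
    refine ContinuousAt.comp (f := fun v : Matrix (Fin m) (Fin n) ℝ =>
      (vᵀ * (gram 1 v)⁻¹, mv v ζ)) (x := u)
      (g := fun p : Matrix (Fin n) (Fin m) ℝ × E m => mv p.1 p.2) continuous_mv.continuousAt ?_
    refine ContinuousAt.prodMk ?_ ?_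
    · have h1 : Continuous fun p : Matrix (Fin n) (Fin m) ℝ × Matrix (Fin m) (Fin m) ℝ =>
        p.1 * p.2 := continuous_fst.matrix_mul continuous_snd
      exact ContinuousAt.comp (f := fun v : Matrix (Fin m) (Fin n) ℝ => (vᵀ, (gram 1 v)⁻¹)) (x := u)
        h1.continuousAt ((Continuous.matrix_transpose continuous_id).continuousAt.prodMk hinv)
    · exact (continuous_mv.comp (Continuous.prodMk_left ζ)).continuousAt
  have hz0 : ζ - mv (uᵀ * (gram 1 u)⁻¹) (mv u ζ) = ζ := by
    rw [LinearMap.mem_ker.1 hζ, map_zero, sub_zero]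
  have h1 := hz.eventually_mem (hO.mem_nhds (by rw [hz0]; exact hζO))
  have h2 := hdet.continuousAt.eventually_ne hd
  filter_upwards [h1, h2] with v hv hv'
  refine ⟨hv', _, ?_, hv⟩
  have e1 : gram 1 v * (gram 1 v)⁻¹ = 1 := Matrix.mul_nonsing_inv _ (isUnit_iff_ne_zero.2 hv')
  have e2 : v * (vᵀ * (gram 1 v)⁻¹) = 1 := by
    rw [← Matrix.mul_assoc]
    conv_rhs => rw [← e1]
    rw [gram, Matrix.mul_one]
  rw [SetLike.mem_coe, LinearMap.mem_ker, map_sub, ← mv_mul, e2, mv_one, sub_self]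

theorem measurable_kerGr {d k m : ℕ} [Nonempty (Gr d k)] (hm : m + k = d) :
    Measurable (kerGr : Matrix (Fin m) (Fin (d + 1)) ℝ → Gr d k) := by
  refine measurable_of_hits fun O hO => ?_
  have hfull : MeasurableSet {u : Matrix (Fin m) (Fin (d + 1)) ℝ | (gram 1 u).det ≠ 0} :=
    (isOpen_ne.preimage (continuous_gram 1).matrix_det).measurableSet
  have : (kerGr : Matrix (Fin m) (Fin (d + 1)) ℝ → Gr d k) ⁻¹' hits k O =
      {u | (gram 1 u).det ≠ 0 ∧ ((LinearMap.ker (mv u) : Set (E (d + 1))) ∩ O).Nonempty} ∪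
      ({u | (gram 1 u).det ≠ 0}ᶜ ∩ {_u | (Classical.arbitrary (Gr d k)) ∈ hits k O}) := by
    ext u
    by_cases h : (gram 1 u).det ≠ 0
    · simp [hits, kerGr_val hm h, h]
    · have h' : ¬ Module.finrank ℝ (LinearMap.ker (mv u)) = k + 1 :=
        fun h'' => h ((finrank_ker_mv_eq_iff hm u).1 h'')
      simp only [Set.mem_preimage, kerGr, dif_neg h', Set.mem_union, Set.mem_inter_iff,
        Set.mem_compl_iff, Set.mem_ofPred_eq, h, false_and, false_or, not_false_eq_true, true_and]
  rw [this]
  exact (isOpen_ker_hits hO).measurableSet.union (hfull.compl.inter (MeasurableSet.const _))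

theorem ker_mv_mul_left {m n : ℕ} {S : Matrix (Fin m) (Fin m) ℝ} (hS : S.det ≠ 0)
    (u : Matrix (Fin m) (Fin n) ℝ) : LinearMap.ker (mv (S * u)) = LinearMap.ker (mv u) := by
  ext ζ
  rw [LinearMap.mem_ker, LinearMap.mem_ker, mv_mul]
  refine ⟨fun h => ?_, fun h => by rw [h, map_zero]⟩
  have h1 : mv S⁻¹ (mv S (mv u ζ)) = mv u ζ := by
    rw [← mv_mul S⁻¹, Matrix.nonsing_inv_mul S (isUnit_iff_ne_zero.2 hS), mv_one]
  rw [← h1, h, map_zero]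

theorem exists_ker_mv_eq {d k m : ℕ} (hm : m + k = d) (W : Gr d k) :
    ∃ u : Matrix (Fin m) (Fin (d + 1)) ℝ, (gram 1 u).det ≠ 0 ∧ LinearMap.ker (mv u) = W.1 := by
  have hq : Module.finrank ℝ (E (d + 1) ⧸ W.1) = Module.finrank ℝ (E m) := by
    have := Submodule.finrank_quotient_add_finrank W.1
    rw [W.2, finrank_euclideanSpace_fin] at this
    rw [finrank_euclideanSpace_fin]
    omega
  let f : E (d + 1) →ₗ[ℝ] E m := (LinearEquiv.ofFinrankEq _ _ hq).toLinearMap ∘ₗ W.1.mkQ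
  have hf : mv (Matrix.toEuclideanLin.symm f) = f :=
    Matrix.toEuclideanLin.apply_symm_apply f
  have hker : LinearMap.ker (mv (Matrix.toEuclideanLin.symm f)) = W.1 := by
    rw [hf, LinearMap.ker_comp, LinearEquiv.ker, Submodule.comap_bot, Submodule.ker_mkQ]
  refine ⟨Matrix.toEuclideanLin.symm f, ?_, hker⟩
  rw [← finrank_ker_mv_eq_iff hm, hker, W.2]

/-- By homogeneity positivity need only be tested on the unit sphere, which is compact, so the tube
lemma applies. -/
theorem isOpen_posDef_gram {m n : ℕ} {A : Matrix (Fin n) (Fin n) ℝ} (hA : Aᵀ = A) :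
    IsOpen {u : Matrix (Fin m) (Fin n) ℝ | (gram A u).PosDef} := by
  have h : {u : Matrix (Fin m) (Fin n) ℝ | (gram A u).PosDef} =
      {u | ∀ x ∈ Metric.sphere (0 : Fin m → ℝ) 1,
        (x ᵥ* u) ⬝ᵥ (A *ᵥ (x ᵥ* u)) ∈ Set.Ioi (0 : ℝ)} := by
    ext u
    simp only [Set.mem_ofPred_eq, posDef_gram_iff hA, Set.mem_Ioi]
    constructor
    · intro h x hx
      exact h x (by rintro rfl; simp at hx)
    · intro h x hx
      have hn : ‖x‖ ≠ 0 := norm_ne_zero_iff.2 hx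
      have h1 := h (‖x‖⁻¹ • x) (by simp [norm_smul, hn])
      rw [Matrix.smul_vecMul, Matrix.mulVec_smul, smul_dotProduct, dotProduct_smul,
        smul_eq_mul, smul_eq_mul] at h1
      have h2 : 0 < ‖x‖⁻¹ := by positivity
      exact pos_of_mul_pos_right (pos_of_mul_pos_right h1 h2.le) h2.le
  rw [h]
  refine isOpen_forall_mem_of_isCompact (f := fun (u : Matrix (Fin m) (Fin n) ℝ) (x : Fin m → ℝ) =>
    (x ᵥ* u) ⬝ᵥ (A *ᵥ (x ᵥ* u))) ?_ (isCompact_sphere _ _) isOpen_Ioi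
  have h1 : Continuous fun p : Matrix (Fin m) (Fin n) ℝ × (Fin m → ℝ) => p.2 ᵥ* p.1 :=
    continuous_snd.matrix_vecMul continuous_fst
  exact h1.dotProduct (continuous_const.matrix_mulVec h1)

/-! ### Transitivity of the isometry groups -/

/-- The reflection of row vectors in the vector `w`. -/
def reflMat {n : ℕ} (A : Matrix (Fin n) (Fin n) ℝ) (w : Fin n → ℝ) : Matrix (Fin n) (Fin n) ℝ :=
  1 - (2 / (w ⬝ᵥ (A *ᵥ w))) • Matrix.vecMulVec (A *ᵥ w) w

theorem vecMul_reflMat {n : ℕ} (A : Matrix (Fin n) (Fin n) ℝ) (v w : Fin n → ℝ) :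
    v ᵥ* reflMat A w = v - (2 / (w ⬝ᵥ (A *ᵥ w)) * (v ⬝ᵥ (A *ᵥ w))) • w := by
  rw [reflMat, Matrix.vecMul_sub, Matrix.vecMul_one, Matrix.vecMul_smul, Matrix.vecMul_vecMulVec,
    smul_smul]

theorem reflMat_mul_self {n : ℕ} (A : Matrix (Fin n) (Fin n) ℝ) {w : Fin n → ℝ}
    (hw : w ⬝ᵥ (A *ᵥ w) ≠ 0) : reflMat A w * reflMat A w = 1 := by
  refine Matrix.ext_of_single_vecMul fun i => ?_
  generalize (Pi.single i 1 : Fin n → ℝ) = v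
  rw [← Matrix.vecMul_vecMul, vecMul_reflMat, vecMul_reflMat, Matrix.vecMul_one, sub_dotProduct,
    smul_dotProduct, smul_eq_mul, sub_sub, ← add_smul]
  have : 2 / (w ⬝ᵥ (A *ᵥ w)) * (v ⬝ᵥ (A *ᵥ w)) + 2 / (w ⬝ᵥ (A *ᵥ w)) * (v ⬝ᵥ (A *ᵥ w) -
      2 / (w ⬝ᵥ (A *ᵥ w)) * (v ⬝ᵥ (A *ᵥ w)) * (w ⬝ᵥ (A *ᵥ w))) = 0 := by
    field_simp
    ring
  rw [this, zero_smul, sub_zero]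

theorem reflMat_isometry {n : ℕ} {A : Matrix (Fin n) (Fin n) ℝ} (hA : Aᵀ = A) {w : Fin n → ℝ}
    (hw : w ⬝ᵥ (A *ᵥ w) ≠ 0) : reflMat A w * A * (reflMat A w)ᵀ = A := by
  have h1 : A * (reflMat A w)ᵀ = reflMat A w * A := by
    simp only [reflMat, Matrix.transpose_sub, Matrix.transpose_one, Matrix.transpose_smul,
      Matrix.transpose_vecMulVec, Matrix.mul_sub, Matrix.sub_mul, Matrix.mul_one, Matrix.one_mul,
      Matrix.mul_smul, Matrix.smul_mul]
    rw [Matrix.mul_vecMulVec, Matrix.vecMulVec_mul, ← Matrix.mulVec_transpose, hA]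
  rw [Matrix.mul_assoc, h1, ← Matrix.mul_assoc, reflMat_mul_self A hw, Matrix.one_mul]

/-- The reflection in `w`, as an element of the isometry group. -/
def reflIso {d : ℕ} (κ : ℝ) {w : Fin (d + 1) → ℝ} (hw : w ⬝ᵥ (J d κ *ᵥ w) ≠ 0) :
    isoGroup d κ :=
  ⟨⟨reflMat (J d κ) w, reflMat (J d κ) w, reflMat_mul_self _ hw, reflMat_mul_self _ hw⟩,
    reflMat_isometry (J_transpose d κ) hw, by
      rw [sq, ← Matrix.det_mul, reflMat_mul_self _ hw, Matrix.det_one]⟩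

theorem dotProduct_symm_form {n : ℕ} {A : Matrix (Fin n) (Fin n) ℝ} (hA : Aᵀ = A)
    (v w : Fin n → ℝ) : v ⬝ᵥ (A *ᵥ w) = w ⬝ᵥ (A *ᵥ v) := by
  rw [Matrix.dotProduct_mulVec, dotProduct_comm, ← Matrix.mulVec_transpose, hA]

/-- For vectors of the same norm there is a reflection mapping one to plus or minus the other. -/
theorem exists_refl_eq_or_neg {n : ℕ} {A : Matrix (Fin n) (Fin n) ℝ} (hA : Aᵀ = A)
    {a b : Fin n → ℝ} (ha : a ⬝ᵥ (A *ᵥ a) = 1) (hb : b ⬝ᵥ (A *ᵥ b) = 1) :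
    ∃ w : Fin n → ℝ, w ⬝ᵥ (A *ᵥ w) ≠ 0 ∧ (w = a - b ∨ w = a + b) ∧
      (a ᵥ* reflMat A w = b ∨ a ᵥ* reflMat A w = -b) := by
  have hs := dotProduct_symm_form hA a b
  have hm : (a - b) ⬝ᵥ (A *ᵥ (a - b)) = 2 - 2 * (a ⬝ᵥ (A *ᵥ b)) := by
    rw [Matrix.mulVec_sub, sub_dotProduct, dotProduct_sub, dotProduct_sub, ha, hb, ← hs]; ring
  have hp : (a + b) ⬝ᵥ (A *ᵥ (a + b)) = 2 + 2 * (a ⬝ᵥ (A *ᵥ b)) := by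
    rw [Matrix.mulVec_add, add_dotProduct, dotProduct_add, dotProduct_add, ha, hb, ← hs]; ring
  -- The reflection in `a - b` maps `a` to `b`, but it does not exist if `a - b` is isotropic. In
  -- that case the product of `a` and `b` is `1`, so `a + b` has square `4` and its reflection maps
  -- `a` to `-b`.
  by_cases h : (a - b) ⬝ᵥ (A *ᵥ (a - b)) = 0
  · have h2 : (a + b) ⬝ᵥ (A *ᵥ (a + b)) = 4 := by rw [hp]; rw [hm] at h; linarith
    refine ⟨a + b, by rw [h2]; norm_num, Or.inr rfl, Or.inr ?_⟩
    rw [vecMul_reflMat, h2, Matrix.mulVec_add, dotProduct_add, ha]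
    have : a ⬝ᵥ (A *ᵥ b) = 1 := by rw [hm] at h; linarith
    rw [this]
    norm_num
  · refine ⟨a - b, h, Or.inl rfl, Or.inl ?_⟩
    rw [vecMul_reflMat, hm, Matrix.mulVec_sub, dotProduct_sub, ha]
    rw [hm] at h
    have : 2 / (2 - 2 * (a ⬝ᵥ (A *ᵥ b))) * (1 - a ⬝ᵥ (A *ᵥ b)) = 1 := by
      rw [div_mul_eq_mul_div, div_eq_one_iff_eq h]; ring
    rw [this, one_smul, sub_sub_cancel]

theorem gram_mul_isoGroup {d m : ℕ} {κ : ℝ} (g : isoGroup d κ)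
    (u : Matrix (Fin m) (Fin (d + 1)) ℝ) : gram (J d κ) (u * g.1.val) = gram (J d κ) u := by
  have h := (mem_isoGroup.1 g.2).1
  rw [gram, Matrix.transpose_mul]
  calc u * g.1.val * J d κ * (g.1.valᵀ * uᵀ)
      = u * (g.1.val * J d κ * g.1.valᵀ) * uᵀ := by simp only [Matrix.mul_assoc]
    _ = gram (J d κ) u := by rw [h]; rfl

theorem gram_apply {m n : ℕ} (A : Matrix (Fin n) (Fin n) ℝ) (u : Matrix (Fin m) (Fin n) ℝ)
    (i j : Fin m) : gram A u i j = u i ⬝ᵥ (A *ᵥ u j) := by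
  rw [gram, Matrix.mul_assoc, Matrix.mul_apply']
  rfl

/-- The isometry group acts transitively on orthonormal frames, up to signs. -/
theorem exists_isoGroup_mul_eq {d m : ℕ} {κ : ℝ} {u v : Matrix (Fin m) (Fin (d + 1)) ℝ}
    (hu : gram (J d κ) u = 1) (hv : gram (J d κ) v = 1) :
    ∃ g : isoGroup d κ, ∀ i, (u * g.1.val) i = v i ∨ (u * g.1.val) i = -v i := by
  have key : ∀ j : ℕ, ∃ g : isoGroup d κ, ∀ i : Fin m, (i : ℕ) < j →
      (u * g.1.val) i = v i ∨ (u * g.1.val) i = -v i := by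
    intro j
    induction j with
    | zero => exact ⟨1, fun i hi => absurd hi (Nat.not_lt_zero _)⟩
    | succ j ih =>
      obtain ⟨g, hg⟩ := ih
      by_cases hj : j < m
      · set u' := u * g.1.val with hu'
        have hu'g : gram (J d κ) u' = 1 := by rw [hu', gram_mul_isoGroup, hu]
        set l : Fin m := ⟨j, hj⟩ with hl
        have h1 : ∀ i i', u' i ⬝ᵥ (J d κ *ᵥ u' i') = (1 : Matrix (Fin m) (Fin m) ℝ) i i' :=
          fun i i' => by rw [← gram_apply, hu'g]
        have h2 : ∀ i i', v i ⬝ᵥ (J d κ *ᵥ v i') = (1 : Matrix (Fin m) (Fin m) ℝ) i i' :=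
          fun i i' => by rw [← gram_apply, hv]
        obtain ⟨w, hw, hwab, hab⟩ := exists_refl_eq_or_neg (J_transpose d κ)
          ((h1 l l).trans (Matrix.one_apply_eq l)) ((h2 l l).trans (Matrix.one_apply_eq l))
        refine ⟨g * reflIso κ hw, fun i hi => ?_⟩
        have hrow : (u * (g * reflIso κ hw).1.val) i = u' i ᵥ* reflMat (J d κ) w := by
          have : u * (g * reflIso κ hw).1.val = u' * reflMat (J d κ) w := by
            rw [hu', Matrix.mul_assoc]; rfl
          rw [this]; rfl
        rw [hrow]
        -- The vector `w` is the sum or the difference of the current row and its target. Both are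
        -- orthogonal to the rows already adjusted, which the new reflection therefore fixes.
        rcases Nat.lt_succ_iff_lt_or_eq.1 hi with hi' | hi'
        · have hne : i ≠ l := fun h => by rw [h] at hi'; exact lt_irrefl _ hi'
          have ha : u' i ⬝ᵥ (J d κ *ᵥ u' l) = 0 := (h1 i l).trans (Matrix.one_apply_ne hne)
          have hb : u' i ⬝ᵥ (J d κ *ᵥ v l) = 0 := by
            have hb' := (h2 i l).trans (Matrix.one_apply_ne hne)
            rcases hg i hi' with h | h
            · rw [h, hb']
            · rw [h, neg_dotProduct, hb', neg_zero]
          have hz : u' i ⬝ᵥ (J d κ *ᵥ w) = 0 := by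
            rcases hwab with rfl | rfl
            · rw [Matrix.mulVec_sub, dotProduct_sub, ha, hb, sub_zero]
            · rw [Matrix.mulVec_add, dotProduct_add, ha, hb, add_zero]
          rw [vecMul_reflMat, hz, mul_zero, zero_smul, sub_zero]
          exact hg i hi'
        · have : i = l := Fin.ext hi'
          rw [this]; exact hab
      · exact ⟨g, fun i _ => hg i (by omega)⟩
  obtain ⟨g, hg⟩ := key m
  exact ⟨g, fun i => hg i i.2⟩

theorem ker_mv_eq_of_rows {m n : ℕ} {u v : Matrix (Fin m) (Fin n) ℝ}
    (h : ∀ i, u i = v i ∨ u i = -v i) : LinearMap.ker (mv u) = LinearMap.ker (mv v) := by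
  ext ζ
  have key : ∀ i, mv u ζ i = 0 ↔ mv v ζ i = 0 := by
    intro i
    rcases h i with h | h
    · simp only [mv_apply, h]
    · simp only [mv_apply, h, Pi.neg_apply, neg_mul, Finset.sum_neg_distrib, neg_eq_zero]
  rw [LinearMap.mem_ker, LinearMap.mem_ker]
  constructor
  · intro h'
    ext i
    exact (key i).1 (by rw [h']; rfl)
  · intro h'
    ext i
    exact (key i).2 (by rw [h']; rfl)

/-- Any two subspaces cut out by matrices with positive definite Gram matrix are related by an
isometry. -/
theorem exists_act_eq {d k m : ℕ} {κ : ℝ} {u v : Matrix (Fin m) (Fin (d + 1)) ℝ}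
    (hu : (gram (J d κ) u).PosDef) (hv : (gram (J d κ) v).PosDef) {W W' : Gr d k}
    (hW : W.1 = LinearMap.ker (mv u)) (hW' : W'.1 = LinearMap.ker (mv v)) :
    ∃ g : isoGroup d κ, act g.1 W = W' := by
  have key : ∀ u : Matrix (Fin m) (Fin (d + 1)) ℝ, (gram (J d κ) u).PosDef →
      ∃ S : Matrix (Fin m) (Fin m) ℝ, S.det ≠ 0 ∧ gram (J d κ) (S * u) = 1 := by
    intro u hu
    obtain ⟨R, hR, hG⟩ := exists_eq_mul_transpose hu
    have h1 : R⁻¹ * R = 1 := Matrix.nonsing_inv_mul R (isUnit_iff_ne_zero.2 hR)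
    have h2 : Rᵀ * R⁻¹ᵀ = 1 := by rw [← Matrix.transpose_mul, h1, Matrix.transpose_one]
    refine ⟨R⁻¹, fun h => ?_, ?_⟩
    · have := congrArg Matrix.det h1
      rw [Matrix.det_mul, h, zero_mul, Matrix.det_one] at this
      exact zero_ne_one this
    · rw [gram_mul, hG, ← Matrix.mul_assoc, h1, Matrix.one_mul, h2]
  obtain ⟨S, hS, hSu⟩ := key u hu
  obtain ⟨T, hT, hTv⟩ := key v hv
  obtain ⟨g, hg⟩ := exists_isoGroup_mul_eq hSu hTv
  -- Multiplying the equations of a subspace by `g` on the right moves the subspace by `g⁻¹`. The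
  -- signs left undetermined by the reflections do not affect the kernel.
  refine ⟨g⁻¹, Subtype.ext ?_⟩
  ext ζ
  rw [mem_act, hW, hW', ← ker_mv_mul_left hS u, ← ker_mv_mul_left hT v, ← ker_mv_eq_of_rows hg,
    LinearMap.mem_ker, LinearMap.mem_ker, mv_mul (S * u)]
  simp

end KPlane

end

noncomputable section

namespace KPlane

open scoped Matrix

/-! ### The affine chart -/

/-- The point `(-x, 1)` of `ℝᵈ⁺¹` over `x ∈ ℝᵈ`. -/
def lift {d : ℕ} (x : E d) : E (d + 1) := WithLp.toLp 2 (Fin.snoc (fun i => -x i) 1)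

@[simp] theorem lastCoord_lift {d : ℕ} (x : E d) : lastCoord (lift x) = 1 := by
  simp [lastCoord, lift]

@[simp] theorem fstPart_lift {d : ℕ} (x : E d) : fstPart (lift x) = -x := by
  ext i; simp [fstPart, lift]

@[simp] theorem proj_lift {d : ℕ} (x : E d) : proj (lift x) = x := by
  simp [proj]

theorem ext_parts {d : ℕ} {ζ η : E (d + 1)} (h1 : fstPart ζ = fstPart η)
    (h2 : lastCoord ζ = lastCoord η) : ζ = η := by
  ext i
  refine Fin.lastCases h2 (fun j => ?_) i
  exact congrArg (fun v : E d => v j) h1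

@[simp] theorem fstPart_add {d : ℕ} (ζ η : E (d + 1)) :
    fstPart (ζ + η) = fstPart ζ + fstPart η := rfl

@[simp] theorem fstPart_smul {d : ℕ} (c : ℝ) (ζ : E (d + 1)) :
    fstPart (c • ζ) = c • fstPart ζ := rfl

@[simp] theorem lastCoord_add {d : ℕ} (ζ η : E (d + 1)) :
    lastCoord (ζ + η) = lastCoord ζ + lastCoord η := rfl

@[simp] theorem lastCoord_smul {d : ℕ} (c : ℝ) (ζ : E (d + 1)) :
    lastCoord (c • ζ) = c * lastCoord ζ := rfl

theorem eq_smul_lift_proj {d : ℕ} {ζ : E (d + 1)} (h : lastCoord ζ ≠ 0) :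
    ζ = lastCoord ζ • lift (proj ζ) := by
  refine ext_parts ?_ (by simp)
  simp [proj, smul_smul, h]

theorem continuous_fstPart {d : ℕ} : Continuous (fstPart : E (d + 1) → E d) := by
  refine (PiLp.continuous_toLp 2 _).comp (continuous_pi fun i => ?_)
  exact (continuous_apply i.castSucc).comp (PiLp.continuous_ofLp 2 _)

theorem continuous_lastCoord {d : ℕ} : Continuous (lastCoord : E (d + 1) → ℝ) :=
  (continuous_apply (Fin.last d)).comp (PiLp.continuous_ofLp 2 _)

/-- The open cone `ζ_{d+1}² + κ |ζ'|² > 0`. -/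
def cone (d : ℕ) (κ : ℝ) : Set (E (d + 1)) := {ζ | 0 < lastCoord ζ ^ 2 + κ * ‖fstPart ζ‖ ^ 2}

theorem isOpen_cone (d : ℕ) (κ : ℝ) : IsOpen (cone d κ) :=
  isOpen_lt continuous_const
    ((continuous_lastCoord.pow 2).add (continuous_const.mul (continuous_fstPart.norm.pow 2)))

theorem mem_cone_zero {d : ℕ} {ζ : E (d + 1)} : ζ ∈ cone d 0 ↔ lastCoord ζ ≠ 0 := by
  simp [cone, sq_pos_iff]

theorem mem_cone_one {d : ℕ} {ζ : E (d + 1)} : ζ ∈ cone d 1 ↔ ζ ≠ 0 := by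
  constructor
  · rintro h rfl
    have h0 : fstPart (0 : E (d + 1)) = 0 := rfl
    have h1 : lastCoord (0 : E (d + 1)) = 0 := rfl
    simp [cone, h0, h1] at h
  · intro h
    by_contra h'
    simp only [cone, Set.mem_ofPred_eq, one_mul, not_lt] at h'
    have h1 : lastCoord ζ = 0 := by nlinarith [sq_nonneg (lastCoord ζ), sq_nonneg ‖fstPart ζ‖]
    have h2 : ‖fstPart ζ‖ = 0 := by nlinarith [sq_nonneg (lastCoord ζ), sq_nonneg ‖fstPart ζ‖]
    refine h (ext_parts (η := 0) ?_ h1)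
    rw [norm_eq_zero.1 h2]; rfl

/-- The first `d` columns. -/
def headCols {d m : ℕ} (u : Matrix (Fin m) (Fin (d + 1)) ℝ) : Matrix (Fin m) (Fin d) ℝ :=
  u.submatrix id Fin.castSucc

/-- The last column. -/
def lastCol {d m : ℕ} (u : Matrix (Fin m) (Fin (d + 1)) ℝ) : Fin m → ℝ := fun i => u i (Fin.last d)

theorem form_J {d : ℕ} (κ : ℝ) (v w : Fin (d + 1) → ℝ) :
    v ⬝ᵥ (J d κ *ᵥ w) = ∑ i : Fin d, v i.castSucc * w i.castSucc +
      κ * (v (Fin.last d) * w (Fin.last d)) := by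
  simp only [J, dotProduct, Matrix.mulVec_diagonal, Fin.sum_univ_castSucc]
  simp [Fin.castSucc_ne_last]
  ring

/-- The three forms differ by a perturbation of rank one, which makes the ratios of their Gram
determinants explicit. -/
theorem gram_J {d m : ℕ} (κ : ℝ) (u : Matrix (Fin m) (Fin (d + 1)) ℝ) :
    gram (J d κ) u = headCols u * (headCols u)ᵀ +
      Matrix.vecMulVec (κ • lastCol u) (lastCol u) := by
  ext i j
  rw [gram_apply, form_J]
  simp [Matrix.mul_apply, headCols, lastCol, Matrix.vecMulVec_apply]

theorem gram_J_zero {d m : ℕ} (u : Matrix (Fin m) (Fin (d + 1)) ℝ) :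
    gram (J d 0) u = headCols u * (headCols u)ᵀ := by
  rw [gram_J]; simp

theorem mv_split {d m : ℕ} (u : Matrix (Fin m) (Fin (d + 1)) ℝ) (ζ : E (d + 1)) :
    mv u ζ = mv (headCols u) (fstPart ζ) + lastCoord ζ • WithLp.toLp 2 (lastCol u) := by
  ext i
  simp only [mv_apply, Fin.sum_univ_castSucc, PiLp.add_apply, PiLp.smul_apply, headCols, lastCol,
    fstPart, lastCoord, Matrix.submatrix_apply, id, smul_eq_mul]
  ring

theorem lift_mem_ker_iff {d m : ℕ} {u : Matrix (Fin m) (Fin (d + 1)) ℝ} {x : E d} :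
    lift x ∈ LinearMap.ker (mv u) ↔ mv (headCols u) x = WithLp.toLp 2 (lastCol u) := by
  rw [LinearMap.mem_ker, mv_split]
  simp [neg_add_eq_zero]

/-- The point of the affine plane cut out by `u` that is closest to the origin. -/
def footPoint {d m : ℕ} (u : Matrix (Fin m) (Fin (d + 1)) ℝ) : E d :=
  mv ((headCols u)ᵀ * (gram (J d 0) u)⁻¹) (WithLp.toLp 2 (lastCol u))

theorem inner_mv_transpose {m n : ℕ} (A : Matrix (Fin m) (Fin n) ℝ) (y : E m) (x : E n) :
    inner ℝ (mv Aᵀ y) x = inner ℝ y (mv A x) := by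
  simp only [EuclideanSpace.inner_eq_star_dotProduct, star_trivial]
  simp only [mv, LinearMap.coe_mk, AddHom.coe_mk]
  rw [Matrix.mulVec_transpose, dotProduct_comm, ← Matrix.dotProduct_mulVec, dotProduct_comm]

section footPoint

variable {d m : ℕ} {u : Matrix (Fin m) (Fin (d + 1)) ℝ}

theorem mv_footPoint (h : (gram (J d 0) u).PosDef) :
    mv (headCols u) (footPoint u) = WithLp.toLp 2 (lastCol u) := by
  rw [footPoint, ← mv_mul, ← Matrix.mul_assoc, ← gram_J_zero,
    Matrix.mul_nonsing_inv _ (isUnit_iff_ne_zero.2 h.det_pos.ne'), mv_one]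

theorem inner_footPoint (x : E d) : inner ℝ (footPoint u) x =
    inner ℝ (mv (gram (J d 0) u)⁻¹ (WithLp.toLp 2 (lastCol u))) (mv (headCols u) x) := by
  rw [footPoint, mv_mul, inner_mv_transpose]

theorem norm_sq_footPoint (h : (gram (J d 0) u).PosDef) : ‖footPoint u‖ ^ 2 =
    lastCol u ⬝ᵥ ((gram (J d 0) u)⁻¹ *ᵥ lastCol u) := by
  rw [← real_inner_self_eq_norm_sq, inner_footPoint, mv_footPoint h,
    EuclideanSpace.inner_eq_star_dotProduct, star_trivial]
  rfl

/-- The foot point is a combination of the rows of `headCols u`, so its inner product with any `x`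
of the plane depends only on `mv (headCols u) x` and hence equals its own squared norm; then
Cauchy–Schwarz. -/
theorem norm_footPoint_le (h : (gram (J d 0) u).PosDef) {x : E d}
    (hx : lift x ∈ LinearMap.ker (mv u)) : ‖footPoint u‖ ≤ ‖x‖ := by
  rw [lift_mem_ker_iff] at hx
  have h1 : inner ℝ (footPoint u) x = ‖footPoint u‖ ^ 2 := by
    rw [← real_inner_self_eq_norm_sq, inner_footPoint, inner_footPoint, mv_footPoint h, hx]
  have h2 := real_inner_le_norm (footPoint u) x
  rw [h1, sq] at h2
  by_contra h3
  push Not at h3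
  have h4 : 0 < ‖footPoint u‖ := lt_of_le_of_lt (norm_nonneg x) h3
  nlinarith

/-- The matrix determinant lemma for the rank-one perturbation `gram_J`; the resulting quadratic
expression in the last column is the squared distance of the plane from the origin. This is the
source of the factor `1 + κρ²`. -/
theorem det_gram_J (h : (gram (J d 0) u).PosDef) (κ : ℝ) :
    (gram (J d κ) u).det = (gram (J d 0) u).det * (1 + κ * ‖footPoint u‖ ^ 2) := by
  rw [gram_J κ, ← gram_J_zero, Matrix.vecMulVec_eq Unit,
    Matrix.det_add_replicateCol_mul_replicateRow (isUnit_iff_ne_zero.2 h.det_pos.ne'),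
    norm_sq_footPoint h]
  congr 1
  rw [Matrix.det_unique, Matrix.add_apply, Matrix.one_apply_eq, Matrix.mul_assoc]
  congr 1
  rw [← Matrix.replicateCol_mulVec, Matrix.replicateRow_mul_replicateCol_apply,
    Matrix.mulVec_smul, dotProduct_smul, smul_eq_mul]

end footPoint

/-- The distance from the origin to the affine plane of the points `x` with `(-x, 1) ∈ W`. -/
def rho {d : ℕ} (W : Submodule ℝ (E (d + 1))) : ℝ := Metric.infDist 0 {x : E d | lift x ∈ W}

theorem rho_eq_of_forall_le {d : ℕ} {W : Submodule ℝ (E (d + 1))} {x : E d} (hx : lift x ∈ W)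
    (h : ∀ y : E d, lift y ∈ W → ‖x‖ ≤ ‖y‖) : rho W = ‖x‖ := by
  refine le_antisymm ?_ ?_
  · have h1 : Metric.infDist 0 {x : E d | lift x ∈ W} ≤ dist 0 x :=
      Metric.infDist_le_dist_of_mem hx
    rwa [dist_zero_left] at h1
  · refine (Metric.le_infDist ⟨x, hx⟩).2 fun y hy => ?_
    simpa using h y hy

theorem rho_ker {d m : ℕ} {u : Matrix (Fin m) (Fin (d + 1)) ℝ} (h : (gram (J d 0) u).PosDef) :
    rho (LinearMap.ker (mv u)) = ‖footPoint u‖ :=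
  rho_eq_of_forall_le (lift_mem_ker_iff.2 (mv_footPoint h)) fun _ hy => norm_footPoint_le h hy

theorem mem_hits_cone_zero {d k : ℕ} {W : Gr d k} :
    W ∈ hits k (cone d 0) ↔ ∃ x : E d, lift x ∈ W.1 := by
  constructor
  · rintro ⟨ζ, hζ, h⟩
    rw [mem_cone_zero] at h
    refine ⟨proj ζ, ?_⟩
    have := W.1.smul_mem (lastCoord ζ)⁻¹ hζ
    rw [eq_smul_lift_proj h, smul_smul] at this
    simpa [h] using this
  · rintro ⟨x, hx⟩
    exact ⟨lift x, hx, by simp [mem_cone_zero]⟩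

theorem measurable_rho {d k : ℕ} : Measurable fun W : Gr d k => rho W.1 := by
  refine measurable_of_Iio fun r => ?_
  have ho : IsOpen {ζ : E (d + 1) | lastCoord ζ ≠ 0 ∧ ‖fstPart ζ‖ < r * |lastCoord ζ|} :=
    (isOpen_ne.preimage continuous_lastCoord).inter
      (isOpen_lt continuous_fstPart.norm (continuous_const.mul continuous_lastCoord.abs))
  -- The second set accounts for the subspaces that contain no lift: there `Metric.infDist` to the
  -- empty set takes the value `0`.
  have h : (fun W : Gr d k => rho W.1) ⁻¹' Set.Iio r =
      hits k {ζ : E (d + 1) | lastCoord ζ ≠ 0 ∧ ‖fstPart ζ‖ < r * |lastCoord ζ|} ∪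
        ((hits k (cone d 0))ᶜ ∩ {_W | 0 < r}) := by
    ext W
    simp only [Set.mem_preimage, Set.mem_Iio, Set.mem_union, Set.mem_inter_iff, Set.mem_compl_iff,
      Set.mem_ofPred_eq]
    by_cases hW : W ∈ hits k (cone d 0)
    · have hne : {x : E d | lift x ∈ W.1}.Nonempty := mem_hits_cone_zero.1 hW
      simp only [hW, not_true_eq_false, false_and, or_false]
      rw [rho, Metric.infDist_lt_iff hne]
      constructor
      · rintro ⟨x, hx, hxr⟩
        exact ⟨lift x, hx, by simp, by simpa using hxr⟩
      · rintro ⟨ζ, hζ, h0, hr⟩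
        have h1 := W.1.smul_mem (lastCoord ζ)⁻¹ hζ
        rw [eq_smul_lift_proj h0, smul_smul] at h1
        refine ⟨proj ζ, by simpa [h0] using h1, ?_⟩
        have h2 : 0 < |lastCoord ζ| := abs_pos.2 h0
        rw [dist_zero_left, proj, norm_neg, norm_smul, norm_inv, Real.norm_eq_abs,
          inv_mul_lt_iff₀ h2, mul_comm]
        exact hr
    · have he : {x : E d | lift x ∈ W.1} = ∅ := by
        ext x
        simpa using fun hx => hW (mem_hits_cone_zero.2 ⟨x, hx⟩)
      have hz : rho W.1 = 0 := by rw [rho, he, Metric.infDist_empty]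
      have hn : W ∉ hits k {ζ : E (d + 1) | lastCoord ζ ≠ 0 ∧ ‖fstPart ζ‖ < r * |lastCoord ζ|} := by
        rintro ⟨ζ, hζ, h0, -⟩
        exact hW ⟨ζ, hζ, mem_cone_zero.2 h0⟩
      simp [hW, hn, hz]
  rw [h]
  exact (measurableSet_hits ho).union
    ((measurableSet_hits (isOpen_cone d 0)).compl.inter (MeasurableSet.const _))

end KPlane

end

noncomputable section

namespace KPlane

open scoped Matrix

/-! ### Positivity on the annihilator -/

/-- The three curvatures. -/
def IsCurv (κ : ℝ) : Prop := κ = 1 ∨ κ = 0 ∨ κ = -1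

theorem form_J_self {d : ℕ} (κ : ℝ) (v : Fin (d + 1) → ℝ) :
    v ⬝ᵥ (J d κ *ᵥ v) =
      ‖fstPart (WithLp.toLp 2 v)‖ ^ 2 + κ * lastCoord (WithLp.toLp 2 v) ^ 2 := by
  rw [form_J, EuclideanSpace.norm_sq_eq]
  simp [fstPart, lastCoord, sq]

theorem dotProduct_split {d : ℕ} (v : Fin (d + 1) → ℝ) (ζ : E (d + 1)) :
    v ⬝ᵥ ζ.ofLp = inner ℝ (fstPart (WithLp.toLp 2 v)) (fstPart ζ) +
      lastCoord (WithLp.toLp 2 v) * lastCoord ζ := by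
  simp [dotProduct, Fin.sum_univ_castSucc, fstPart, lastCoord, EuclideanSpace.inner_eq_star_dotProduct,
    mul_comm]

/-- Annihilation says that the products of the last coordinates and of the first parts are opposite;
the latter is bounded by Cauchy–Schwarz. -/
theorem lastCoord_sq_mul_le {d : ℕ} {v : Fin (d + 1) → ℝ} {ζ : E (d + 1)} (h : v ⬝ᵥ ζ.ofLp = 0) :
    lastCoord (WithLp.toLp 2 v) ^ 2 * lastCoord ζ ^ 2 ≤
      ‖fstPart (WithLp.toLp 2 v)‖ ^ 2 * ‖fstPart ζ‖ ^ 2 := by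
  rw [dotProduct_split] at h
  have h1 : lastCoord (WithLp.toLp 2 v) * lastCoord ζ =
      -inner ℝ (fstPart (WithLp.toLp 2 v)) (fstPart ζ) := by linarith
  rw [← mul_pow, ← mul_pow, h1, neg_sq]
  exact sq_le_sq' (by linarith [abs_le.1 (abs_real_inner_le_norm (fstPart (WithLp.toLp 2 v))
    (fstPart ζ))]) (real_inner_le_norm _ _)

/-- A form which is positive on the vector `ζ` of the cone is positive on the annihilator of `ζ`. -/
theorem form_J_pos {d : ℕ} {κ : ℝ} (hκ : IsCurv κ) {v : Fin (d + 1) → ℝ} (hv : v ≠ 0)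
    {ζ : E (d + 1)} (hζ : ζ ∈ cone d κ) (h : v ⬝ᵥ ζ.ofLp = 0) : 0 < v ⬝ᵥ (J d κ *ᵥ v) := by
  have hle := lastCoord_sq_mul_le h
  have hv' : ¬ (‖fstPart (WithLp.toLp 2 v)‖ = 0 ∧ lastCoord (WithLp.toLp 2 v) = 0) := by
    rintro ⟨h1, h2⟩
    have : WithLp.toLp 2 v = (0 : E (d + 1)) := ext_parts (by rw [norm_eq_zero.1 h1]; rfl) h2
    exact hv (congrArg WithLp.ofLp this)
  rw [form_J_self]
  simp only [cone, Set.mem_ofPred_eq] at hζ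
  set a := ‖fstPart (WithLp.toLp 2 v)‖
  set c := lastCoord (WithLp.toLp 2 v)
  set b := ‖fstPart ζ‖
  set z := lastCoord ζ
  have ha0 : a = 0 → 0 < z ^ 2 → False := by
    intro ha hz
    refine hv' ⟨ha, ?_⟩
    rw [ha] at hle
    have : c ^ 2 ≤ 0 := by nlinarith
    nlinarith
  rcases hκ with rfl | rfl | rfl
  · by_contra h'
    push Not at h'
    exact hv' ⟨by nlinarith [sq_nonneg a, sq_nonneg c], by nlinarith [sq_nonneg a, sq_nonneg c]⟩
  · have hz : 0 < z ^ 2 := by linarith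
    have : a ≠ 0 := fun ha => ha0 ha hz
    positivity
  · have hz : 0 < z ^ 2 := by nlinarith [sq_nonneg b]
    have ha : 0 < a ^ 2 := by
      have : a ≠ 0 := fun ha => ha0 ha hz
      positivity
    by_contra h'
    push Not at h'
    nlinarith

theorem vecMul_dotProduct_eq_zero {m n : ℕ} {u : Matrix (Fin m) (Fin n) ℝ} {ζ : E n}
    (h : ζ ∈ LinearMap.ker (mv u)) (x : Fin m → ℝ) : (x ᵥ* u) ⬝ᵥ ζ.ofLp = 0 := by
  rw [← dotProduct_mv, LinearMap.mem_ker.1 h]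
  exact dotProduct_zero x

/-- All combinations of the rows of `u` annihilate the kernel, in particular one vector of the cone,
and `form_J_pos` makes the form positive on them. -/
theorem posDef_gram_of_hits {d m : ℕ} {κ : ℝ} (hκ : IsCurv κ)
    {u : Matrix (Fin m) (Fin (d + 1)) ℝ} (hu : (gram 1 u).det ≠ 0) {ζ : E (d + 1)}
    (hζ : ζ ∈ cone d κ) (h : ζ ∈ LinearMap.ker (mv u)) : (gram (J d κ) u).PosDef := by
  rw [posDef_gram_iff (J_transpose d κ)]
  intro x hx
  refine form_J_pos hκ (fun h0 => hx ?_) hζ (vecMul_dotProduct_eq_zero h x)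
  exact vecMul_injective_of_surjective (mv_surjective_of_det hu) x h0

theorem posDef_gram_zero_of_neg {d m : ℕ} {u : Matrix (Fin m) (Fin (d + 1)) ℝ}
    (h : (gram (J d (-1)) u).PosDef) : (gram (J d 0) u).PosDef := by
  rw [posDef_gram_iff (J_transpose d _)] at h ⊢
  intro x hx
  have h1 := h x hx
  rw [form_J_self] at h1 ⊢
  nlinarith [sq_nonneg (lastCoord (WithLp.toLp 2 (x ᵥ* u)))]

/-- For `κ = 1` any nonzero vector of the kernel will do. Otherwise the lift of the foot point is
the witness: for `κ = -1`, positivity of the Gram determinant and `det_gram_J` put the foot point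
inside the unit ball. -/
theorem ker_hits_cone {d k m : ℕ} (hm : m + k = d) {κ : ℝ} (hκ : IsCurv κ)
    {u : Matrix (Fin m) (Fin (d + 1)) ℝ} (hu : (gram (J d κ) u).PosDef) :
    ∃ ζ ∈ LinearMap.ker (mv u), ζ ∈ cone d κ := by
  rcases hκ with rfl | rfl | rfl
  · have h1 := (finrank_ker_mv_eq_iff hm u).2 (det_gram_one_ne_zero_of_posDef hu)
    have h2 : LinearMap.ker (mv u) ≠ ⊥ := by
      intro h
      rw [h, finrank_bot] at h1
      omega
    obtain ⟨ζ, hζ, h0⟩ := Submodule.exists_mem_ne_zero_of_ne_bot h2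
    exact ⟨ζ, hζ, mem_cone_one.2 h0⟩
  · exact ⟨lift (footPoint u), lift_mem_ker_iff.2 (mv_footPoint hu), by simp [mem_cone_zero]⟩
  · have h0 := posDef_gram_zero_of_neg hu
    refine ⟨lift (footPoint u), lift_mem_ker_iff.2 (mv_footPoint h0), ?_⟩
    have h1 := det_gram_J h0 (-1)
    have h2 := hu.det_pos
    rw [h1] at h2
    have h3 := pos_of_mul_pos_right h2 h0.det_pos.le
    simpa [cone] using h3

theorem kerGr_mem_hits_cone_iff {d k m : ℕ} [Nonempty (Gr d k)] (hm : m + k = d) {κ : ℝ}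
    (hκ : IsCurv κ) {u : Matrix (Fin m) (Fin (d + 1)) ℝ} (hu : (gram 1 u).det ≠ 0) :
    (kerGr u : Gr d k) ∈ hits k (cone d κ) ↔ (gram (J d κ) u).PosDef := by
  constructor
  · rintro ⟨ζ, h1, h2⟩
    rw [kerGr_val hm hu] at h1
    exact posDef_gram_of_hits hκ hu h2 h1
  · intro h
    obtain ⟨ζ, h1, h2⟩ := ker_hits_cone hm hκ h
    exact ⟨ζ, by rw [kerGr_val hm hu]; exact h1, h2⟩

/-- The isometry group acts transitively on the subspaces that hit the cone. -/
theorem exists_act_eq_of_hits {d k m : ℕ} (hm : m + k = d) {κ : ℝ} (hκ : IsCurv κ) {W W' : Gr d k}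
    (hW : W ∈ hits k (cone d κ)) (hW' : W' ∈ hits k (cone d κ)) :
    ∃ g : isoGroup d κ, act g.1 W = W' := by
  obtain ⟨u, hu, huW⟩ := exists_ker_mv_eq hm W
  obtain ⟨v, hv, hvW⟩ := exists_ker_mv_eq hm W'
  obtain ⟨ζ, h1, h2⟩ := hW
  obtain ⟨η, h3, h4⟩ := hW'
  exact exists_act_eq (posDef_gram_of_hits hκ hu h2 (by rw [huW]; exact h1))
    (posDef_gram_of_hits hκ hv h4 (by rw [hvW]; exact h3)) huW.symm hvW.symm

/-! ### The invariant measures -/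

/-- Matrices whose Gram matrix is positive definite and close to the identity. -/
def baseSet (d m : ℕ) (κ : ℝ) : Set (Matrix (Fin m) (Fin (d + 1)) ℝ) :=
  {u | (gram (J d κ) u).PosDef} ∩ {u | gram (J d κ) u ∈ nearOne m}

theorem measurableSet_gram_nearOne (d m : ℕ) (κ : ℝ) :
    MeasurableSet {u : Matrix (Fin m) (Fin (d + 1)) ℝ | gram (J d κ) u ∈ nearOne m} :=
  (continuous_gram _).measurable (isClosed_nearOne m).measurableSet

theorem measurableSet_posDef_gram (d m : ℕ) (κ : ℝ) :
    MeasurableSet {u : Matrix (Fin m) (Fin (d + 1)) ℝ | (gram (J d κ) u).PosDef} :=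
  (isOpen_posDef_gram (J_transpose d κ)).measurableSet

theorem measurableSet_baseSet (d m : ℕ) (κ : ℝ) : MeasurableSet (baseSet d m κ) :=
  (measurableSet_posDef_gram d m κ).inter (measurableSet_gram_nearOne d m κ)

/-- The invariant measure on the subspaces that hit the cone, as a measure on the Grassmannian. -/
def grMeasure (d k m : ℕ) [Nonempty (Gr d k)] (κ : ℝ) : Measure (Gr d k) :=
  ((volume : Measure (Matrix (Fin m) (Fin (d + 1)) ℝ)).restrict (baseSet d m κ)).map kerGr

section grMeasure

variable {d k m : ℕ} [Nonempty (Gr d k)] {κ : ℝ}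

theorem ae_grMeasure_hits (hm : m + k = d) (hκ : IsCurv κ) :
    ∀ᵐ W ∂grMeasure d k m κ, W ∈ hits k (cone d κ) := by
  have hmeas : MeasurableSet {W | W ∈ hits k (cone d κ)} := measurableSet_hits (isOpen_cone d κ)
  rw [grMeasure, ae_map_iff (measurable_kerGr hm).aemeasurable hmeas]
  filter_upwards [ae_restrict_mem (measurableSet_baseSet d m κ)] with u hu
  exact (kerGr_mem_hits_cone_iff hm hκ (det_gram_one_ne_zero_of_posDef hu.1)).2 hu.1

theorem measurePreserving_mul_right {m n : ℕ} {M : Matrix (Fin n) (Fin n) ℝ} (hM : M.det ^ 2 = 1) :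
    MeasurePreserving (fun u : Matrix (Fin m) (Fin n) ℝ => u * M) volume volume := by
  have h0 : M.det ≠ 0 := by rintro h; rw [h] at hM; norm_num at hM
  have h1 : absDet M = 1 := by
    rw [absDet, ← Real.sqrt_sq_eq_abs, hM]; simp
  refine ⟨measurable_mul_right M, ?_⟩
  ext A hA
  have h2 := lintegral_mul_right (m := m) h0 (F := A.indicator 1) (measurable_one.indicator hA)
  rw [h1, one_pow, one_mul, lintegral_indicator_one hA] at h2
  rw [← h2, Measure.map_apply (measurable_mul_right M) hA,
    ← lintegral_indicator_one (measurable_mul_right M hA)]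
  rfl

/-- Right multiplication by `g⁻¹` moves kernels by `g`, preserves Lebesgue measure because the
determinant is `±1`, and preserves `baseSet` because it preserves Gram matrices. -/
theorem grMeasure_map_act (hm : m + k = d) (g : isoGroup d κ) :
    (grMeasure d k m κ).map (act g.1) = grMeasure d k m κ := by
  have hK := measurable_kerGr (k := k) (m := m) hm
  have hdet := (mem_isoGroup.1 (g⁻¹).2).2
  have hpre : (fun u : Matrix (Fin m) (Fin (d + 1)) ℝ => u * (g⁻¹).1.val) ⁻¹' baseSet d m κ =
      baseSet d m κ := by
    ext u
    simp only [baseSet, Set.mem_preimage, Set.mem_inter_iff, Set.mem_ofPred_eq, gram_mul_isoGroup]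
  have hmp := (measurePreserving_mul_right (m := m) hdet).restrict_preimage
    (measurableSet_baseSet d m κ)
  rw [hpre] at hmp
  have hcongr : (act g.1 ∘ kerGr : Matrix (Fin m) (Fin (d + 1)) ℝ → Gr d k)
      =ᵐ[volume.restrict (baseSet d m κ)] (kerGr ∘ fun u => u * (g⁻¹).1.val) := by
    filter_upwards [ae_restrict_mem (measurableSet_baseSet d m κ)] with u hu
    have hu' : (gram (J d κ) (u * (g⁻¹).1.val)).PosDef := by rw [gram_mul_isoGroup]; exact hu.1
    refine Subtype.ext ?_
    ext ζ
    rw [Function.comp_apply, Function.comp_apply, mem_act,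
      kerGr_val hm (det_gram_one_ne_zero_of_posDef hu.1),
      kerGr_val hm (det_gram_one_ne_zero_of_posDef hu'), LinearMap.mem_ker, LinearMap.mem_ker,
      mv_mul]
    rfl
  rw [grMeasure, Measure.map_map (measurable_act_right g.1) hK, Measure.map_congr hcongr,
    ← Measure.map_map hK (measurable_mul_right _), hmp.map_eq]

/-- The first `m` coordinate covectors are orthonormal for every `κ`, because `m ≤ d` keeps the last
coordinate out. -/
theorem exists_gram_eq_one (hm : m ≤ d) (κ : ℝ) :
    ∃ u : Matrix (Fin m) (Fin (d + 1)) ℝ, gram (J d κ) u = 1 := by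
  refine ⟨Matrix.of fun i j => if (j : ℕ) = i then 1 else 0, ?_⟩
  have hl : lastCol (Matrix.of fun (i : Fin m) (j : Fin (d + 1)) =>
      if (j : ℕ) = i then (1 : ℝ) else 0) = 0 := by
    ext i
    have : d ≠ (i : ℕ) := by omega
    simp [lastCol, this]
  rw [gram_J, hl]
  ext i j
  have hiff : ∀ (l : Fin d) (i : Fin m), ((l : ℕ) = i) = (l = Fin.castLE hm i) := by
    intro l i
    rw [Fin.ext_iff]; rfl
  simp only [headCols, smul_zero, Matrix.add_apply, Matrix.mul_apply, Matrix.transpose_apply,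
    Matrix.submatrix_apply, Matrix.of_apply, id, Fin.val_castSucc, hiff, Matrix.one_apply]
  simp [Matrix.vecMulVec_apply, eq_comm]

theorem grMeasure_ne_zero (hm : m + k = d) (κ : ℝ) : grMeasure d k m κ ≠ 0 := by
  intro h
  have h1 := congrArg (fun μ : Measure (Gr d k) => μ Set.univ) h
  simp only [grMeasure, Measure.map_apply (measurable_kerGr hm) MeasurableSet.univ,
    Set.preimage_univ, Measure.restrict_apply_univ, Measure.coe_zero, Pi.zero_apply] at h1
  obtain ⟨O, hOK, hO, h1O⟩ := exists_isOpen_subset_nearOne m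
  obtain ⟨u, hu⟩ := exists_gram_eq_one (d := d) (m := m) (by omega) κ
  have ho : IsOpen ({u : Matrix (Fin m) (Fin (d + 1)) ℝ | (gram (J d κ) u).PosDef} ∩
      gram (J d κ) ⁻¹' O) :=
    (isOpen_posDef_gram (J_transpose d κ)).inter (hO.preimage (continuous_gram _))
  refine ho.measure_ne_zero volume ⟨u, ?_, ?_⟩ (measure_mono_null ?_ h1)
  · simp only [Set.mem_ofPred_eq, hu]; exact Matrix.PosDef.one
  · rw [Set.mem_preimage, hu]; exact h1O
  · exact fun v hv => ⟨hv.1, hOK hv.2⟩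

theorem volume_lt_top_of_abs_le {m n : ℕ} (C : ℝ) :
    volume {u : Matrix (Fin m) (Fin n) ℝ | ∀ i j, |u i j| ≤ C} < ∞ := by
  have hc : IsClosed {u : Matrix (Fin m) (Fin n) ℝ | ∀ i j, |u i j| ≤ C} := by
    simp only [Set.ofPred_forall]
    exact isClosed_iInter fun i => isClosed_iInter fun j =>
      isClosed_le (Continuous.matrix_elem continuous_id i j).abs continuous_const
  exact (isCompact_of_isClosed_of_abs_le hc C fun u hu => hu).measure_lt_top

/-- Vectors of bounded norm that annihilate a vector well inside the cone are bounded. -/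
theorem sq_le_of_annihilates {κ : ℝ} (hκ : IsCurv κ) {v : Fin (d + 1) → ℝ} {ζ : E (d + 1)}
    {R : ℝ} (hR : 0 ≤ R)
    (hζ : lastCoord ζ ^ 2 + ‖fstPart ζ‖ ^ 2 < R * (lastCoord ζ ^ 2 + κ * ‖fstPart ζ‖ ^ 2))
    (h : v ⬝ᵥ ζ.ofLp = 0) (hv : v ⬝ᵥ (J d κ *ᵥ v) ≤ 2) :
    ‖fstPart (WithLp.toLp 2 v)‖ ^ 2 ≤ 2 * R + 2 ∧
      lastCoord (WithLp.toLp 2 v) ^ 2 ≤ 2 * R + 2 := by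
  have hle := lastCoord_sq_mul_le h
  rw [form_J_self] at hv
  set a := ‖fstPart (WithLp.toLp 2 v)‖ ^ 2
  set c := lastCoord (WithLp.toLp 2 v) ^ 2
  set b := ‖fstPart ζ‖ ^ 2
  set z := lastCoord ζ ^ 2
  have ha : 0 ≤ a := sq_nonneg _
  have hc : 0 ≤ c := sq_nonneg _
  have hb : 0 ≤ b := sq_nonneg _
  have hz : 0 ≤ z := sq_nonneg _
  rcases hκ with rfl | rfl | rfl
  · exact ⟨by linarith, by linarith⟩
  · refine ⟨by linarith, ?_⟩
    have hz' : 0 < z := by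
      rcases hz.lt_or_eq with h' | h'
      · exact h'
      · rw [← h'] at hζ; linarith
    have : c * z ≤ 2 * R * z := by nlinarith
    nlinarith
  · have hz' : 0 < z := by
      rcases hz.lt_or_eq with h' | h'
      · exact h'
      · rw [← h'] at hζ; nlinarith
    have hbz : 0 < z - b := by
      by_contra h'
      push Not at h'
      nlinarith
    have h1 : a * (z - b) ≤ 2 * R * (z - b) := by nlinarith
    have h2 : a ≤ 2 * R := le_of_mul_le_mul_right h1 hbz
    have h3 : c * z ≤ a * z := by nlinarith
    have h4 : c ≤ a := le_of_mul_le_mul_right h3 hz'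
    exact ⟨by linarith, by linarith⟩

/-- The entries of the Gram matrix bound the rows only with respect to the form. A kernel vector
well inside the cone turns this into a Euclidean bound, so the matrices in question form a bounded
set. -/
theorem grMeasure_hits_lt_top (hm : m + k = d) (hκ : IsCurv κ) (R : ℕ) :
    grMeasure d k m κ (hits k {ζ | lastCoord ζ ^ 2 + ‖fstPart ζ‖ ^ 2 <
      R * (lastCoord ζ ^ 2 + κ * ‖fstPart ζ‖ ^ 2)}) < ∞ := by
  have ho : IsOpen {ζ : E (d + 1) | lastCoord ζ ^ 2 + ‖fstPart ζ‖ ^ 2 <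
      R * (lastCoord ζ ^ 2 + κ * ‖fstPart ζ‖ ^ 2)} :=
    isOpen_lt ((continuous_lastCoord.pow 2).add (continuous_fstPart.norm.pow 2))
      (continuous_const.mul ((continuous_lastCoord.pow 2).add
        (continuous_const.mul (continuous_fstPart.norm.pow 2))))
  rw [grMeasure, Measure.map_apply (measurable_kerGr hm) (measurableSet_hits ho),
    Measure.restrict_apply (measurable_kerGr hm (measurableSet_hits ho))]
  refine lt_of_le_of_lt (measure_mono ?_) (volume_lt_top_of_abs_le (2 * R + 2 : ℝ))
  rintro u ⟨⟨ζ, hζ, hζR⟩, hu⟩ i j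
  rw [kerGr_val hm (det_gram_one_ne_zero_of_posDef hu.1)] at hζ
  have h1 : u i ⬝ᵥ ζ.ofLp = 0 := by
    have := vecMul_dotProduct_eq_zero hζ (Pi.single i 1)
    rwa [Matrix.single_one_vecMul] at this
  have h2 : u i ⬝ᵥ (J d κ *ᵥ u i) ≤ 2 := by
    rw [← gram_apply]
    exact (abs_le.1 (hu.2.2 i i)).2
  have hR : (0 : ℝ) ≤ R := Nat.cast_nonneg R
  obtain ⟨h3, h4⟩ := sq_le_of_annihilates hκ hR hζR h1 h2
  have h5 : u i j ^ 2 ≤ 2 * R + 2 := by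
    refine Fin.lastCases h4 (fun l => ?_) j
    refine le_trans ?_ h3
    rw [EuclideanSpace.norm_sq_eq]
    refine le_trans ?_ (Finset.single_le_sum (fun l _ => sq_nonneg _) (Finset.mem_univ l))
    simp [fstPart]
  exact abs_le_of_sq_le_sq (by nlinarith) (by linarith)

/-- As `R` grows, the sets of `grMeasure_hits_lt_top` exhaust the subspaces that hit the cone, and
the other subspaces are null. -/
theorem sigmaFinite_grMeasure (hm : m + k = d) (hκ : IsCurv κ) :
    SigmaFinite (grMeasure d k m κ) := by
  refine ⟨⟨⟨fun R => hits k {ζ | lastCoord ζ ^ 2 + ‖fstPart ζ‖ ^ 2 <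
      (R : ℕ) * (lastCoord ζ ^ 2 + κ * ‖fstPart ζ‖ ^ 2)} ∪ (hits k (cone d κ))ᶜ,
    fun _ => trivial, fun R => ?_, ?_⟩⟩⟩
  · refine (measure_union_le _ _).trans_lt (ENNReal.add_lt_top.2
      ⟨grMeasure_hits_lt_top hm hκ R, ?_⟩)
    have := ae_iff.1 (ae_grMeasure_hits (k := k) hm hκ)
    exact lt_of_le_of_lt this.le ENNReal.zero_lt_top
  · refine Set.eq_univ_of_forall fun W => ?_
    by_cases hW : W ∈ hits k (cone d κ)
    · obtain ⟨ζ, h1, h2⟩ := hW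
      obtain ⟨R, hR⟩ := exists_nat_gt ((lastCoord ζ ^ 2 + ‖fstPart ζ‖ ^ 2) /
        (lastCoord ζ ^ 2 + κ * ‖fstPart ζ‖ ^ 2))
      refine Set.mem_iUnion.2 ⟨R, Or.inl ⟨ζ, h1, ?_⟩⟩
      exact (div_lt_iff₀ h2).1 hR
    · exact Set.mem_iUnion.2 ⟨0, Or.inr hW⟩

/-- For `κ = 1` and `R = 2` the condition reads `|ζ|² < 2 |ζ|²`, which every nonzero vector
satisfies. -/
theorem isFiniteMeasure_grMeasure_one (hm : m + k = d) : IsFiniteMeasure (grMeasure d k m 1) := by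
  refine ⟨?_⟩
  refine lt_of_le_of_lt ?_ (grMeasure_hits_lt_top (κ := 1) hm (Or.inl rfl) 2)
  have h := ae_grMeasure_hits (k := k) (κ := 1) hm (Or.inl rfl)
  refine measure_mono_ae ?_
  filter_upwards [h] with W hW _
  obtain ⟨ζ, h1, h2⟩ := hW
  refine ⟨ζ, h1, ?_⟩
  simp only [cone, Set.mem_ofPred_eq] at h2 ⊢
  push_cast
  linarith

end grMeasure

/-! ### Densities between the invariant measures -/

/-- The density of the flat invariant measure with respect to the curved ones. -/
def weight {d : ℕ} (κ : ℝ) (W : Submodule ℝ (E (d + 1))) : ℝ≥0∞ :=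
  ENNReal.ofReal √(1 + κ * rho W ^ 2)

theorem measurable_weight {d k : ℕ} (κ : ℝ) : Measurable fun W : Gr d k => weight κ W.1 :=
  ENNReal.measurable_ofReal.comp
    ((measurable_const.add (measurable_const.mul (measurable_rho.pow_const 2))).sqrt)

/-- The invariant measures of the three geometries are mutually absolutely continuous on their
common domain, with explicit densities. -/
theorem exists_lintegral_grMeasure_eq {d k m : ℕ} [Nonempty (Gr d k)] (hm : m + k = d) :
    ∃ c : ℝ≥0∞, c ≠ 0 ∧ c ≠ ∞ ∧ ∀ κ : ℝ, IsCurv κ → ∀ φ : Gr d k → ℝ≥0∞, Measurable φ →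
      c * ∫⁻ W in hits k (cone d κ), φ W * (weight κ W.1 ^ (d + 1))⁻¹ ∂grMeasure d k m 0 =
        ∫⁻ W in hits k (cone d 0), φ W ∂grMeasure d k m κ := by
  obtain ⟨c, hc0, hct, hc⟩ := exists_lintegral_gram_eq m (d + 1)
  refine ⟨c, hc0, hct, fun κ hκ φ hφ => ?_⟩
  have hK := measurable_kerGr (k := k) (m := m) hm
  set S : Set (Matrix (Fin m) (Fin (d + 1)) ℝ) :=
    {u | (gram (J d 0) u).PosDef} ∩ {u | (gram (J d κ) u).PosDef} with hS
  have hSm : MeasurableSet S :=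
    (measurableSet_posDef_gram d m 0).inter (measurableSet_posDef_gram d m κ)
  -- The cut-off to matrices with both Gram matrices positive definite corresponds to subspaces that
  -- hit both cones. It is invariant under left multiplication by invertible matrices, as
  -- `exists_lintegral_gram_eq` requires.
  set ψ : Matrix (Fin m) (Fin (d + 1)) ℝ → ℝ≥0∞ := S.indicator fun u => φ (kerGr u) with hψ
  have hψm : Measurable ψ := (hφ.comp hK).indicator hSm
  have hinv : ∀ (T : Matrix (Fin m) (Fin m) ℝ) (u : Matrix (Fin m) (Fin (d + 1)) ℝ),
      T.det ≠ 0 → ψ (T * u) = ψ u := by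
    intro T u hT
    have hpos : ∀ κ, (gram (J d κ) (T * u)).PosDef ↔ (gram (J d κ) u).PosDef := by
      intro κ
      rw [gram_mul, ← Matrix.conjTranspose_eq_transpose_of_trivial T]
      exact Matrix.IsUnit.posDef_star_right_conjugate_iff
        ((Matrix.isUnit_iff_isUnit_det T).2 (isUnit_iff_ne_zero.2 hT))
    by_cases hu : u ∈ S
    · have hTu : T * u ∈ S := ⟨(hpos 0).2 hu.1, (hpos κ).2 hu.2⟩
      rw [hψ, Set.indicator_of_mem hu, Set.indicator_of_mem hTu]
      congr 1
      refine Subtype.ext ?_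
      rw [kerGr_val hm (det_gram_one_ne_zero_of_posDef hu.1),
        kerGr_val hm (det_gram_one_ne_zero_of_posDef hTu.1), ker_mv_mul_left hT]
    · have hTu : T * u ∉ S := fun h => hu ⟨(hpos 0).1 h.1, (hpos κ).1 h.2⟩
      rw [hψ, Set.indicator_of_notMem hu, Set.indicator_of_notMem hTu]
  have hA : ∀ u, ψ u ≠ 0 → (gram (J d 0) u).PosDef := fun u hu =>
    (Set.mem_of_indicator_ne_zero hu).1
  have hB : ∀ u, ψ u ≠ 0 → (gram (J d κ) u).PosDef := fun u hu =>
    (Set.mem_of_indicator_ne_zero hu).2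
  have key := hc (J d 0) (J d κ) ψ hψm hinv hA hB
  have hm0 := measurableSet_hits (k := k) (isOpen_cone d 0)
  have hmκ := measurableSet_hits (k := k) (isOpen_cone d κ)
  have hw : Measurable fun W : Gr d k => φ W * (weight κ W.1 ^ (d + 1))⁻¹ :=
    hφ.mul ((measurable_weight κ).pow_const _).inv
  rw [grMeasure, grMeasure, setLIntegral_map hmκ hw hK, setLIntegral_map hm0 hφ hK,
    Measure.restrict_restrict (hK hmκ), Measure.restrict_restrict (hK hm0)]
  refine Eq.trans (congrArg (c * ·) ?_) (key.trans ?_)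
  · rw [← lintegral_indicator ((hK hmκ).inter (measurableSet_baseSet d m 0)),
      ← lintegral_indicator (measurableSet_gram_nearOne d m 0)]
    refine lintegral_congr fun u => ?_
    by_cases hu : gram (J d 0) u ∈ nearOne m
    · rw [Set.indicator_of_mem (s := {u | gram (J d 0) u ∈ nearOne m}) (by exact hu)]
      by_cases hu2 : u ∈ S
      · have hmem : u ∈ kerGr ⁻¹' hits k (cone d κ) ∩ baseSet d m 0 :=
          ⟨(kerGr_mem_hits_cone_iff hm hκ (det_gram_one_ne_zero_of_posDef hu2.1)).2 hu2.2,
            hu2.1, hu⟩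
        rw [Set.indicator_of_mem hmem, hψ, Set.indicator_of_mem hu2]
        congr 1
        -- The square root of `det_gram_J`: the ratio of the Gram determinants is a function of the
        -- subspace, namely `1 + κρ²`.
        have h1 : sqrtDet (gram (J d κ) u) =
            sqrtDet (gram (J d 0) u) * weight κ (kerGr u : Gr d k).1 := by
          rw [weight, kerGr_val hm (det_gram_one_ne_zero_of_posDef hu2.1), rho_ker hu2.1, sqrtDet,
            sqrtDet, det_gram_J hu2.1 κ, Real.sqrt_mul hu2.1.det_pos.le,
            ENNReal.ofReal_mul (Real.sqrt_nonneg _)]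
        have h2 : sqrtDet (gram (J d 0) u) ^ (d + 1) ≠ 0 := by
          have := Real.sqrt_pos.2 hu2.1.det_pos
          simp [sqrtDet, hu2.1.det_pos]
        have h3 : sqrtDet (gram (J d 0) u) ^ (d + 1) ≠ ∞ :=
          ENNReal.pow_ne_top (by simp [sqrtDet])
        rw [h1, mul_pow, ENNReal.mul_inv (Or.inl h2) (Or.inl h3), ← mul_assoc,
          ENNReal.mul_inv_cancel h2 h3, one_mul]
      · have hmem : u ∉ kerGr ⁻¹' hits k (cone d κ) ∩ baseSet d m 0 := fun h =>
          hu2 ⟨h.2.1, (kerGr_mem_hits_cone_iff hm hκ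
            (det_gram_one_ne_zero_of_posDef h.2.1)).1 h.1⟩
        rw [Set.indicator_of_notMem hmem, hψ, Set.indicator_of_notMem hu2, zero_mul]
    · rw [Set.indicator_of_notMem (s := {u | gram (J d 0) u ∈ nearOne m}) (by exact hu),
        Set.indicator_of_notMem fun h => hu h.2.2]
  · symm
    rw [← lintegral_indicator ((hK hm0).inter (measurableSet_baseSet d m κ)),
      ← lintegral_indicator (measurableSet_gram_nearOne d m κ)]
    refine lintegral_congr fun u => ?_
    by_cases hu : gram (J d κ) u ∈ nearOne m
    · rw [Set.indicator_of_mem (s := {u | gram (J d κ) u ∈ nearOne m}) (by exact hu)]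
      by_cases hu2 : u ∈ S
      · have hmem : u ∈ kerGr ⁻¹' hits k (cone d 0) ∩ baseSet d m κ :=
          ⟨(kerGr_mem_hits_cone_iff hm (Or.inr (Or.inl rfl))
            (det_gram_one_ne_zero_of_posDef hu2.1)).2 hu2.1, hu2.2, hu⟩
        rw [Set.indicator_of_mem hmem, hψ, Set.indicator_of_mem hu2]
      · have hmem : u ∉ kerGr ⁻¹' hits k (cone d 0) ∩ baseSet d m κ := fun h =>
          hu2 ⟨(kerGr_mem_hits_cone_iff hm (Or.inr (Or.inl rfl))
            (det_gram_one_ne_zero_of_posDef h.2.1)).1 h.1, h.2.1⟩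
        rw [Set.indicator_of_notMem hmem, hψ, Set.indicator_of_notMem hu2]
    · rw [Set.indicator_of_notMem (s := {u | gram (J d κ) u ∈ nearOne m}) (by exact hu),
        Set.indicator_of_notMem fun h => hu h.2.2]

/-- Uniqueness of the invariant measures on the Grassmannian. -/
theorem exists_eq_smul_grMeasure {d k m : ℕ} [Nonempty (Gr d k)] (hm : m + k = d) {κ : ℝ}
    (hκ : IsCurv κ) (μ : Measure (Gr d k)) [SigmaFinite μ] (hμ0 : μ ≠ 0)
    (hμS : ∀ᵐ W ∂μ, W ∈ hits k (cone d κ)) (hμ : ∀ g : isoGroup d κ, μ.map (act g.1) = μ) :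
    ∃ c : ℝ≥0∞, c ≠ 0 ∧ c ≠ ∞ ∧ μ = c • grMeasure d k m κ := by
  have := sigmaFinite_grMeasure (k := k) hm hκ
  exact exists_eq_smul_of_transitive (H := isoGroup d κ) (a := fun g W => act g.1 W)
    (measurable_act continuous_subtype_val) (fun W => act_one W)
    (fun g h W => act_mul g.1 h.1 W)
    (fun W hW W' hW' => exists_act_eq_of_hits hm hκ hW hW') μ _ hμ0 (grMeasure_ne_zero hm κ) hμS
    (ae_grMeasure_hits hm hκ) hμ fun g => grMeasure_map_act hm g

end KPlane

end

noncomputable section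

namespace KPlane

/-! ### The volume of a subspace in coordinates -/

theorem form_add_left (ν : Curv) {d : ℕ} (ζ η ξ : E (d + 1)) :
    form ν (ζ + η) ξ = form ν ζ ξ + form ν η ξ := by
  simp only [form, lastCoord_add, fstPart_add, inner_add_left]; ring

theorem form_smul_left (ν : Curv) {d : ℕ} (c : ℝ) (ζ ξ : E (d + 1)) :
    form ν (c • ζ) ξ = c * form ν ζ ξ := by
  simp only [form, lastCoord_smul, fstPart_smul, real_inner_smul_left]; ring

theorem form_comm (ν : Curv) {d : ℕ} (ζ ξ : E (d + 1)) : form ν ζ ξ = form ν ξ ζ := by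
  simp only [form, real_inner_comm, mul_comm]

theorem form_add_right (ν : Curv) {d : ℕ} (ζ η ξ : E (d + 1)) :
    form ν ξ (ζ + η) = form ν ξ ζ + form ν ξ η := by
  rw [form_comm, form_add_left, form_comm ν ζ, form_comm ν η]

theorem form_smul_right (ν : Curv) {d : ℕ} (c : ℝ) (ζ ξ : E (d + 1)) :
    form ν ξ (c • ζ) = c * form ν ξ ζ := by
  rw [form_comm, form_smul_left, form_comm]

/-- The restriction of the form to a subspace, as a bilinear form. -/
def formBilin (ν : Curv) {d : ℕ} (W : Submodule ℝ (E (d + 1))) : LinearMap.BilinForm ℝ W :=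
  LinearMap.mk₂ ℝ (fun w w' : W => form ν (w : E (d + 1)) w')
    (fun _ _ _ => form_add_left ν _ _ _) (fun _ _ _ => form_smul_left ν _ _ _)
    (fun _ _ _ => form_add_right ν _ _ _) (fun _ _ _ => form_smul_right ν _ _ _)

/-- The Gram matrix of a family of vectors. -/
def formGram (ν : Curv) {d : ℕ} {ι : Type*} (v : ι → E (d + 1)) : Matrix ι ι ℝ :=
  Matrix.of fun i j => form ν (v i) (v j)

theorem toMatrix_formBilin (ν : Curv) {d : ℕ} {W : Submodule ℝ (E (d + 1))} {ι : Type*} [Fintype ι]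
    [DecidableEq ι] (b : Module.Basis ι ℝ W) :
    LinearMap.BilinForm.toMatrix b (formBilin ν W) = formGram ν fun i => (b i : E (d + 1)) := by
  ext i j
  rw [LinearMap.BilinForm.toMatrix_apply]
  rfl

/-- Each measure gives mass `1` to the parallelepiped of its own basis, and the measure of `b` gives
mass `|b.det c|` to that of `c`. -/
theorem ofReal_abs_det_smul_addHaar {V ι : Type*} [NormedAddCommGroup V] [NormedSpace ℝ V]
    [FiniteDimensional ℝ V] [MeasurableSpace V] [BorelSpace V] [Fintype ι] [DecidableEq ι]
    (b c : Module.Basis ι ℝ V) :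
    ENNReal.ofReal |b.det c| • c.addHaar = b.addHaar := by
  have h0 : b.det c ≠ 0 := (b.isUnit_det c).ne_zero
  have h1 : ENNReal.ofReal |b.det c| ≠ 0 := by simpa using h0
  have h2 : c.addHaar = (ENNReal.ofReal |b.det c|)⁻¹ • b.addHaar := by
    have := Measure.IsAddHaarMeasure.smul b.addHaar (ENNReal.inv_ne_zero.2 ENNReal.ofReal_ne_top)
      (ENNReal.inv_ne_top.2 h1)
    rw [c.addHaar_eq_iff, Measure.smul_apply, smul_eq_mul]
    have h3 : (c.parallelepiped : Set V) = parallelepiped c := c.coe_parallelepiped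
    rw [h3, Measure.addHaar_parallelepiped, ENNReal.inv_mul_cancel h1 ENNReal.ofReal_ne_top]
  rw [h2, smul_smul, ENNReal.mul_inv_cancel h1 ENNReal.ofReal_ne_top, one_smul]

/-- The normalized volume of a subspace may be computed in any basis. -/
theorem formVolume_eq (ν : Curv) {d : ℕ} (W : Submodule ℝ (E (d + 1))) {ι : Type*} [Fintype ι]
    [DecidableEq ι] (b : Module.Basis ι ℝ W) :
    formVolume ν W = ENNReal.ofReal √|(formGram ν fun i => (b i : E (d + 1))).det| • b.addHaar := by
  have hcard : Fintype.card ι = Fintype.card (Fin (Module.finrank ℝ W)) := by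
    rw [Fintype.card_fin, Module.finrank_eq_card_basis b]
  let e : ι ≃ Fin (Module.finrank ℝ W) := Fintype.equivOfCardEq hcard
  set c := b.reindex e with hc
  have h1 : (formGram ν fun i => (b i : E (d + 1))).det =
      (formGram ν fun i => (c i : E (d + 1))).det := by
    rw [← Matrix.det_submatrix_equiv_self e]
    congr 1
    ext i j
    simp [formGram, hc]
  have h2 : b.addHaar = c.addHaar := (b.addHaar_reindex e).symm
  set a := Module.finBasis ℝ W with ha
  -- Under a change of basis the Gram determinant gains the square of the determinant of the change;
  -- its square root cancels the factor between the two Haar measures.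
  have h3 : (formGram ν fun i => (c i : E (d + 1))).det =
      (a.det c) ^ 2 * (formGram ν fun i => (a i : E (d + 1))).det := by
    rw [← toMatrix_formBilin, ← toMatrix_formBilin,
      ← LinearMap.BilinForm.toMatrix_mul_basis_toMatrix a c, Matrix.det_mul, Matrix.det_mul,
      Matrix.det_transpose, Module.Basis.det_apply]
    ring
  rw [h1, h2, h3, abs_mul, abs_of_nonneg (sq_nonneg _), Real.sqrt_mul (sq_nonneg _),
    Real.sqrt_sq_eq_abs, mul_comm, ENNReal.ofReal_mul (Real.sqrt_nonneg _), mul_smul,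
    ofReal_abs_det_smul_addHaar]
  rfl

theorem continuous_form (ν : Curv) {d : ℕ} : Continuous fun ζ : E (d + 1) => form ν ζ ζ := by
  unfold form
  exact (continuous_lastCoord.mul continuous_lastCoord).add
    (continuous_const.mul (continuous_fstPart.inner continuous_fstPart))

theorem measurable_radial (ν : Curv) {d : ℕ} : Measurable (radial ν : E (d + 1) → E (d + 1)) :=
  ((continuous_form ν).measurable.sqrt.inv).smul measurable_id

theorem measurable_proj {d : ℕ} : Measurable (proj : E (d + 1) → E d) :=
  (continuous_lastCoord.measurable.inv.smul continuous_fstPart.measurable).neg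

theorem measurable_bracket (ν : Curv) {d : ℕ} : Measurable (bracket ν : E d → ℝ) :=
  (measurable_const.add (measurable_const.mul (measurable_norm.pow_const 2))).sqrt

theorem measurableSet_space (ν : Curv) (d : ℕ) : MeasurableSet (space ν d) := by
  cases ν
  · exact (isClosed_eq (continuous_form .plus) continuous_const).measurableSet
  · exact (isClosed_eq (continuous_form .minus) continuous_const).measurableSet.inter
      (isOpen_lt continuous_const continuous_lastCoord).measurableSet

theorem form_radial {ν : Curv} {d : ℕ} {w : E (d + 1)} (h : 0 < form ν w w) :
    form ν (radial ν w) (radial ν w) = 1 := by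
  rw [radial, form_smul_left, form_smul_right, ← mul_assoc, ← mul_inv, Real.mul_self_sqrt h.le,
    inv_mul_cancel₀ h.ne']

theorem radial_mem_space_plus {d : ℕ} {w : E (d + 1)} (h : 0 < form .plus w w) :
    radial .plus w ∈ space .plus d := form_radial h

theorem radial_mem_space_minus {d : ℕ} {w : E (d + 1)} (h : 0 < form .minus w w) :
    radial .minus w ∈ space .minus d ↔ 0 < lastCoord w := by
  have h1 : 0 < (√(form .minus w w))⁻¹ := inv_pos.2 (Real.sqrt_pos.2 h)
  constructor
  · intro h2
    have := h2.2
    rw [radial, lastCoord_smul] at this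
    exact pos_of_mul_pos_right this h1.le
  · intro h2
    refine ⟨form_radial h, ?_⟩
    rw [radial, lastCoord_smul]
    exact mul_pos h1 h2

/-- The part of the open unit cone of `W` over the space form. -/
def coneSet (ν : Curv) {d : ℕ} (W : Submodule ℝ (E (d + 1))) : Set W :=
  {w : W | 0 < form ν (w : E (d + 1)) w ∧ form ν (w : E (d + 1)) w < 1 ∧
    radial ν (w : E (d + 1)) ∈ space ν d}

theorem measurableSet_coneSet (ν : Curv) {d : ℕ} (W : Submodule ℝ (E (d + 1))) :
    MeasurableSet (coneSet ν W) := by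
  have h : Measurable fun w : W => form ν (w : E (d + 1)) w :=
    (continuous_form ν).measurable.comp measurable_subtype_coe
  exact (measurableSet_lt measurable_const h).inter ((measurableSet_lt h measurable_const).inter
    (((measurable_radial ν).comp measurable_subtype_coe) (measurableSet_space ν d)))

theorem sectionMeasure_eq (ν : Curv) {d : ℕ} (W : Submodule ℝ (E (d + 1))) {ι : Type*} [Fintype ι]
    [DecidableEq ι] (b : Module.Basis ι ℝ W) :
    sectionMeasure ν W = (Module.finrank ℝ W *
      ENNReal.ofReal √|(formGram ν fun i => (b i : E (d + 1))).det|) •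
        (b.addHaar.restrict (coneSet ν W)).map fun w : W => radial ν (w : E (d + 1)) := by
  rw [sectionMeasure, formVolume_eq ν W b, Measure.restrict_smul, Measure.map_smul, smul_smul]
  rfl

/-- Isometries transport the Riemannian measures of sections. -/
theorem sectionMeasure_map {ν : Curv} {d : ℕ} (T : Isom ν d) (W : Submodule ℝ (E (d + 1))) :
    sectionMeasure ν (W.map (T.toEquiv : E (d + 1) →ₗ[ℝ] E (d + 1))) =
      (sectionMeasure ν W).map T.toEquiv := by
  have hT : Measurable T.toEquiv :=
    (LinearMap.continuous_of_finiteDimensional T.toEquiv.toLinearMap).measurable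
  let e : W ≃ₗ[ℝ] W.map (T.toEquiv : E (d + 1) →ₗ[ℝ] E (d + 1)) := T.toEquiv.submoduleMap W
  have he : ∀ w : W, (e w : E (d + 1)) = T.toEquiv w := fun w => rfl
  let b := Module.finBasis ℝ W
  have hr : ∀ w : E (d + 1), radial ν (T.toEquiv w) = T.toEquiv (radial ν w) := by
    intro w
    rw [radial, radial, T.form_map, map_smul]
  have hem : Measurable e :=
    (LinearMap.continuous_of_finiteDimensional e.toLinearMap).measurable
  have hS : e ⁻¹' coneSet ν (W.map (T.toEquiv : E (d + 1) →ₗ[ℝ] E (d + 1))) = coneSet ν W := by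
    ext w
    simp only [coneSet, Set.mem_preimage, Set.mem_ofPred_eq, he, T.form_map, hr]
    rw [← T.image_space, T.toEquiv.injective.mem_set_image]
    rw [T.image_space]
  rw [sectionMeasure_eq ν W b, sectionMeasure_eq ν _ (b.map e), Measure.map_smul]
  have h1 : Module.finrank ℝ (W.map (T.toEquiv : E (d + 1) →ₗ[ℝ] E (d + 1))) =
      Module.finrank ℝ W := e.finrank_eq.symm
  have h2 : (formGram ν fun i => ((b.map e) i : E (d + 1))) =
      formGram ν fun i => (b i : E (d + 1)) := by
    ext i j
    simp [formGram, he, T.form_map]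
  have h3 : (b.map e).addHaar = b.addHaar.map e := by
    have := b.map_addHaar e.toContinuousLinearEquiv
    exact this.symm
  rw [h1, h2, h3]
  congr 1
  have hrm : Measurable fun w : W => radial ν (w : E (d + 1)) :=
    (measurable_radial ν).comp measurable_subtype_coe
  have hrm' : Measurable fun w : W.map (T.toEquiv : E (d + 1) →ₗ[ℝ] E (d + 1)) =>
      radial ν (w : E (d + 1)) :=
    (measurable_radial ν).comp measurable_subtype_coe
  rw [Measure.restrict_map hem (measurableSet_coneSet ν _), hS, Measure.map_map hrm' hem,
    Measure.map_map hT hrm]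
  congr 1
  ext1 w
  simp [he, hr]

end KPlane

end

noncomputable section

namespace KPlane

/-! ### The linear span of an affine plane -/

/-- The horizontal vector `(-v, 0)`. -/
def horiz {d : ℕ} : E d →ₗ[ℝ] E (d + 1) where
  toFun v := WithLp.toLp 2 (Fin.snoc (fun i => -v i) 0)
  map_add' v w := by
    refine PiLp.ext fun i => ?_
    refine Fin.lastCases ?_ (fun i => ?_) i
    · simp
    · simp; ring
  map_smul' c v := by
    refine PiLp.ext fun i => ?_
    refine Fin.lastCases ?_ (fun i => ?_) i <;> simp

@[simp] theorem lastCoord_horiz {d : ℕ} (v : E d) : lastCoord (horiz v) = 0 := by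
  simp [lastCoord, horiz]

@[simp] theorem fstPart_horiz {d : ℕ} (v : E d) : fstPart (horiz v) = -v := by
  ext i; simp [fstPart, horiz]

theorem lift_add {d : ℕ} (x v : E d) : lift (x + v) = lift x + horiz v := by
  refine ext_parts ?_ ?_
  · simp [add_comm]
  · simp

/-- The parametrization `(s, v) ↦ s • lift x + horiz v` of the linear span of the lift of the affine
plane through `x` with direction `D`. -/
def spanParam {d : ℕ} (x : E d) (D : Submodule ℝ (E d)) : ℝ × D →ₗ[ℝ] E (d + 1) :=
  (LinearMap.toSpanSingleton ℝ (E (d + 1)) (lift x)).coprod (horiz ∘ₗ D.subtype)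

theorem spanParam_apply {d : ℕ} (x : E d) (D : Submodule ℝ (E d)) (s : ℝ) (v : D) :
    spanParam x D (s, v) = s • lift x + horiz v := by
  simp [spanParam]

@[simp] theorem lastCoord_spanParam {d : ℕ} (x : E d) (D : Submodule ℝ (E d)) (s : ℝ) (v : D) :
    lastCoord (spanParam x D (s, v)) = s := by
  simp [spanParam_apply]

@[simp] theorem fstPart_spanParam {d : ℕ} (x : E d) (D : Submodule ℝ (E d)) (s : ℝ) (v : D) :
    fstPart (spanParam x D (s, v)) = -(s • x + v) := by
  simp only [spanParam_apply, fstPart_add, fstPart_smul, fstPart_lift, fstPart_horiz, neg_add,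
    smul_neg]

theorem spanParam_injective {d : ℕ} (x : E d) (D : Submodule ℝ (E d)) :
    Function.Injective (spanParam x D) := by
  rintro ⟨s, v⟩ ⟨t, w⟩ h
  have h1 : s = t := by simpa using congrArg lastCoord h
  have h2 := congrArg fstPart h
  subst h1
  simp only [fstPart_spanParam, neg_inj, add_right_inj] at h2
  rw [Subtype.ext h2]

/-- The linear span of the lift of the affine plane through `x` with direction `D`. -/
def flatSpan {d : ℕ} (x : E d) (D : Submodule ℝ (E d)) : Submodule ℝ (E (d + 1)) :=
  LinearMap.range (spanParam x D)

/-- The parametrization of `flatSpan x D` as a linear equivalence. -/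
def spanEquiv {d : ℕ} (x : E d) (D : Submodule ℝ (E d)) : (ℝ × D) ≃ₗ[ℝ] flatSpan x D :=
  LinearEquiv.ofInjective (spanParam x D) (spanParam_injective x D)

@[simp] theorem coe_spanEquiv {d : ℕ} (x : E d) (D : Submodule ℝ (E d)) (z : ℝ × D) :
    (spanEquiv x D z : E (d + 1)) = spanParam x D z := rfl

theorem finrank_flatSpan {d : ℕ} (x : E d) (D : Submodule ℝ (E d)) :
    Module.finrank ℝ (flatSpan x D) = Module.finrank ℝ D + 1 := by
  rw [← (spanEquiv x D).finrank_eq, Module.finrank_prod, Module.finrank_self, add_comm]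

theorem lift_mem_flatSpan {d : ℕ} {x y : E d} {D : Submodule ℝ (E d)} :
    lift y ∈ flatSpan x D ↔ y - x ∈ D := by
  constructor
  · rintro ⟨⟨s, v⟩, h⟩
    have h1 : s = 1 := by simpa using congrArg lastCoord h
    have h2 := congrArg fstPart h
    subst h1
    simp only [fstPart_spanParam, fstPart_lift, neg_inj, one_smul] at h2
    rw [← h2, add_sub_cancel_left]
    exact v.2
  · intro h
    refine ⟨(1, ⟨y - x, h⟩), ?_⟩
    rw [spanParam_apply, one_smul, ← lift_add, add_sub_cancel]

/-- The orthonormal basis of `flatSpan x D`, up to the length of the first vector, if `x` is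
orthogonal to `D`. -/
def spanBasis {d : ℕ} (x : E d) (D : Submodule ℝ (E d)) :
    Module.Basis (Unit ⊕ Fin (Module.finrank ℝ D)) ℝ (flatSpan x D) :=
  ((OrthonormalBasis.singleton Unit ℝ).toBasis.prod (stdOrthonormalBasis ℝ D).toBasis).map
    (spanEquiv x D)

theorem addHaar_spanBasis {d : ℕ} (x : E d) (D : Submodule ℝ (E d)) :
    (spanBasis x D).addHaar =
      ((volume : Measure ℝ).prod (stdOrthonormalBasis ℝ D).toBasis.addHaar).map (spanEquiv x D) := by
  rw [← OrthonormalBasis.addHaar_eq_volume (OrthonormalBasis.singleton Unit ℝ),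
    ← Module.Basis.prod_addHaar]
  exact (Module.Basis.map_addHaar _ (spanEquiv x D).toContinuousLinearEquiv).symm

theorem Curv.sgn_sq (ν : Curv) : ν.sgn ^ 2 = 1 := by cases ν <;> simp [Curv.sgn]

theorem Curv.abs_sgn (ν : Curv) : |ν.sgn| = 1 := by cases ν <;> simp [Curv.sgn]

/-- As `x` is orthogonal to `D`, the Gram matrix is diagonal, with the entry `1 ± ‖x‖²` for the lift
of `x` and `±1` for every horizontal vector. The latter signs vanish in the absolute value. -/
theorem abs_det_formGram_spanBasis (ν : Curv) {d : ℕ} {x : E d} {D : Submodule ℝ (E d)}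
    (hx : ∀ v ∈ D, inner ℝ x v = 0) :
    |(formGram ν fun i => (spanBasis x D i : E (d + 1))).det| = |1 + ν.sgn * ‖x‖ ^ 2| := by
  have h : (formGram ν fun i => (spanBasis x D i : E (d + 1))) =
      Matrix.diagonal (Sum.elim (fun _ => 1 + ν.sgn * ‖x‖ ^ 2) fun _ => ν.sgn) := by
    have hl : ∀ i, (spanBasis x D (Sum.inl i) : E (d + 1)) = spanParam x D (1, 0) := by
      intro i; simp [spanBasis]
    have hr : ∀ i, (spanBasis x D (Sum.inr i) : E (d + 1)) =
        spanParam x D (0, stdOrthonormalBasis ℝ D i) := by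
      intro i; simp [spanBasis]
    ext i j
    rcases i with i | i <;> rcases j with j | j
    · simp [formGram, hl, form, Matrix.diagonal]
    · simp [formGram, hl, hr, form, Matrix.diagonal, hx]
    · simp [formGram, hl, hr, form, Matrix.diagonal, real_inner_comm, hx]
    · have := orthonormal_iff_ite.1 (stdOrthonormalBasis ℝ D).orthonormal i j
      rw [Submodule.coe_inner] at this
      simp [formGram, hr, form, Matrix.diagonal, this]
  rw [h, Matrix.det_diagonal, Fintype.prod_sum_type, abs_mul]
  simp [Curv.abs_sgn]

/-! ### Comparison of the measures of a plane and of its lift -/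

/-- The number of preimages under the projection to `ℝᵈ`. -/
def Curv.mult : Curv → ℝ≥0∞
  | .plus => 2
  | .minus => 1

/-- The last coordinates of the nonhorizontal points in the cone over the space form. -/
def side : Curv → Set ℝ
  | .plus => {s | s ≠ 0}
  | .minus => {s | 0 < s}

theorem measurableSet_side (ν : Curv) : MeasurableSet (side ν) := by
  cases ν
  · exact (measurableSet_singleton (0 : ℝ)).compl
  · exact measurableSet_Ioi

theorem radial_mem_space_iff {ν : Curv} {d : ℕ} {w : E (d + 1)} (h : 0 < form ν w w)
    (h0 : lastCoord w ≠ 0) : radial ν w ∈ space ν d ↔ lastCoord w ∈ side ν := by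
  cases ν
  · exact iff_of_true (radial_mem_space_plus h) h0
  · exact radial_mem_space_minus h

theorem lintegral_pow_Ioo {r : ℝ} (hr : 0 ≤ r) (k : ℕ) :
    ∫⁻ s in Set.Ioo 0 r, ENNReal.ofReal (|s| ^ k) = ENNReal.ofReal (r ^ (k + 1) / (k + 1)) := by
  have h1 : ∫ s in Set.Ioo 0 r, |s| ^ k = r ^ (k + 1) / (k + 1) := by
    rw [← integral_Ioc_eq_integral_Ioo, ← intervalIntegral.integral_of_le hr]
    rw [intervalIntegral.integral_congr (g := fun s => s ^ k), integral_pow]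
    · simp
    · intro s hs
      rw [Set.uIcc_of_le hr] at hs
      simp [abs_of_nonneg hs.1]
  rw [← h1, ofReal_integral_eq_lintegral_ofReal]
  · have : Continuous fun s : ℝ => |s| ^ k := by fun_prop
    exact (this.integrableOn_Icc (a := 0) (b := r)).mono_set Set.Ioo_subset_Icc_self
  · exact Filter.Eventually.of_forall fun s => by positivity

/-- For the sphere both signs of the last coordinate occur and contribute equally; this is the
multiplicity `2`. -/
theorem lintegral_pow_side (ν : Curv) {r : ℝ} (hr : 0 ≤ r) (k : ℕ) :
    ∫⁻ s in {s | s ∈ side ν ∧ |s| < r}, ENNReal.ofReal (|s| ^ k) =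
      ν.mult * ENNReal.ofReal (r ^ (k + 1) / (k + 1)) := by
  cases ν
  · have h : {s | s ∈ side .plus ∧ |s| < r} = Set.Ioo 0 r ∪ Set.Ioo (-r) 0 := by
      ext s
      simp only [side, Set.mem_ofPred_eq, Set.mem_union, Set.mem_Ioo, abs_lt]
      constructor
      · rintro ⟨h1, h2⟩
        rcases lt_or_gt_of_ne h1 with h | h
        · exact Or.inr ⟨h2.1, h⟩
        · exact Or.inl ⟨h, h2.2⟩
      · rintro (h | h)
        · exact ⟨h.1.ne', by linarith, h.2⟩
        · exact ⟨h.2.ne, h.1, by linarith⟩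
    rw [h, lintegral_union measurableSet_Ioo]
    · have h2 : ∫⁻ s in Set.Ioo (-r) 0, ENNReal.ofReal (|s| ^ k) =
          ∫⁻ s in Set.Ioo 0 r, ENNReal.ofReal (|s| ^ k) := by
        rw [← lintegral_indicator measurableSet_Ioo, ← lintegral_indicator measurableSet_Ioo,
          ← lintegral_neg_eq_self]
        congr 1
        ext s
        simp only [Set.indicator_apply, Set.mem_Ioo, abs_neg]
        congr 1
        exact propext ⟨fun h => ⟨by linarith, by linarith⟩, fun h => ⟨by linarith, by linarith⟩⟩
      rw [h2, lintegral_pow_Ioo hr, Curv.mult, two_mul]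
    · rw [Set.disjoint_left]
      intro s h1 h2
      exact lt_asymm h1.1 h2.2
  · have h : {s | s ∈ side .minus ∧ |s| < r} = Set.Ioo 0 r := by
      ext s
      simp only [side, Set.mem_ofPred_eq, Set.mem_Ioo]
      exact and_congr_right fun h => by rw [abs_of_pos h]
    rw [h, lintegral_pow_Ioo hr, Curv.mult, one_mul]

theorem proj_smul {d : ℕ} {c : ℝ} (hc : c ≠ 0) (ζ : E (d + 1)) : proj (c • ζ) = proj ζ := by
  simp only [proj, lastCoord_smul, fstPart_smul, smul_smul, mul_inv]
  rw [mul_comm, ← mul_assoc, mul_inv_cancel₀ hc, one_mul]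

theorem proj_radial {ν : Curv} {d : ℕ} {w : E (d + 1)} (h : 0 < form ν w w) :
    proj (radial ν w) = proj w :=
  proj_smul (inv_ne_zero (Real.sqrt_pos.2 h).ne') w

theorem proj_spanParam {d : ℕ} (x : E d) (D : Submodule ℝ (E d)) {s : ℝ} (hs : s ≠ 0) (v : D) :
    proj (spanParam x D (s, v)) = x + s⁻¹ • (v : E d) := by
  simp only [proj, lastCoord_spanParam, fstPart_spanParam, smul_neg, neg_neg, smul_add, smul_smul,
    inv_mul_cancel₀ hs, one_smul]

theorem form_eq_of_lastCoord_ne_zero (ν : Curv) {d : ℕ} {w : E (d + 1)} (h : lastCoord w ≠ 0) :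
    form ν w w = lastCoord w ^ 2 * (1 + ν.sgn * ‖proj w‖ ^ 2) := by
  rw [form, real_inner_self_eq_norm_sq, proj, norm_neg, norm_smul, mul_pow, norm_inv, inv_pow,
    Real.norm_eq_abs, sq_abs]
  field_simp

theorem lintegral_comp_inv_smul {V : Type*} [NormedAddCommGroup V] [NormedSpace ℝ V]
    [FiniteDimensional ℝ V] [MeasurableSpace V] [BorelSpace V] (μ : Measure V)
    [μ.IsAddHaarMeasure] {s : ℝ} (hs : s ≠ 0) {f : V → ℝ≥0∞} (hf : Measurable f) :
    ∫⁻ v, f (s⁻¹ • v) ∂μ = ENNReal.ofReal (|s| ^ Module.finrank ℝ V) * ∫⁻ v, f v ∂μ := by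
  have h := Measure.map_addHaar_smul μ (inv_ne_zero hs)
  have h2 : ∫⁻ v, f v ∂(μ.map fun v => s⁻¹ • v) = ∫⁻ v, f (s⁻¹ • v) ∂μ :=
    lintegral_map hf (measurable_const_smul _)
  rw [← h2, h, lintegral_smul_measure, smul_eq_mul]
  congr 2
  rw [inv_pow, inv_inv, abs_pow]

end KPlane

end

/-! ### The Riemannian measure of a section, projected to the affine plane -/

noncomputable section

namespace KPlane

/-- The region of `ℝᵈ` covered by the projection of the space form. -/
def region (ν : Curv) (d : ℕ) : Set (E d) := {x | 0 < 1 + ν.sgn * ‖x‖ ^ 2}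

theorem measurableSet_region (ν : Curv) (d : ℕ) : MeasurableSet (region ν d) :=
  measurableSet_lt measurable_const
    (measurable_const.add (measurable_const.mul (measurable_norm.pow_const 2)))

theorem region_plus (d : ℕ) : region .plus d = Set.univ := by
  ext x
  simp only [region, Curv.sgn, Set.mem_ofPred_eq, Set.mem_univ, iff_true]
  positivity

theorem region_minus (d : ℕ) : region .minus d = Metric.ball 0 1 := by
  ext x
  simp only [region, Curv.sgn, Set.mem_ofPred_eq, mem_ball_zero_iff]
  rw [← sq_lt_one_iff₀ (norm_nonneg x)]
  constructor <;> intro h <;> linarith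

/-- At a point with last coordinate `s` over `z` the form equals `s² (1 ± |z|²)`, so the unit bound
on the form becomes `|s| < ⟨z⟩⁻¹`. -/
theorem spanParam_mem_coneSet_iff (ν : Curv) {d : ℕ} (x : E d) (D : Submodule ℝ (E d)) {s : ℝ}
    (hs : s ≠ 0) (v : D) : spanEquiv x D (s, v) ∈ coneSet ν (flatSpan x D) ↔
      x + s⁻¹ • (v : E d) ∈ region ν d ∧ s ∈ side ν ∧ |s| < (bracket ν (x + s⁻¹ • (v : E d)))⁻¹ := by
  have hl : lastCoord (spanParam x D (s, v)) ≠ 0 := by simpa using hs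
  have hf := form_eq_of_lastCoord_ne_zero ν hl
  rw [lastCoord_spanParam, proj_spanParam x D hs] at hf
  simp only [coneSet, Set.mem_ofPred_eq, coe_spanEquiv, region]
  set Q := 1 + ν.sgn * ‖x + s⁻¹ • (v : E d)‖ ^ 2 with hQ
  have hs2 : 0 < s ^ 2 := by positivity
  have h1 : 0 < form ν (spanParam x D (s, v)) (spanParam x D (s, v)) ↔ 0 < Q := by
    rw [hf, mul_pos_iff_of_pos_left hs2]
  rw [h1]
  refine and_congr_right fun h => ?_
  rw [radial_mem_space_iff (h1.2 h) hl, lastCoord_spanParam, and_comm]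
  refine and_congr_right fun _ => ?_
  have hsq : 0 < √Q := Real.sqrt_pos.2 h
  rw [hf, bracket, ← hQ, lt_inv_comm₀ (abs_pos.2 hs) hsq, ← one_div, lt_div_iff₀ (abs_pos.2 hs),
    ← sq_lt_one_iff₀ (by positivity : 0 ≤ √Q * |s|), mul_pow (√Q), Real.sq_sqrt h.le, sq_abs,
    mul_comm]

/-- The integrand of the iterated integral over the coordinates of the cone. -/
@[irreducible] def sliceDensity (ν : Curv) (k : ℕ) {d : ℕ} (h : E d → ℝ≥0∞) (s : ℝ) (z : E d) :
    ℝ≥0∞ :=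
  {s | s ∈ side ν ∧ |s| < (bracket ν z)⁻¹}.indicator (fun _ => (region ν d).indicator
    (fun z => ENNReal.ofReal (bracket ν z) ^ (k + 1) * h z) z) s

theorem measurable_sliceDensity (ν : Curv) (k : ℕ) {d : ℕ} {h : E d → ℝ≥0∞} (hh : Measurable h) :
    Measurable fun p : ℝ × E d => sliceDensity ν k h p.1 p.2 := by
  have h1 : MeasurableSet {p : ℝ × E d | p.1 ∈ side ν ∧ |p.1| < (bracket ν p.2)⁻¹} :=
    (measurable_fst (measurableSet_side ν)).inter (measurableSet_lt
      (continuous_abs.measurable.comp measurable_fst)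
      (((measurable_bracket ν).comp measurable_snd).inv))
  have hB : Measurable fun z : E d => ENNReal.ofReal (bracket ν z) ^ (k + 1) * h z :=
    ((measurable_bracket ν).ennreal_ofReal.pow_const _).mul hh
  have h2 : Measurable fun p : ℝ × E d => (region ν d).indicator
      (fun z => ENNReal.ofReal (bracket ν z) ^ (k + 1) * h z) p.2 :=
    (hB.indicator (measurableSet_region ν d)).comp measurable_snd
  unfold sliceDensity
  exact h2.indicator h1

theorem indicator_coneSet_eq_sliceDensity (ν : Curv) (k : ℕ) {d : ℕ} (x : E d)
    (D : Submodule ℝ (E d)) (h : E d → ℝ≥0∞) {s : ℝ} (hs : s ≠ 0) (v : D) :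
    (coneSet ν (flatSpan x D)).indicator (fun w : flatSpan x D =>
      ENNReal.ofReal (bracket ν (proj (radial ν (w : E (d + 1))))) ^ (k + 1) *
        h (proj (radial ν (w : E (d + 1))))) (spanEquiv x D (s, v)) =
      sliceDensity ν k h s (x + s⁻¹ • (v : E d)) := by
  have hiff := spanParam_mem_coneSet_iff ν x D hs v
  unfold sliceDensity
  by_cases hc : spanEquiv x D (s, v) ∈ coneSet ν (flatSpan x D)
  · have hc' := hiff.1 hc
    rw [Set.indicator_of_mem hc, proj_radial hc.1, coe_spanEquiv, proj_spanParam x D hs,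
      Set.indicator_of_mem (by exact hc'.2), Set.indicator_of_mem hc'.1]
  · rw [Set.indicator_of_notMem hc]
    by_cases h2 : s ∈ side ν ∧ |s| < (bracket ν (x + s⁻¹ • (v : E d)))⁻¹
    · rw [Set.indicator_of_mem (by exact h2), Set.indicator_of_notMem]
      exact fun h3 => hc (hiff.2 ⟨h3, h2⟩)
    · rw [Set.indicator_of_notMem (by exact h2)]

/-- The radial integral of `|s| ^ k` over `|s| < ⟨z⟩⁻¹` is a multiple of `⟨z⟩^{-(k+1)}`. It cancels
the weight, which is why the pullback carries the exponent `k + 1`. -/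
theorem lintegral_slice (ν : Curv) (k : ℕ) {d : ℕ} (z : E d) (h : E d → ℝ≥0∞) :
    ∫⁻ s, ENNReal.ofReal (|s| ^ k) * sliceDensity ν k h s z =
      ν.mult * (k + 1 : ℝ≥0∞)⁻¹ * (region ν d).indicator h z := by
  unfold sliceDensity
  set B : E d → ℝ≥0∞ := fun y => ENNReal.ofReal (bracket ν y) ^ (k + 1) with hB
  set S : Set ℝ := {s | s ∈ side ν ∧ |s| < (bracket ν z)⁻¹} with hS
  have h1 : MeasurableSet S :=
    (measurableSet_side ν).inter (measurableSet_lt continuous_abs.measurable measurable_const)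
  have h2 : ∀ s, ENNReal.ofReal (|s| ^ k) *
      S.indicator (fun _ => (region ν d).indicator (fun z => B z * h z) z) s =
      S.indicator (fun s => ENNReal.ofReal (|s| ^ k)) s *
        (region ν d).indicator (fun z => B z * h z) z := by
    intro s
    by_cases hs : s ∈ S
    · rw [Set.indicator_of_mem hs, Set.indicator_of_mem hs]
    · rw [Set.indicator_of_notMem hs, Set.indicator_of_notMem hs, mul_zero, zero_mul]
  have hc : Continuous fun s : ℝ => |s| ^ k := by fun_prop
  have h3 : Measurable (S.indicator fun s => ENNReal.ofReal (|s| ^ k)) :=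
    hc.measurable.ennreal_ofReal.indicator h1
  have hb0 : 0 ≤ (bracket ν z)⁻¹ := inv_nonneg.2 (Real.sqrt_nonneg _)
  rw [lintegral_congr h2, lintegral_mul_const _ h3, lintegral_indicator h1,
    lintegral_pow_side ν hb0]
  by_cases h4 : z ∈ region ν d
  · have hb : 0 < bracket ν z := Real.sqrt_pos.2 h4
    rw [Set.indicator_of_mem h4, Set.indicator_of_mem h4, inv_pow, div_eq_mul_inv,
      ENNReal.ofReal_mul (by positivity), ENNReal.ofReal_inv_of_pos (by positivity),
      ENNReal.ofReal_inv_of_pos (by positivity), ENNReal.ofReal_pow hb.le]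
    have hk1 : ENNReal.ofReal ((k : ℝ) + 1) = (k : ℝ≥0∞) + 1 := by
      rw [ENNReal.ofReal_add (by positivity) zero_le_one, ENNReal.ofReal_natCast,
        ENNReal.ofReal_one]
    rw [hk1]
    have hB0 : B z ≠ 0 := pow_ne_zero _ (by simpa using hb)
    have hB1 : B z ≠ ∞ := ENNReal.pow_ne_top ENNReal.ofReal_ne_top
    change ν.mult * ((B z)⁻¹ * _) * (B z * _) = _
    calc _ = ν.mult * (k + 1 : ℝ≥0∞)⁻¹ * h z * ((B z)⁻¹ * B z) := by ring
      _ = _ := by rw [ENNReal.inv_mul_cancel hB0 hB1, mul_one]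
  · rw [Set.indicator_of_notMem h4, Set.indicator_of_notMem h4, mul_zero, mul_zero]

theorem lintegral_sectionMeasure_eq_iterated (ν : Curv) {d : ℕ} {x : E d} {D : Submodule ℝ (E d)}
    (hx : ∀ v ∈ D, inner ℝ x v = 0) {F : E (d + 1) → ℝ≥0∞} (hF : Measurable F) :
    ∫⁻ ζ, F ζ ∂sectionMeasure ν (flatSpan x D) =
      ((Module.finrank ℝ D : ℝ≥0∞) + 1) * ENNReal.ofReal √|1 + ν.sgn * ‖x‖ ^ 2| *
        ∫⁻ s : ℝ, ∫⁻ v : D, (coneSet ν (flatSpan x D)).indicator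
          (fun w : flatSpan x D => F (radial ν (w : E (d + 1)))) (spanEquiv x D (s, v))
            ∂(stdOrthonormalBasis ℝ D).toBasis.addHaar := by
  have hem : Measurable (spanEquiv x D) :=
    (LinearMap.continuous_of_finiteDimensional (spanEquiv x D).toLinearMap).measurable
  have hrm : Measurable fun w : flatSpan x D => radial ν (w : E (d + 1)) :=
    (measurable_radial ν).comp measurable_subtype_coe
  have hFr : Measurable ((coneSet ν (flatSpan x D)).indicator
      fun w : flatSpan x D => F (radial ν (w : E (d + 1)))) :=
    (hF.comp hrm).indicator (measurableSet_coneSet ν _)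
  have hFe : Measurable fun z => (coneSet ν (flatSpan x D)).indicator
      (fun w : flatSpan x D => F (radial ν (w : E (d + 1)))) (spanEquiv x D z) := hFr.comp hem
  rw [sectionMeasure_eq ν _ (spanBasis x D), lintegral_smul_measure, smul_eq_mul,
    lintegral_map hF hrm, ← lintegral_indicator (measurableSet_coneSet ν _), addHaar_spanBasis,
    lintegral_map hFr hem, lintegral_prod _ hFe.aemeasurable,
    abs_det_formGram_spanBasis ν hx, finrank_flatSpan, Nat.cast_add, Nat.cast_one]

/-- The substitution `v = s y` on the direction contributes `|s| ^ finrank`; after Fubini the inner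
integral over `s` is that of `lintegral_slice`. -/
theorem lintegral_lintegral_sliceDensity (ν : Curv) {d : ℕ} (x : E d) {D : Submodule ℝ (E d)}
    (μ : Measure D) [μ.IsAddHaarMeasure] {h : E d → ℝ≥0∞} (hh : Measurable h) :
    ∫⁻ s : ℝ, ∫⁻ v : D, sliceDensity ν (Module.finrank ℝ D) h s (x + s⁻¹ • (v : E d)) ∂μ =
      ν.mult * (Module.finrank ℝ D + 1 : ℝ≥0∞)⁻¹ *
        ∫⁻ v : D, (region ν d).indicator h (x + (v : E d)) ∂μ := by
  have hxm : Measurable fun y : D => x + (y : E d) := measurable_const.add measurable_subtype_coe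
  have hGm : Measurable fun p : ℝ × D =>
      sliceDensity ν (Module.finrank ℝ D) h p.1 (x + (p.2 : E d)) :=
    (measurable_sliceDensity ν _ hh).comp (measurable_fst.prodMk (hxm.comp measurable_snd))
  have hGy : ∀ s, Measurable fun y : D => sliceDensity ν (Module.finrank ℝ D) h s (x + (y : E d)) :=
    fun s => hGm.comp (measurable_const.prodMk measurable_id)
  have h0 : ∀ᵐ s : ℝ, s ≠ 0 := by
    rw [ae_iff]; simp
  have hind : Measurable fun y : D => (region ν d).indicator h (x + (y : E d)) :=
    (hh.indicator (measurableSet_region ν d)).comp hxm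
  have hc : Continuous fun z : ℝ × D => |z.1| ^ (Module.finrank ℝ D) := by fun_prop
  have hpow : Measurable fun z : ℝ × D => ENNReal.ofReal (|z.1| ^ (Module.finrank ℝ D)) *
      sliceDensity ν (Module.finrank ℝ D) h z.1 (x + (z.2 : E d)) :=
    hc.measurable.ennreal_ofReal.mul hGm
  have h1 : ∀ᵐ s : ℝ,
      ∫⁻ v : D, sliceDensity ν (Module.finrank ℝ D) h s (x + s⁻¹ • (v : E d)) ∂μ =
        ∫⁻ y : D, ENNReal.ofReal (|s| ^ (Module.finrank ℝ D)) *
          sliceDensity ν (Module.finrank ℝ D) h s (x + (y : E d)) ∂μ := by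
    refine h0.mono fun s hs => ?_
    rw [lintegral_const_mul _ (hGy s)]
    exact lintegral_comp_inv_smul μ hs (hGy s)
  rw [lintegral_congr_ae h1, lintegral_lintegral_swap hpow.aemeasurable,
    lintegral_congr fun y : D => lintegral_slice ν (Module.finrank ℝ D) (x + (y : E d)) h, lintegral_const_mul _ hind]

/-- The weighted projection of the Riemannian measure of a section is, up to a factor that depends
only on the distance to the origin, the Lebesgue measure of the affine plane. -/
theorem lintegral_sectionMeasure_flatSpan (ν : Curv) {d : ℕ} {x : E d} {D : Submodule ℝ (E d)}
    (hx : ∀ v ∈ D, inner ℝ x v = 0) {k : ℕ} (hk : Module.finrank ℝ D = k) {h : E d → ℝ≥0∞}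
    (hh : Measurable h) :
    ∫⁻ ζ, ENNReal.ofReal (bracket ν (proj ζ)) ^ (k + 1) * h (proj ζ)
        ∂sectionMeasure ν (flatSpan x D) =
      ν.mult * ENNReal.ofReal √|1 + ν.sgn * ‖x‖ ^ 2| *
        ∫⁻ v : D, (region ν d).indicator h (x + v) ∂(stdOrthonormalBasis ℝ D).toBasis.addHaar := by
  subst hk
  have hBm : Measurable fun z : E d =>
      ENNReal.ofReal (bracket ν z) ^ (Module.finrank ℝ D + 1) * h z :=
    ((measurable_bracket ν).ennreal_ofReal.pow_const _).mul hh
  have hF : Measurable fun ζ : E (d + 1) =>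
    ENNReal.ofReal (bracket ν (proj ζ)) ^ (Module.finrank ℝ D + 1) * h (proj ζ) :=
    hBm.comp measurable_proj
  rw [lintegral_sectionMeasure_eq_iterated ν hx hF]
  have h0 : ∀ᵐ s : ℝ, s ≠ 0 := by
    rw [ae_iff]; simp
  have h1 := h0.mono fun s hs => lintegral_congr
    (μ := (stdOrthonormalBasis ℝ D).toBasis.addHaar) fun v =>
      indicator_coneSet_eq_sliceDensity ν (Module.finrank ℝ D) x D h hs v
  rw [lintegral_congr_ae h1, lintegral_lintegral_sliceDensity ν x _ hh]
  generalize ∫⁻ y : D, (region ν d).indicator h (x + (y : E d))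
    ∂(stdOrthonormalBasis ℝ D).toBasis.addHaar = I
  have hk0 : ((Module.finrank ℝ D : ℝ≥0∞) + 1) ≠ 0 := by simp
  have hk1 : ((Module.finrank ℝ D : ℝ≥0∞) + 1) ≠ ∞ := by simp
  calc _ = ν.mult * ENNReal.ofReal √|1 + ν.sgn * ‖x‖ ^ 2| * I *
          (((Module.finrank ℝ D : ℝ≥0∞) + 1) * ((Module.finrank ℝ D : ℝ≥0∞) + 1)⁻¹) := by ring
    _ = _ := by rw [ENNReal.mul_inv_cancel hk0 hk1, mul_one]

end KPlane

end

/-! ### Consequences of the projection formula for the whole space and for planes -/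

noncomputable section

namespace KPlane

theorem bracket_nonneg (ν : Curv) {d : ℕ} (x : E d) : 0 ≤ bracket ν x := Real.sqrt_nonneg _

/-- Weighted by `⟨x⟩ ^ (n + 1)`, the image of the measure `σ` under the projection to `ℝᵈ` is `C`
times the restriction of `μ` to the region covered by the projection. -/
def IsWeightedImage (ν : Curv) (n : ℕ) {d : ℕ} (σ : Measure (E (d + 1))) (C : ℝ≥0∞)
    (μ : Measure (E d)) : Prop :=
  ∀ h : E d → ℝ≥0∞, Measurable h →
    ∫⁻ ζ, ENNReal.ofReal (bracket ν (proj ζ)) ^ (n + 1) * h (proj ζ) ∂σ =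
      C * ∫⁻ x in region ν d, h x ∂μ

namespace IsWeightedImage

variable {ν : Curv} {n d : ℕ} {σ : Measure (E (d + 1))} {C : ℝ≥0∞} {μ : Measure (E d)}

/-- The exponent of the pullback need not be that of the weight: null sets are governed by the
projection alone, except where the bracket vanishes, and there both pullbacks are zero. -/
theorem ae_pull_eq (H : IsWeightedImage ν n σ C μ) (k : ℕ) {f g : E d → ℝ}
    (hfg : f =ᵐ[μ.restrict (region ν d)] g) : pull ν k f =ᵐ[σ] pull ν k g := by
  set N := toMeasurable (μ.restrict (region ν d)) {x | f x ≠ g x} with hN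
  have hNm : MeasurableSet N := measurableSet_toMeasurable _ _
  have hN0 : μ.restrict (region ν d) N = 0 := by
    rw [hN, measure_toMeasurable]
    exact hfg
  have hB : Measurable fun ζ : E (d + 1) => ENNReal.ofReal (bracket ν (proj ζ)) ^ (n + 1) :=
    ((measurable_bracket ν).comp measurable_proj).ennreal_ofReal.pow_const _
  have h1 : Measurable (N.indicator (1 : E d → ℝ≥0∞)) := measurable_one.indicator hNm
  have h2 : Measurable fun ζ : E (d + 1) => N.indicator (1 : E d → ℝ≥0∞) (proj ζ) :=
    h1.comp measurable_proj
  have h3 := H _ h1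
  rw [lintegral_indicator_one hNm, hN0, mul_zero] at h3
  replace h3 := (lintegral_eq_zero_iff (hB.mul h2)).1 h3
  filter_upwards [h3] with ζ hζ
  simp only [Pi.zero_apply, Pi.mul_apply, mul_eq_zero] at hζ
  unfold pull
  rcases hζ with hζ | hζ
  · have : bracket ν (proj ζ) = 0 := by
      have h4 := eq_zero_of_pow_eq_zero hζ
      rw [ENNReal.ofReal_eq_zero] at h4
      exact le_antisymm h4 (bracket_nonneg ν _)
    simp [this]
  · have h4 : proj ζ ∉ N := by
      intro h5
      rw [Set.indicator_of_mem h5] at hζ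
      exact one_ne_zero hζ
    have h5 : f (proj ζ) = g (proj ζ) := by
      by_contra h6
      exact h4 (subset_toMeasurable _ _ h6)
    rw [h5]

/-- The weight as a density. -/
def _root_.KPlane.weightDensity (ν : Curv) (n : ℕ) {d : ℕ} (ζ : E (d + 1)) : NNReal :=
  (bracket ν (proj ζ)).toNNReal ^ (n + 1)

theorem _root_.KPlane.measurable_weightDensity (ν : Curv) (n : ℕ) {d : ℕ} :
    Measurable (weightDensity ν n : E (d + 1) → NNReal) :=
  ((measurable_bracket ν).comp measurable_proj).real_toNNReal.pow_const _

theorem _root_.KPlane.weightDensity_smul (ν : Curv) (n : ℕ) {d : ℕ} (f : E d → ℝ) :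
    (fun ζ : E (d + 1) => weightDensity ν n ζ • f (proj ζ)) = pull ν n f := by
  ext ζ
  rw [pull, weightDensity, NNReal.smul_def, NNReal.coe_pow,
    Real.coe_toNNReal _ (bracket_nonneg ν _), smul_eq_mul]

theorem map_eq (H : IsWeightedImage ν n σ C μ) :
    (σ.withDensity fun ζ => (weightDensity ν n ζ : ℝ≥0∞)).map proj =
      C • μ.restrict (region ν d) := by
  refine Measure.ext_of_lintegral _ fun h hh => ?_
  have h1 : Measurable fun ζ : E (d + 1) => (weightDensity ν n ζ : ℝ≥0∞) :=
    (measurable_weightDensity ν n).coe_nnreal_ennreal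
  have h2 : Measurable fun ζ : E (d + 1) => h (proj ζ) := hh.comp measurable_proj
  rw [lintegral_map hh measurable_proj, lintegral_withDensity_eq_lintegral_mul σ h1 h2,
    lintegral_smul_measure, smul_eq_mul, ← H h hh]
  refine lintegral_congr fun ζ => ?_
  rw [Pi.mul_apply, weightDensity, ENNReal.coe_pow]
  rfl

theorem integrable_pull_iff (H : IsWeightedImage ν n σ C μ) {f : E d → ℝ} (hf : Measurable f) :
    Integrable (pull ν n f) σ ↔ Integrable f (C • μ.restrict (region ν d)) := by
  rw [← H.map_eq, integrable_map_measure hf.aestronglyMeasurable measurable_proj.aemeasurable,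
    integrable_withDensity_iff_integrable_smul (measurable_weightDensity ν n), ← weightDensity_smul]
  rfl

theorem integral_pull (H : IsWeightedImage ν n σ C μ) {f : E d → ℝ} (hf : Measurable f) :
    ∫ ζ, pull ν n f ζ ∂σ = C.toReal * ∫ x in region ν d, f x ∂μ := by
  rw [← smul_eq_mul, ← integral_smul_measure, ← H.map_eq,
    integral_map measurable_proj.aemeasurable hf.aestronglyMeasurable,
    integral_withDensity_eq_integral_smul (measurable_weightDensity ν n), ← weightDensity_smul]

/-- The relation between the exponents makes the `p`-th power of the factor `⟨x⟩^{k+1}` equal to the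
weight `⟨x⟩^{n+1}`. -/
theorem lintegral_pull_rpow (H : IsWeightedImage ν n σ C μ) (k : ℕ) {p : ℝ} (hp : 0 ≤ p)
    (hpn : ((k : ℝ) + 1) * p = (n : ℝ) + 1) {f : E d → ℝ} (hf : Measurable f) :
    ∫⁻ ζ, ‖pull ν k f ζ‖ₑ ^ p ∂σ = C * ∫⁻ x in region ν d, ‖f x‖ₑ ^ p ∂μ := by
  rw [← H (fun x => ‖f x‖ₑ ^ p) (hf.enorm.pow_const p)]
  refine lintegral_congr fun ζ => ?_
  rw [pull, enorm_mul, ENNReal.mul_rpow_of_nonneg _ _ hp,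
    Real.enorm_of_nonneg (pow_nonneg (bracket_nonneg ν _) _),
    ENNReal.ofReal_pow (bracket_nonneg ν _), ← ENNReal.rpow_natCast, ← ENNReal.rpow_mul,
    Nat.cast_add, Nat.cast_one, hpn, ← ENNReal.rpow_natCast (ENNReal.ofReal _), Nat.cast_add,
    Nat.cast_one]

end IsWeightedImage

theorem flatSpan_top {d : ℕ} : flatSpan (0 : E d) ⊤ = ⊤ := by
  refine Submodule.eq_top_of_finrank_eq ?_
  rw [finrank_flatSpan, finrank_top, finrank_euclideanSpace_fin, finrank_euclideanSpace_fin]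

/-- The whole space is the case `x = 0`, `D = ⊤` of the formula for sections, where the factor `√|1
± ‖x‖²|` is `1`. -/
theorem isWeightedImage_spaceMeasure (ν : Curv) (d : ℕ) :
    IsWeightedImage ν d (spaceMeasure ν d) ν.mult volume := by
  intro h hh
  have h1 := lintegral_sectionMeasure_flatSpan ν (x := (0 : E d)) (D := ⊤)
    (fun v _ => inner_zero_left v)
    ((finrank_top ℝ (E d)).trans finrank_euclideanSpace_fin) hh
  rw [flatSpan_top] at h1
  rw [spaceMeasure, h1, ← lintegral_indicator (measurableSet_region ν d)]
  have h2 : (stdOrthonormalBasis ℝ (⊤ : Submodule ℝ (E d))).toBasis.addHaar.map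
      (LinearIsometryEquiv.ofTop (E d) (⊤ : Submodule ℝ (E d)) rfl) = volume := by
    have h3 := Module.Basis.map_addHaar (stdOrthonormalBasis ℝ (⊤ : Submodule ℝ (E d))).toBasis
      (LinearIsometryEquiv.ofTop (E d) (⊤ : Submodule ℝ (E d)) rfl).toContinuousLinearEquiv
    rw [← OrthonormalBasis.addHaar_eq_volume ((stdOrthonormalBasis ℝ (⊤ : Submodule ℝ (E d))).map
      (LinearIsometryEquiv.ofTop (E d) (⊤ : Submodule ℝ (E d)) rfl))]
    exact h3
  have h4 : Measurable (LinearIsometryEquiv.ofTop (E d) (⊤ : Submodule ℝ (E d)) rfl) :=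
    (LinearIsometryEquiv.continuous _).measurable
  rw [← h2, lintegral_map (hh.indicator (measurableSet_region ν d)) h4]
  simp

/-! ### Affine planes -/

/-- The foot of the perpendicular from the origin. -/
def FlatPlane.foot {d k : ℕ} (π : FlatPlane d k) : E d :=
  π.nonempty.some - π.carrier.direction.starProjection π.nonempty.some

/-- The linear span of the lift of an affine plane. -/
def flatLift {d k : ℕ} (π : FlatPlane d k) : Submodule ℝ (E (d + 1)) :=
  flatSpan π.foot π.carrier.direction

namespace FlatPlane

variable {d k : ℕ} (π : FlatPlane d k)

theorem foot_mem : π.foot ∈ π.carrier := by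
  have h := AffineSubspace.vadd_mem_of_mem_direction
    (π.carrier.direction.neg_mem (Submodule.starProjection_apply_mem π.carrier.direction
      π.nonempty.some)) π.nonempty.some_mem
  rwa [vadd_eq_add, neg_add_eq_sub] at h

theorem inner_foot {v : E d} (hv : v ∈ π.carrier.direction) : inner ℝ π.foot v = 0 := by
  rw [real_inner_comm]
  exact Submodule.sub_starProjection_mem_orthogonal π.nonempty.some v hv

theorem mem_iff {y : E d} : y ∈ π.carrier ↔ y - π.foot ∈ π.carrier.direction := by
  constructor
  · intro h
    exact AffineSubspace.vsub_mem_direction h π.foot_mem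
  · intro h
    have := AffineSubspace.vadd_mem_of_mem_direction h π.foot_mem
    rwa [vadd_eq_add, sub_add_cancel] at this

theorem lift_mem_flatLift {y : E d} : lift y ∈ flatLift π ↔ y ∈ π.carrier := by
  rw [flatLift, lift_mem_flatSpan, mem_iff]

theorem finrank_flatLift : Module.finrank ℝ (flatLift π) = k + 1 := by
  rw [flatLift, finrank_flatSpan, π.finrank_direction]

theorem rho_flatLift : rho (flatLift π) = ‖π.foot‖ := by
  refine rho_eq_of_forall_le (π.lift_mem_flatLift.2 π.foot_mem) fun y hy => ?_
  have h1 := π.mem_iff.1 (π.lift_mem_flatLift.1 hy)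
  have h2 : ‖y‖ ^ 2 = ‖π.foot‖ ^ 2 + ‖y - π.foot‖ ^ 2 := by
    conv_lhs => rw [← add_sub_cancel π.foot y]
    rw [norm_add_sq_real, π.inner_foot h1]
    ring
  exact le_of_sq_le_sq (by nlinarith [sq_nonneg ‖y - π.foot‖]) (norm_nonneg y)

/-- By translation invariance on the direction the arbitrary base point in the definition may be
replaced by the foot point, which is orthogonal to the direction. -/
theorem measure_eq : π.measure = (stdOrthonormalBasis ℝ π.carrier.direction).toBasis.addHaar.map
    fun v : π.carrier.direction => π.foot + (v : E d) := by
  have hw : π.nonempty.some - π.foot ∈ π.carrier.direction :=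
    π.mem_iff.1 π.nonempty.some_mem
  set w : π.carrier.direction := ⟨π.nonempty.some - π.foot, hw⟩ with hwd
  have h1 : Measurable fun v : π.carrier.direction => π.foot + (v : E d) :=
    measurable_const.add measurable_subtype_coe
  rw [FlatPlane.measure, ← map_add_right_eq_self
    (stdOrthonormalBasis ℝ π.carrier.direction).toBasis.addHaar w]
  conv_rhs => rw [Measure.map_map h1 (measurable_add_const w)]
  rw [map_add_right_eq_self]
  congr 1
  ext1 v
  simp only [Function.comp_apply, hwd, Submodule.coe_add]
  abel

end FlatPlane

theorem isWeightedImage_flatLift (ν : Curv) {d k : ℕ} (π : FlatPlane d k) :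
    IsWeightedImage ν k (sectionMeasure ν (flatLift π))
      (ν.mult * ENNReal.ofReal √|1 + ν.sgn * rho (flatLift π) ^ 2|) π.measure := by
  intro h hh
  have h1 := lintegral_sectionMeasure_flatSpan ν (fun v hv => π.inner_foot hv)
    π.finrank_direction hh
  have h2 : Measurable fun v : π.carrier.direction => π.foot + (v : E d) :=
    measurable_const.add measurable_subtype_coe
  rw [π.rho_flatLift, flatLift, h1, ← lintegral_indicator (measurableSet_region ν d), π.measure_eq,
    lintegral_map (hh.indicator (measurableSet_region ν d)) h2]

end KPlane

end

/-! ### The `L^p` isometry -/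

noncomputable section

namespace KPlane

theorem measurable_pull (ν : Curv) (k : ℕ) {d : ℕ} {f : E d → ℝ} (hf : Measurable f) :
    Measurable (pull ν k f) :=
  (((measurable_bracket ν).comp measurable_proj).pow_const _).mul (hf.comp measurable_proj)

theorem IsWeightedImage.smul {ν : Curv} {n d : ℕ} {σ : Measure (E (d + 1))} {C : ℝ≥0∞}
    {μ : Measure (E d)} (H : IsWeightedImage ν n σ C μ) (c : ℝ≥0∞) :
    IsWeightedImage ν n (c • σ) (c * C) μ := by
  intro h hh
  rw [lintegral_smul_measure, smul_eq_mul, H h hh, mul_assoc]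

theorem Curv.mult_ne_zero (ν : Curv) : ν.mult ≠ 0 := by cases ν <;> simp [Curv.mult]

theorem Curv.mult_ne_top (ν : Curv) : ν.mult ≠ ∞ := by cases ν <;> simp [Curv.mult]

/-- The exponent `(d + 1) / (k + 1)`. -/
theorem toReal_exponent (d k : ℕ) :
    (((d : ℝ≥0∞) + 1) / ((k : ℝ≥0∞) + 1)).toReal = ((d : ℝ) + 1) / ((k : ℝ) + 1) := by
  rw [ENNReal.toReal_div, ENNReal.toReal_add (by simp) (by simp),
    ENNReal.toReal_add (by simp) (by simp)]
  simp

theorem exponent_ne_zero (d k : ℕ) : ((d : ℝ≥0∞) + 1) / ((k : ℝ≥0∞) + 1) ≠ 0 :=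
  (ENNReal.div_pos (by simp) (by simp)).ne'

theorem exponent_ne_top (d k : ℕ) : ((d : ℝ≥0∞) + 1) / ((k : ℝ≥0∞) + 1) ≠ ∞ :=
  ENNReal.div_ne_top (by simp) (by simp)

theorem lintegral_region_eq {ν : Curv} {d : ℕ} {μ : Measure (E d)} {f : E d → ℝ} {p : ℝ}
    (hp : 0 < p) (h0 : ∀ᵐ x ∂μ, x ∉ region ν d → f x = 0) :
    ∫⁻ x in region ν d, ‖f x‖ₑ ^ p ∂μ = ∫⁻ x, ‖f x‖ₑ ^ p ∂μ := by
  rw [← lintegral_indicator (measurableSet_region ν d)]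
  refine lintegral_congr_ae (h0.mono fun x hx => ?_)
  by_cases h : x ∈ region ν d
  · simp [h]
  · simp [h, hx h, hp]

/-- The weighted pullback is an isometry of `L^p`. -/
theorem memLp_pull_and_eLpNorm_eq (ν : Curv) {d k : ℕ} {p : ℝ≥0∞}
    (hp : p = ((d : ℝ≥0∞) + 1) / ((k : ℝ≥0∞) + 1)) {f : E d → ℝ} (hf : MemLp f p volume)
    (h0 : ∀ᵐ x, x ∉ region ν d → f x = 0) :
    MemLp (pull ν k f) p (ν.mult⁻¹ • spaceMeasure ν d) ∧
      eLpNorm (pull ν k f) p (ν.mult⁻¹ • spaceMeasure ν d) = eLpNorm f p volume := by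
  have H := (isWeightedImage_spaceMeasure ν d).smul ν.mult⁻¹
  rw [ENNReal.inv_mul_cancel ν.mult_ne_zero ν.mult_ne_top] at H
  set g := hf.1.mk f with hg
  have hgm : Measurable g := hf.1.stronglyMeasurable_mk.measurable
  have hfg : f =ᵐ[volume] g := hf.1.ae_eq_mk
  have hpull : pull ν k f =ᵐ[ν.mult⁻¹ • spaceMeasure ν d] pull ν k g :=
    H.ae_pull_eq k (ae_restrict_of_ae hfg)
  have hg0 : ∀ᵐ x, x ∉ region ν d → g x = 0 := by
    filter_upwards [h0, hfg] with x h1 h2 h3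
    rw [← h2, h1 h3]
  have hp0 : p ≠ 0 := hp ▸ exponent_ne_zero d k
  have hpt : p ≠ ∞ := hp ▸ exponent_ne_top d k
  -- The choice of `p`: the `p`-th power turns the exponent `k + 1` of the pullback into the
  -- exponent `d + 1` of the volume.
  have hpr : ((k : ℝ) + 1) * p.toReal = (d : ℝ) + 1 := by
    rw [hp, toReal_exponent]
    field_simp
  have hpp : 0 < p.toReal := ENNReal.toReal_pos hp0 hpt
  have hnorm : eLpNorm (pull ν k f) p (ν.mult⁻¹ • spaceMeasure ν d) = eLpNorm f p volume := by
    rw [eLpNorm_congr_ae hpull, eLpNorm_congr_ae hfg,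
      eLpNorm_eq_lintegral_rpow_enorm_toReal hp0 hpt,
      eLpNorm_eq_lintegral_rpow_enorm_toReal hp0 hpt, H.lintegral_pull_rpow k hpp.le hpr hgm,
      one_mul, lintegral_region_eq hpp hg0]
  refine ⟨⟨((measurable_pull ν k hgm).aestronglyMeasurable).congr hpull.symm, ?_⟩, hnorm⟩
  rw [hnorm]
  exact hf.2

end KPlane

end

noncomputable section

namespace KPlane

open scoped Matrix

/-! ### Isometries and matrices -/

/-- The matrix `J` gives the first `d` coordinates the sign `+`, while `form` normalizes the last
coordinate; the two differ by the curvature sign, which does not affect the isometries. -/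
theorem form_eq_dotProduct (ν : Curv) {d : ℕ} (ζ η : E (d + 1)) :
    form ν ζ η = ν.sgn * (ζ.ofLp ⬝ᵥ (J d ν.sgn *ᵥ η.ofLp)) := by
  rw [form_J, mul_add, ← mul_assoc, ← sq, ν.sgn_sq, one_mul, form, add_comm]
  congr 2
  simp [fstPart, PiLp.inner_apply, mul_comm]

theorem J_mul_J {d : ℕ} (ν : Curv) : J d ν.sgn * J d ν.sgn = 1 := by
  have h := ν.sgn_sq
  rw [J, Matrix.diagonal_mul_diagonal, ← Matrix.diagonal_one]
  congr 1
  ext i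
  split_ifs
  · rw [← sq, h]
  · rw [one_mul]

/-- A matrix preserves the form on row vectors iff it does so on column vectors. -/
theorem mul_J_mul_transpose_iff {d : ℕ} (ν : Curv) (g : Matrix (Fin (d + 1)) (Fin (d + 1)) ℝ) :
    g * J d ν.sgn * gᵀ = J d ν.sgn ↔ gᵀ * J d ν.sgn * g = J d ν.sgn := by
  have key : ∀ a b : Matrix (Fin (d + 1)) (Fin (d + 1)) ℝ,
      a * J d ν.sgn * b = J d ν.sgn → b * J d ν.sgn * a = J d ν.sgn := by
    intro a b h
    have h1 : (a * J d ν.sgn) * (b * J d ν.sgn) = 1 := by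
      rw [← Matrix.mul_assoc, h, J_mul_J]
    have h2 := mul_eq_one_comm.1 h1
    calc b * J d ν.sgn * a = b * J d ν.sgn * (a * J d ν.sgn) * J d ν.sgn := by
          simp only [Matrix.mul_assoc, J_mul_J, Matrix.mul_one]
      _ = J d ν.sgn := by rw [h2, Matrix.one_mul]
  exact ⟨key _ _, key _ _⟩

theorem form_mv (ν : Curv) {d : ℕ} (g : isoGroup d ν.sgn) (ζ η : E (d + 1)) :
    form ν (mv g.1.val ζ) (mv g.1.val η) = form ν ζ η := by
  have h := (mul_J_mul_transpose_iff ν g.1.val).1 g.2.1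
  rw [form_eq_dotProduct, form_eq_dotProduct]
  congr 1
  conv_rhs => rw [← h]
  change (g.1.val *ᵥ ζ.ofLp) ⬝ᵥ (J d ν.sgn *ᵥ (g.1.val *ᵥ η.ofLp)) = _
  rw [← Matrix.mulVec_mulVec, ← Matrix.mulVec_mulVec, Matrix.dotProduct_mulVec ζ.ofLp,
    Matrix.vecMul_transpose]

theorem exists_mv_eq {n : ℕ} (T : E n →ₗ[ℝ] E n) : ∃ A : Matrix (Fin n) (Fin n) ℝ, mv A = T := by
  refine ⟨Matrix.of fun i j => T (EuclideanSpace.single j 1) i, ?_⟩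
  refine (EuclideanSpace.basisFun (Fin n) ℝ).toBasis.ext fun j => ?_
  ext i
  simp [mv_apply]

theorem mv_eq_iff {m n : ℕ} {A B : Matrix (Fin m) (Fin n) ℝ} : (∀ x, mv A x = mv B x) ↔ A = B := by
  constructor
  · intro h
    ext i j
    have := congrArg (fun v : E m => v i) (h (EuclideanSpace.single j 1))
    simpa [mv_apply] using this
  · rintro rfl x
    rfl

/-- Linear automorphisms as elements of the general linear group. -/
theorem exists_GL_eq {n : ℕ} (T : E n ≃ₗ[ℝ] E n) : ∃ g : GL (Fin n) ℝ, ∀ x, mv g.val x = T x := by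
  obtain ⟨A, hA⟩ := exists_mv_eq (T : E n →ₗ[ℝ] E n)
  obtain ⟨B, hB⟩ := exists_mv_eq (T.symm : E n →ₗ[ℝ] E n)
  refine ⟨⟨A, B, mv_eq_iff.1 fun x => ?_, mv_eq_iff.1 fun x => ?_⟩, fun x => ?_⟩
  · rw [mv_mul, hA, hB]; simp
  · rw [mv_mul, hA, hB]; simp
  · exact congrArg (· x) hA

/-- Linear automorphisms that preserve the form are elements of the isometry group. -/
theorem exists_isoGroup_eq {ν : Curv} {d : ℕ} (T : E (d + 1) ≃ₗ[ℝ] E (d + 1))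
    (hT : ∀ ζ η, form ν (T ζ) (T η) = form ν ζ η) :
    ∃ g : isoGroup d ν.sgn, ∀ ζ, mv g.1.val ζ = T ζ := by
  obtain ⟨g, hg⟩ := exists_GL_eq T
  have hs : ν.sgn ≠ 0 := by
    have := ν.sgn_sq
    intro h
    simp [h] at this
  have h1 : g.valᵀ * J d ν.sgn * g.val = J d ν.sgn := by
    refine Matrix.ext_iff_mulVec.2 fun v => dotProduct_eq _ _ fun u => ?_
    rw [dotProduct_comm, dotProduct_comm _ u]
    have h := hT (WithLp.toLp 2 u) (WithLp.toLp 2 v)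
    rw [← hg, ← hg, form_eq_dotProduct, form_eq_dotProduct] at h
    have h' := mul_left_cancel₀ hs h
    rw [← Matrix.mulVec_mulVec, ← Matrix.mulVec_mulVec, Matrix.dotProduct_mulVec u,
      Matrix.vecMul_transpose]
    exact h'
  have h2 := (mul_J_mul_transpose_iff ν g.val).2 h1
  refine ⟨⟨g, h2, ?_⟩, hg⟩
  have h3 := congrArg Matrix.det h1
  have h4 : (J d ν.sgn).det ≠ 0 := by
    intro h5
    have := congrArg Matrix.det (J_mul_J (d := d) ν)
    rw [Matrix.det_mul, h5] at this
    simp at this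
  rw [Matrix.det_mul, Matrix.det_mul, Matrix.det_transpose] at h3
  have h5 : (g.val.det ^ 2 - 1) * (J d ν.sgn).det = 0 := by linear_combination h3
  rcases mul_eq_zero.1 h5 with h | h
  · linarith
  · exact absurd h h4

/-- On the upper sheet the last coordinate exceeds the norm of the first part, so the product of the
last coordinates dominates the inner product. -/
theorem form_minus_pos {d : ℕ} {ζ η : E (d + 1)} (hζ : form .minus ζ ζ = 1) (hζ0 : 0 < lastCoord ζ)
    (hη : form .minus η η = 1) (hη0 : 0 < lastCoord η) : 0 < form .minus ζ η := by
  simp only [form, Curv.sgn, real_inner_self_eq_norm_sq] at hζ hη ⊢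
  have h1 : ‖fstPart ζ‖ < lastCoord ζ := by
    refine lt_of_pow_lt_pow_left₀ 2 hζ0.le ?_
    nlinarith
  have h2 : ‖fstPart η‖ < lastCoord η := by
    refine lt_of_pow_lt_pow_left₀ 2 hη0.le ?_
    nlinarith
  have h3 := real_inner_le_norm (fstPart ζ) (fstPart η)
  have h4 := mul_lt_mul'' h1 h2 (norm_nonneg _) (norm_nonneg _)
  linarith

/-- The sign of the form against one point of the upper sheet distinguishes the two sheets, since
`-ζ` would otherwise contradict `form_minus_pos`. -/
theorem mem_space_minus_of_form_pos {d : ℕ} {ζ η : E (d + 1)} (hη : η ∈ space .minus d)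
    (hζ : form .minus ζ ζ = 1) (h : 0 < form .minus ζ η) : ζ ∈ space .minus d := by
  refine ⟨hζ, ?_⟩
  by_contra h0
  have h1 : lastCoord ζ ≠ 0 := by
    intro h2
    have h3 := real_inner_self_nonneg (x := fstPart ζ)
    simp only [form, Curv.sgn, h2] at hζ
    linarith
  have h2 : 0 < lastCoord ((-1 : ℝ) • ζ) := by
    rw [lastCoord_smul]
    have : lastCoord ζ < 0 := lt_of_le_of_ne (not_lt.1 h0) h1
    linarith
  have h3 := form_minus_pos (by rw [form_smul_left, form_smul_right, hζ]; norm_num) h2 hη.1 hη.2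
  rw [form_smul_left] at h3
  linarith

theorem lift_zero_mem_space (ν : Curv) (d : ℕ) : lift (0 : E d) ∈ space ν d := by
  cases ν
  · simp [space, form]
  · simp [space, form]

/-- A linear map that preserves the form keeps each sheet or exchanges the two, so the image of the
single point `lift 0` decides. -/
theorem image_space_eq {ν : Curv} {d : ℕ} {T : E (d + 1) ≃ₗ[ℝ] E (d + 1)}
    (hT : ∀ ζ η, form ν (T ζ) (T η) = form ν ζ η) (h0 : T (lift 0) ∈ space ν d) :
    T '' space ν d = space ν d := by
  have hT' : ∀ ζ η, form ν (T.symm ζ) η = form ν ζ (T η) := by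
    intro ζ η
    rw [← hT, T.apply_symm_apply]
  cases ν
  · ext ζ
    rw [LinearEquiv.image_eq_preimage_symm]
    simp only [space, Set.mem_preimage, Set.mem_ofPred_eq, hT', T.apply_symm_apply]
  · refine Set.Subset.antisymm ?_ ?_
    · rintro _ ⟨ζ, hζ, rfl⟩
      refine mem_space_minus_of_form_pos h0 ((hT _ _).trans hζ.1) ?_
      rw [hT]
      exact form_minus_pos hζ.1 hζ.2 (lift_zero_mem_space .minus d).1 (lift_zero_mem_space .minus d).2
    · intro ζ hζ
      refine ⟨T.symm ζ, ?_, T.apply_symm_apply ζ⟩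
      refine mem_space_minus_of_form_pos (lift_zero_mem_space .minus d) ?_ ?_
      · rw [hT', T.apply_symm_apply]; exact hζ.1
      · rw [hT']
        exact form_minus_pos hζ.1 hζ.2 h0.1 h0.2

/-- The elements of the isometry group are isometries up to the sign. -/
theorem exists_isom_eq (ν : Curv) {d : ℕ} (g : isoGroup d ν.sgn) :
    ∃ (T : Isom ν d) (ε : ℝ), (ε = 1 ∨ ε = -1) ∧ (ν = .plus → ε = 1) ∧
      ∀ ζ, T.toEquiv ζ = ε • mv g.1.val ζ := by
  let T : E (d + 1) ≃ₗ[ℝ] E (d + 1) := LinearEquiv.ofLinearMap (mv g.1.val) (mv (g.1⁻¹).val)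
    (LinearMap.ext fun x => mv_mv_inv g.1 x) (LinearMap.ext fun x => mv_inv_mv g.1 x)
  have hT : ∀ ζ, T ζ = mv g.1.val ζ := fun ζ => rfl
  have hform : ∀ ζ η, form ν (T ζ) (T η) = form ν ζ η := form_mv ν g
  have hform' : ∀ ζ η, form ν (T.trans (LinearEquiv.neg ℝ) ζ) (T.trans (LinearEquiv.neg ℝ) η) =
      form ν ζ η := by
    intro ζ η
    have h1 : ∀ ζ, (T.trans (LinearEquiv.neg ℝ)) ζ = (-1 : ℝ) • T ζ := fun ζ => by simp
    rw [h1, h1, form_smul_left, form_smul_right, hform]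
    ring
  by_cases h0 : T (lift 0) ∈ space ν d
  · exact ⟨⟨T, hform, image_space_eq hform h0⟩, 1, Or.inl rfl, fun _ => rfl, fun ζ => by simp [hT]⟩
  -- Only the hyperboloid has two sheets; if `g` exchanges them, then `-g` is the isometry.
  · have h1 : ν = .minus := by
      cases ν
      · exact absurd ((hform _ _).trans (lift_zero_mem_space .plus d)) h0
      · rfl
    subst h1
    have h2 : form .minus (T (lift 0)) (T (lift 0)) = 1 :=
      (hform _ _).trans (lift_zero_mem_space .minus d).1
    have h3 : T.trans (LinearEquiv.neg ℝ) (lift 0) ∈ space .minus d := by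
      refine ⟨(hform' _ _).trans (lift_zero_mem_space .minus d).1, ?_⟩
      have h4 : (T.trans (LinearEquiv.neg ℝ)) (lift 0) = (-1 : ℝ) • T (lift 0) := by simp
      rw [h4, lastCoord_smul]
      have h5 : lastCoord (T (lift 0)) ≠ 0 := by
        intro h6
        have h7 := real_inner_self_nonneg (x := fstPart (T (lift 0)))
        simp only [form, Curv.sgn, h6] at h2
        linarith
      have h6 : ¬ 0 < lastCoord (T (lift 0)) := fun h => h0 ⟨h2, h⟩
      have : lastCoord (T (lift 0)) < 0 := lt_of_le_of_ne (not_lt.1 h6) h5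
      linarith
    exact ⟨⟨T.trans (LinearEquiv.neg ℝ), hform', image_space_eq hform' h3⟩, -1, Or.inr rfl,
      fun h => (Curv.noConfusion h), fun ζ => by simp [hT]⟩

end KPlane

end

noncomputable section

namespace KPlane

/-! ### The Riemannian measures of the sections of the sphere -/

theorem form_plus {d : ℕ} (ζ η : E (d + 1)) : form .plus ζ η = inner ℝ ζ η := by
  simp only [form, Curv.sgn, PiLp.inner_apply, fstPart, lastCoord, Fin.sum_univ_castSucc]
  simp [mul_comm, add_comm]

theorem form_plus_self {d : ℕ} (ζ : E (d + 1)) : form .plus ζ ζ = ‖ζ‖ ^ 2 := by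
  rw [form_plus, real_inner_self_eq_norm_sq]

theorem mem_space_plus {d : ℕ} {ζ : E (d + 1)} : ζ ∈ space .plus d ↔ ‖ζ‖ = 1 := by
  simp only [space, Set.mem_ofPred_eq, form_plus_self]
  exact pow_eq_one_iff_of_nonneg (norm_nonneg ζ) two_ne_zero

theorem ae_sectionMeasure_mem (ν : Curv) {d : ℕ} (W : Submodule ℝ (E (d + 1))) :
    ∀ᵐ ζ ∂sectionMeasure ν W, ζ ∈ W ∧ ζ ∈ space ν d := by
  have hrm : Measurable fun w : W => radial ν (w : E (d + 1)) :=
    (measurable_radial ν).comp measurable_subtype_coe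
  rw [sectionMeasure_eq ν W (Module.finBasis ℝ W)]
  refine Measure.ae_smul_measure ?_ _
  have hs : MeasurableSet {ζ : E (d + 1) | ζ ∈ W ∧ ζ ∈ space ν d} :=
    W.closed_of_finiteDimensional.measurableSet.inter (measurableSet_space ν d)
  rw [ae_map_iff hrm.aemeasurable hs, ae_restrict_iff' (measurableSet_coneSet ν W)]
  exact Filter.Eventually.of_forall fun w hw => ⟨W.smul_mem _ w.2, hw.2.2⟩

instance isFiniteMeasure_sectionMeasure_plus {d : ℕ} (W : Submodule ℝ (E (d + 1))) :
    IsFiniteMeasure (sectionMeasure .plus W) := by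
  have hrm : Measurable fun w : W => radial .plus (w : E (d + 1)) :=
    (measurable_radial .plus).comp measurable_subtype_coe
  have h : (Module.finBasis ℝ W).addHaar (coneSet .plus W) < ∞ := by
    refine lt_of_le_of_lt (measure_mono (t := Metric.closedBall 0 1) ?_)
      measure_closedBall_lt_top
    intro w hw
    have h1 : ‖(w : E (d + 1))‖ ^ 2 < 1 := by
      rw [← form_plus_self]; exact hw.2.1
    rw [mem_closedBall_zero_iff]
    exact ((sq_lt_one_iff₀ (norm_nonneg _)).1 h1).le
  refine ⟨?_⟩
  rw [sectionMeasure_eq .plus W (Module.finBasis ℝ W), Measure.smul_apply,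
    Measure.map_apply hrm MeasurableSet.univ, Set.preimage_univ, Measure.restrict_apply_univ]
  exact ENNReal.mul_lt_top (ENNReal.mul_lt_top (by simp) ENNReal.ofReal_lt_top) h

theorem sectionMeasure_map_mv {d : ℕ} (g : isoGroup d 1) (W : Submodule ℝ (E (d + 1))) :
    sectionMeasure .plus (W.map (mv g.1.val)) = (sectionMeasure .plus W).map (mv g.1.val) := by
  obtain ⟨T, ε, -, h1, h2⟩ := exists_isom_eq .plus g
  have h3 : (T.toEquiv : E (d + 1) →ₗ[ℝ] E (d + 1)) = mv g.1.val := by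
    ext1 ζ
    change T.toEquiv ζ = _
    rw [h2, h1 rfl, one_smul]
  rw [← h3, sectionMeasure_map T W]
  rfl

theorem measurable_mv_uncurry {d : ℕ} :
    Measurable fun p : isoGroup d 1 × E (d + 1) => mv p.1.1.val p.2 := by
  have h : Continuous fun p : isoGroup d 1 × E (d + 1) => (p.1.1.val, p.2) :=
    (Units.continuous_val.comp (continuous_subtype_val.comp continuous_fst)).prodMk continuous_snd
  exact (continuous_mv.comp h).measurable

theorem measurable_mv {m n : ℕ} (A : Matrix (Fin m) (Fin n) ℝ) : Measurable (mv A) :=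
  (LinearMap.continuous_of_finiteDimensional (mv A)).measurable

theorem mem_hits_cone_one {d k : ℕ} (W : Gr d k) : W ∈ hits k (cone d 1) := by
  have h : W.1 ≠ ⊥ := by
    intro h
    have := W.2
    rw [h, finrank_bot] at this
    omega
  obtain ⟨ζ, h1, h2⟩ := Submodule.exists_mem_ne_zero_of_ne_bot h
  exact ⟨ζ, h1, mem_cone_one.2 h2⟩

/-- The measures of the sections of the sphere form a kernel. -/
theorem measurable_sectionMeasure_plus {d k m : ℕ} (hm : m + k = d) :
    Measurable fun W : Gr d k => sectionMeasure .plus W.1 := by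
  rcases isEmpty_or_nonempty (Gr d k) with h | ⟨⟨W₀⟩⟩
  · exact measurable_of_empty _
  refine Measure.measurable_of_measurable_coe _ fun s hs => ?_
  have := countablySeparated_Gr (d := d) (k := k)
  have hφ : Measurable fun g : isoGroup d 1 => act g.1 W₀ := by
    have h1 : Measurable fun p : isoGroup d 1 × Gr d k => act p.1.1 p.2 :=
      measurable_act (ι := fun g : isoGroup d 1 => g.1) continuous_subtype_val
    exact h1.comp (measurable_id.prodMk measurable_const)
  have hsurj : Function.Surjective fun g : isoGroup d 1 => act g.1 W₀ := fun W =>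
    exists_act_eq_of_hits hm (Or.inl rfl) (mem_hits_cone_one W₀) (mem_hits_cone_one W)
  -- The orbit map is a Borel surjection from a Polish group onto a countably separated space, so
  -- measurability may be tested on the group. There the section measure is the image of one fixed
  -- measure under `g`.
  rw [← Measurable.measurable_comp_iff_of_surjective hφ hsurj]
  have h2 : ((fun W : Gr d k => sectionMeasure .plus W.1 s) ∘ fun g : isoGroup d 1 => act g.1 W₀) =
      fun g : isoGroup d 1 => ∫⁻ ζ, s.indicator 1 (mv g.1.val ζ) ∂sectionMeasure .plus W₀.1 := by
    ext g
    have h3 : sectionMeasure .plus (act g.1 W₀).1 =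
      (sectionMeasure .plus W₀.1).map (mv g.1.val) := sectionMeasure_map_mv g W₀.1
    rw [Function.comp_apply, h3, ← lintegral_indicator_one hs,
      lintegral_map (measurable_one.indicator hs) (measurable_mv _)]
  rw [h2]
  have h4 : Measurable fun p : isoGroup d 1 × E (d + 1) =>
      s.indicator (1 : E (d + 1) → ℝ≥0∞) (mv p.1.1.val p.2) :=
    (measurable_one.indicator hs).comp measurable_mv_uncurry
  exact h4.lintegral_prod_right'

theorem exists_isoGroup_mv_eq {d : ℕ} {ζ η : E (d + 1)} (h : ‖ζ‖ = ‖η‖) :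
    ∃ g : isoGroup d 1, mv g.1.val ζ = η := by
  let T := (ℝ ∙ (ζ - η))ᗮ.reflection
  obtain ⟨g, hg⟩ := exists_isoGroup_eq (ν := .plus) T.toLinearEquiv fun ζ η => by
    rw [form_plus, form_plus]
    exact T.inner_map_map ζ η
  exact ⟨g, (hg ζ).trans (Submodule.reflection_sub h)⟩

instance isFiniteMeasure_spaceMeasure_plus (d : ℕ) : IsFiniteMeasure (spaceMeasure .plus d) :=
  isFiniteMeasure_sectionMeasure_plus ⊤

theorem spaceMeasure_map_mv {d : ℕ} (g : isoGroup d 1) :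
    (spaceMeasure .plus d).map (mv g.1.val) = spaceMeasure .plus d := by
  rw [spaceMeasure, ← sectionMeasure_map_mv]
  congr 1
  rw [Submodule.map_top, LinearMap.range_eq_top]
  exact fun ζ => ⟨_, mv_mv_inv g.1 ζ⟩

theorem spaceMeasure_plus_ne_zero (d : ℕ) : spaceMeasure .plus d ≠ 0 := by
  intro h
  have h1 := isWeightedImage_spaceMeasure .plus d 1 measurable_one
  rw [h, lintegral_zero_measure, region_plus, Measure.restrict_univ] at h1
  simp only [Pi.one_apply, lintegral_one] at h1
  have h2 : (volume : Measure (E d)) Set.univ ≠ 0 := by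
    rw [Measure.measure_univ_ne_zero]
    exact NeZero.ne _
  exact mul_ne_zero (Curv.mult_ne_zero _) h2 h1.symm

end KPlane

end

/-! ### The average of the spherical sections -/

noncomputable section

namespace KPlane

theorem nonempty_flatPlane {d k : ℕ} (hk : k ≤ d) : Nonempty (FlatPlane d k) := by
  have h1 : LinearIndependent ℝ fun i : Fin k =>
      EuclideanSpace.basisFun (Fin d) ℝ (Fin.castLE hk i) :=
    (EuclideanSpace.basisFun (Fin d) ℝ).orthonormal.linearIndependent.comp (Fin.castLE hk)
      (Fin.castLE_injective hk)
  refine ⟨⟨AffineSubspace.mk' 0 (Submodule.span ℝ (Set.range fun i : Fin k =>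
    EuclideanSpace.basisFun (Fin d) ℝ (Fin.castLE hk i))), ⟨0, AffineSubspace.self_mem_mk' _ _⟩, ?_⟩⟩
  rw [AffineSubspace.direction_mk', finrank_span_eq_card h1, Fintype.card_fin]

/-- The linear span of the lift of an affine plane, as a point of the Grassmannian. -/
def FlatPlane.toGr {d k : ℕ} (π : FlatPlane d k) : Gr d k := ⟨flatLift π, π.finrank_flatLift⟩

theorem nonempty_Gr {d k : ℕ} (hk : k ≤ d) : Nonempty (Gr d k) :=
  (nonempty_flatPlane hk).map FlatPlane.toGr

theorem FlatPlane.measure_univ_ne_zero {d k : ℕ} (π : FlatPlane d k) : π.measure Set.univ ≠ 0 := by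
  have h : Measurable fun v : π.carrier.direction => (v : E d) + π.nonempty.some :=
    measurable_subtype_coe.add_const _
  rw [FlatPlane.measure, Measure.map_apply h MeasurableSet.univ, Set.preimage_univ,
    Measure.measure_univ_ne_zero]
  exact NeZero.ne _

theorem weightFactor_plus_ne_zero (ρ : ℝ) :
    Curv.plus.mult * ENNReal.ofReal √|1 + Curv.plus.sgn * ρ ^ 2| ≠ 0 := by
  refine mul_ne_zero (Curv.mult_ne_zero _) ?_
  have : 0 < √|1 + Curv.plus.sgn * ρ ^ 2| := by
    refine Real.sqrt_pos.2 (abs_pos.2 ?_)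
    simp only [Curv.sgn]
    positivity
  simpa using this

theorem sectionMeasure_flatLift_ne_zero {d k : ℕ} (π : FlatPlane d k) :
    sectionMeasure .plus (flatLift π) Set.univ ≠ 0 := by
  rw [Measure.measure_univ_ne_zero]
  intro h
  have h1 := isWeightedImage_flatLift .plus π 1 measurable_one
  rw [h, lintegral_zero_measure, region_plus, Measure.restrict_univ] at h1
  simp only [Pi.one_apply, lintegral_one] at h1
  exact mul_ne_zero (weightFactor_plus_ne_zero _) π.measure_univ_ne_zero h1.symm

section Bind

variable {d k m : ℕ}

/-- The sections of the sphere all have the same volume. -/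
theorem sectionMeasure_plus_univ_eq (hm : m + k = d) (W W' : Gr d k) :
    sectionMeasure .plus W.1 Set.univ = sectionMeasure .plus W'.1 Set.univ := by
  obtain ⟨g, rfl⟩ := exists_act_eq_of_hits hm (Or.inl rfl) (mem_hits_cone_one W)
    (mem_hits_cone_one W')
  have h3 : sectionMeasure .plus (act g.1 W).1 =
    (sectionMeasure .plus W.1).map (mv g.1.val) := sectionMeasure_map_mv g W.1
  rw [h3, Measure.map_apply (measurable_mv _) MeasurableSet.univ, Set.preimage_univ]

theorem sectionMeasure_plus_univ_ne_zero (hm : m + k = d) (W : Gr d k) :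
    sectionMeasure .plus W.1 Set.univ ≠ 0 := by
  obtain ⟨π⟩ := nonempty_flatPlane (show k ≤ d by omega)
  rw [sectionMeasure_plus_univ_eq hm W π.toGr]
  exact sectionMeasure_flatLift_ne_zero π

/-- The average of the measures of the sections is the measure of the sphere. -/
theorem exists_bind_sectionMeasure_eq (hm : m + k = d) [Nonempty (Gr d k)] : ∃ C : ℝ≥0∞, C ≠ 0 ∧ C ≠ ∞ ∧
    (grMeasure d k m 1).bind (fun W => sectionMeasure .plus W.1) = C • spaceMeasure .plus d := by
  have hK := measurable_sectionMeasure_plus hm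
  have hfin := isFiniteMeasure_grMeasure_one (d := d) (k := k) hm
  set M := grMeasure d k m 1 with hM
  have hbind : ∀ f : E (d + 1) → ℝ≥0∞, Measurable f →
      ∫⁻ ζ, f ζ ∂(M.bind fun W => sectionMeasure .plus W.1) =
        ∫⁻ W, ∫⁻ ζ, f ζ ∂sectionMeasure .plus W.1 ∂M := fun f hf =>
    Measure.lintegral_bind hK.aemeasurable hf.aemeasurable
  have hW : Nonempty (Gr d k) := inferInstance
  obtain ⟨W₀⟩ := hW
  have huniv : (M.bind fun W => sectionMeasure .plus W.1) Set.univ =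
      sectionMeasure .plus W₀.1 Set.univ * M Set.univ := by
    rw [Measure.bind_apply MeasurableSet.univ hK.aemeasurable,
      lintegral_congr fun W => sectionMeasure_plus_univ_eq hm W W₀, lintegral_const]
  have hfin2 : IsFiniteMeasure (M.bind fun W => sectionMeasure .plus W.1) := by
    refine ⟨?_⟩
    rw [huniv]
    exact ENNReal.mul_lt_top (measure_lt_top _ _) (measure_lt_top _ _)
  have hne : (M.bind fun W => sectionMeasure .plus W.1) ≠ 0 := by
    rw [← Measure.measure_univ_ne_zero, huniv]
    refine mul_ne_zero (sectionMeasure_plus_univ_ne_zero hm W₀) ?_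
    rw [Measure.measure_univ_ne_zero]
    exact grMeasure_ne_zero hm 1
  -- The average inherits invariance from the sections and from `grMeasure`; on the sphere, a single
  -- orbit of the group, invariance determines a σ-finite measure up to a factor.
  refine exists_eq_smul_of_transitive (H := isoGroup d 1)
    (a := fun g ζ => mv g.1.val ζ) measurable_mv_uncurry (fun ζ => mv_one ζ)
    (fun g h ζ => mv_mul g.1.val h.1.val ζ) (S := space .plus d) ?_ _ _ hne
    (spaceMeasure_plus_ne_zero d) ?_ ?_ ?_ ?_
  · intro ζ hζ η hη
    exact exists_isoGroup_mv_eq ((mem_space_plus.1 hζ).trans (mem_space_plus.1 hη).symm)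
  · change (M.bind fun W => sectionMeasure .plus W.1) (space .plus d)ᶜ = 0
    rw [Measure.bind_apply (measurableSet_space .plus d).compl hK.aemeasurable]
    refine lintegral_eq_zero_of_ae_eq_zero (Filter.Eventually.of_forall fun W => ?_)
    exact (ae_sectionMeasure_mem .plus W.1).mono fun ζ h => h.2
  · exact (ae_sectionMeasure_mem .plus _).mono fun ζ h => h.2
  · intro g
    refine Measure.ext_of_lintegral _ fun f hf => ?_
    have hg : Measurable (mv g.1.val) := measurable_mv _
    have hfg : Measurable fun ζ => f (mv g.1.val ζ) := hf.comp hg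
    rw [lintegral_map hf hg, hbind _ hfg, hbind _ hf]
    have h1 : ∀ W : Gr d k, ∫⁻ ζ, f (mv g.1.val ζ) ∂sectionMeasure .plus W.1 =
        ∫⁻ ζ, f ζ ∂sectionMeasure .plus (act g.1 W).1 := by
      intro W
      have h3 : sectionMeasure .plus (act g.1 W).1 =
        (sectionMeasure .plus W.1).map (mv g.1.val) := sectionMeasure_map_mv g W.1
      rw [h3, lintegral_map hf hg]
    rw [lintegral_congr h1]
    conv_rhs => rw [hM, ← grMeasure_map_act hm g]
    exact (lintegral_map ((Measure.measurable_lintegral hf).comp hK)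
      (measurable_act_right g.1)).symm
  · exact spaceMeasure_map_mv

theorem ae_ae_sectionMeasure (hm : m + k = d) [Nonempty (Gr d k)] {P : E (d + 1) → Prop}
    (h : ∀ᵐ ζ ∂spaceMeasure .plus d, P ζ) :
    ∀ᵐ W ∂grMeasure d k m 1, ∀ᵐ ζ ∂sectionMeasure .plus W.1, P ζ := by
  obtain ⟨C, -, -, hC⟩ := exists_bind_sectionMeasure_eq (k := k) hm
  refine Measure.ae_ae_of_ae_bind (measurable_sectionMeasure_plus hm).aemeasurable ?_
  rw [hC]
  exact Measure.ae_smul_measure h C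

/-- Averaging the integrals of `‖g‖` over the sections gives a multiple of its integral over the
sphere, which is finite. -/
theorem ae_integrable_sectionMeasure (hm : m + k = d) [Nonempty (Gr d k)] {g : E (d + 1) → ℝ} (hgm : Measurable g)
    (hg : Integrable g (spaceMeasure .plus d)) :
    ∀ᵐ W : Gr d k ∂grMeasure d k m 1, Integrable g (sectionMeasure .plus W.1) := by
  obtain ⟨C, -, hCt, hC⟩ := exists_bind_sectionMeasure_eq (k := k) hm
  have hK := measurable_sectionMeasure_plus hm
  have h1 := Measure.lintegral_bind (m := grMeasure d k m 1) (μ := fun W => sectionMeasure .plus W.1)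
    hK.aemeasurable hgm.enorm.aemeasurable
  rw [hC, lintegral_smul_measure, smul_eq_mul] at h1
  have h2 : ∫⁻ W : Gr d k, ∫⁻ ζ, ‖g ζ‖ₑ ∂sectionMeasure .plus W.1 ∂grMeasure d k m 1 ≠ ∞ := by
    rw [← h1]
    exact ENNReal.mul_ne_top hCt hg.2.ne
  filter_upwards [ae_lt_top ((Measure.measurable_lintegral hgm.enorm).comp hK) h2] with W hW
  exact ⟨hgm.aestronglyMeasurable, hW⟩

end Bind

/-- A subspace outside the affine chart has its section in the equator, which is null on the sphere.
So almost every such section would be null, whereas every section has positive measure. -/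
theorem ae_mem_hits_cone_zero {d k m : ℕ} [Nonempty (Gr d k)] (hm : m + k = d) (hd : 0 < d) :
    ∀ᵐ W ∂grMeasure d k m 1, W ∈ hits k (cone d 0) := by
  have h1 : ∀ᵐ ζ ∂spaceMeasure .plus d, lastCoord ζ ≠ 0 := by
    have : Nontrivial (E d) := by
      refine Module.nontrivial_of_finrank_pos (R := ℝ) ?_
      rw [finrank_euclideanSpace_fin]; exact hd
    have h2 := isWeightedImage_spaceMeasure .plus d (Set.indicator {0} 1)
      (measurable_one.indicator (measurableSet_singleton _))
    rw [lintegral_indicator_one (measurableSet_singleton _), region_plus, Measure.restrict_univ,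
      measure_singleton, mul_zero] at h2
    have h3 : Measurable fun ζ : E (d + 1) => ENNReal.ofReal (bracket .plus (proj ζ)) ^ (d + 1) *
        Set.indicator {(0 : E d)} (1 : E d → ℝ≥0∞) (proj ζ) :=
      (((measurable_bracket .plus).comp measurable_proj).ennreal_ofReal.pow_const _).mul
        ((measurable_one.indicator (measurableSet_singleton _)).comp measurable_proj)
    filter_upwards [(lintegral_eq_zero_iff h3).1 h2] with ζ hζ h0
    -- Since `0⁻¹ = 0`, the projection sends the equator to the origin, a null set of `ℝᵈ`.
    have h4 : proj ζ = 0 := by simp [proj, h0]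
    simp [h4, bracket] at hζ
  filter_upwards [ae_ae_sectionMeasure hm h1] with W hW
  by_contra h2
  have h3 : ∀ᵐ ζ ∂sectionMeasure .plus W.1, False := by
    filter_upwards [hW, ae_sectionMeasure_mem .plus W.1] with ζ h4 h5
    exact h2 ⟨ζ, h5.1, mem_cone_zero.2 h4⟩
  have h4 : sectionMeasure .plus W.1 Set.univ = 0 := by
    have := ae_iff.1 h3
    simpa using this
  exact sectionMeasure_plus_univ_ne_zero hm W h4

theorem measurable_integral_sectionMeasure {d k m : ℕ} (hm : m + k = d) {g : E (d + 1) → ℝ}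
    (hg : Measurable g) : Measurable fun W : Gr d k => ∫ ζ, g ζ ∂sectionMeasure .plus W.1 := by
  let K : ProbabilityTheory.Kernel (Gr d k) (E (d + 1)) :=
    ⟨fun W => sectionMeasure .plus W.1, measurable_sectionMeasure_plus hm⟩
  exact (hg.stronglyMeasurable.integral_kernel (κ := K)).measurable

end KPlane

end

noncomputable section

namespace KPlane

/-! ### Charts of spaces of planes in the Grassmannian -/

theorem countablySeparated_of_carrier {X Y : Type*} [MeasurableSpace X] [TopologicalSpace Y]
    [SecondCountableTopology Y] (c : X → Set Y) (hc : ∀ x, IsClosed (c x))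
    (hinj : Function.Injective c) (hmeas : ∀ U, IsOpen U → MeasurableSet {x | (c x ∩ U).Nonempty}) :
    MeasurableSpace.CountablySeparated X := by
  have hB := TopologicalSpace.isBasis_countableBasis Y
  refine ⟨⟨(fun U => {x | (c x ∩ U).Nonempty}) '' TopologicalSpace.countableBasis Y,
    (TopologicalSpace.countable_countableBasis _).image _, ?_, ?_⟩⟩
  · rintro _ ⟨b, hb, rfl⟩
    exact hmeas b (hB.isOpen hb)
  · intro x _ x' _ h
    have key : ∀ z z' : X, (∀ s ∈ (fun U => {x | (c x ∩ U).Nonempty}) ''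
        TopologicalSpace.countableBasis Y, z ∈ s ↔ z' ∈ s) → c z ⊆ c z' := by
      intro z z' h y hy
      by_contra hy'
      obtain ⟨b, hb, hyb, hbz⟩ := hB.exists_subset_of_mem_open
        (show y ∈ (c z')ᶜ from hy') (hc z').isOpen_compl
      obtain ⟨w, hw, hwb⟩ := (h _ ⟨b, hb, rfl⟩).1 ⟨y, hy, hyb⟩
      exact hbz hwb hw
    exact hinj (Set.Subset.antisymm (key x x' h) (key x' x fun s hs => (h s hs).symm))

/-- An image of a σ-finite measure need not be σ-finite; the left inverse transports the spanning
sets. -/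
theorem sigmaFinite_map_of_ae_left_inv {X Y : Type*} [MeasurableSpace X] [MeasurableSpace Y]
    (μ : Measure X) [SigmaFinite μ] {f : X → Y} {g : Y → X} (hf : Measurable f) (hg : Measurable g)
    (h : ∀ᵐ x ∂μ, g (f x) = x) : SigmaFinite (μ.map f) := by
  refine ⟨⟨⟨fun n => g ⁻¹' spanningSets μ n, fun _ => trivial, fun n => ?_, ?_⟩⟩⟩
  · rw [Measure.map_apply hf (hg (measurableSet_spanningSets μ n))]
    refine lt_of_le_of_lt (measure_mono_ae ?_) (measure_spanningSets_lt_top μ n)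
    filter_upwards [h] with x hx hx'
    change g (f x) ∈ spanningSets μ n at hx'
    rwa [hx] at hx'
  · rw [← Set.preimage_iUnion, iUnion_spanningSets, Set.preimage_univ]

/-- The space `X` of planes, with its group of motions, is identified with the set of subspaces that
hit the cone, with the action of the isometry group. -/
structure IsChart {d k : ℕ} {X Γ : Type*} [MeasurableSpace X] (κ : ℝ) (toGr : X → Gr d k)
    (ofGr : Gr d k → X) (move : Γ → X → X) : Prop where
  separated : MeasurableSpace.CountablySeparated X
  measurable_ofGr : Measurable ofGr
  left_inv : ∀ x, ofGr (toGr x) = x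
  mem_hits : ∀ x, toGr x ∈ hits k (cone d κ)
  right_inv : ∀ W ∈ hits k (cone d κ), toGr (ofGr W) = W
  exists_move : ∀ g : isoGroup d κ, ∃ T, ∀ x, toGr (move T x) = act g.1 (toGr x)
  exists_iso : ∀ T, ∃ g : isoGroup d κ, ∀ x, toGr (move T x) = act g.1 (toGr x)

namespace IsChart

variable {d k m : ℕ} {X Γ : Type*} [MeasurableSpace X] {κ : ℝ} {toGr : X → Gr d k}
  {ofGr : Gr d k → X} {move : Γ → X → X}

/-- The Effros σ-algebra makes `ofGr` easily measurable; its inverse is treated along an orbit.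
Transitivity gives a Borel surjection from the Polish isometry group onto `X`, and its composite
with `toGr` is an orbit map in the Grassmannian. -/
theorem measurable_toGr (h : IsChart κ toGr ofGr move) (hm : m + k = d) (hκ : IsCurv κ) :
    Measurable toGr := by
  have := h.separated
  rcases isEmpty_or_nonempty X with hX | ⟨⟨x₀⟩⟩
  · exact measurable_of_empty _
  have hact : Measurable fun g : isoGroup d κ => act g.1 (toGr x₀) := by
    have h1 : Measurable fun p : isoGroup d κ × Gr d k => act p.1.1 p.2 :=
      measurable_act (ι := fun g : isoGroup d κ => g.1) continuous_subtype_val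
    exact h1.comp (measurable_id.prodMk measurable_const)
  have hφ : Measurable fun g : isoGroup d κ => ofGr (act g.1 (toGr x₀)) :=
    h.measurable_ofGr.comp hact
  have hsurj : Function.Surjective fun g : isoGroup d κ => ofGr (act g.1 (toGr x₀)) := by
    intro x
    obtain ⟨g, hg⟩ := exists_act_eq_of_hits hm hκ (h.mem_hits x₀) (h.mem_hits x)
    exact ⟨g, by simp only [hg, h.left_inv]⟩
  rw [← Measurable.measurable_comp_iff_of_surjective hφ hsurj]
  convert hact using 1
  ext1 g
  obtain ⟨T, hT⟩ := h.exists_move g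
  refine h.right_inv _ ?_
  rw [← hT]
  exact h.mem_hits _

theorem measurable_move (h : IsChart κ toGr ofGr move) (hm : m + k = d) (hκ : IsCurv κ) (T : Γ) :
    Measurable (move T) := by
  obtain ⟨g, hg⟩ := h.exists_iso T
  have h1 : move T = fun x => ofGr (act g.1 (toGr x)) := by
    ext1 x
    rw [← hg, h.left_inv]
  rw [h1]
  exact h.measurable_ofGr.comp ((measurable_act_right g.1).comp (h.measurable_toGr hm hκ))

/-- Invariant measures exist. -/
theorem exists_invariant [Nonempty (Gr d k)] (h : IsChart κ toGr ofGr move) (hm : m + k = d)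
    (hκ : IsCurv κ) :
    ∃ μ : Measure X, μ ≠ 0 ∧ SigmaFinite μ ∧ ∀ T, μ.map (move T) = μ := by
  have hae := ae_grMeasure_hits (k := k) hm hκ
  have hσ := sigmaFinite_grMeasure (k := k) hm hκ
  refine ⟨(grMeasure d k m κ).map ofGr, ?_, ?_, fun T => ?_⟩
  · rw [Ne, Measure.map_eq_zero_iff h.measurable_ofGr.aemeasurable]
    exact grMeasure_ne_zero hm κ
  · exact sigmaFinite_map_of_ae_left_inv _ h.measurable_ofGr (h.measurable_toGr hm hκ)
      (hae.mono fun W hW => h.right_inv W hW)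
  · obtain ⟨g, hg⟩ := h.exists_iso T
    rw [Measure.map_map (h.measurable_move hm hκ T) h.measurable_ofGr]
    conv_rhs => rw [← grMeasure_map_act hm g,
      Measure.map_map h.measurable_ofGr (measurable_act_right g.1)]
    refine Measure.map_congr (hae.mono fun W hW => ?_)
    rw [Function.comp_apply, Function.comp_apply, ← h.left_inv (move T (ofGr W)), hg,
      h.right_inv W hW]

/-- Invariant measures are unique up to a factor. -/
theorem exists_map_eq_smul [Nonempty (Gr d k)] (h : IsChart κ toGr ofGr move) (hm : m + k = d)
    (hκ : IsCurv κ) {μ : Measure X} (hμ0 : μ ≠ 0) (hμσ : SigmaFinite μ)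
    (hμ : ∀ T, μ.map (move T) = μ) :
    ∃ c : ℝ≥0∞, c ≠ 0 ∧ c ≠ ∞ ∧ μ.map toGr = c • grMeasure d k m κ := by
  have hι := h.measurable_toGr hm hκ
  have := sigmaFinite_map_of_ae_left_inv μ hι h.measurable_ofGr
    (Filter.Eventually.of_forall h.left_inv)
  refine exists_eq_smul_grMeasure hm hκ (μ.map toGr) ?_ ?_ fun g => ?_
  · rwa [Ne, Measure.map_eq_zero_iff hι.aemeasurable]
  · exact (ae_map_iff hι.aemeasurable (measurableSet_hits (isOpen_cone d κ))).2
      (Filter.Eventually.of_forall h.mem_hits)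
  · obtain ⟨T, hT⟩ := h.exists_move g
    rw [Measure.map_map (measurable_act_right g.1) hι]
    conv_rhs => rw [← hμ T, Measure.map_map hι (h.measurable_move hm hκ T)]
    congr 1
    ext1 x
    exact (hT x).symm

end IsChart

/-! ### The space of affine planes -/

/-- A subspace that contains one lift is spanned by its lifts: vectors with nonzero last coordinate
are multiples of lifts, and adding `lift x` to a horizontal vector reduces it to that case. -/
theorem eq_of_lift_mem_iff {d : ℕ} {W W' : Submodule ℝ (E (d + 1))} {x : E d} (hx : lift x ∈ W)
    (h : ∀ y, lift y ∈ W ↔ lift y ∈ W') : W = W' := by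
  have key : ∀ V V' : Submodule ℝ (E (d + 1)), lift x ∈ V → (∀ y, lift y ∈ V → lift y ∈ V') →
      V ≤ V' := by
    intro V V' hV hVV ζ hζ
    have key' : ∀ ζ ∈ V, lastCoord ζ ≠ 0 → ζ ∈ V' := by
      intro ζ hζ h0
      have h1 := eq_smul_lift_proj h0
      have h2 : lift (proj ζ) ∈ V := by
        have h3 : lift (proj ζ) = (lastCoord ζ)⁻¹ • ζ := by
          conv_rhs => rw [h1]
          rw [lastCoord_smul, lastCoord_lift, mul_one, smul_smul, inv_mul_cancel₀ h0, one_smul]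
        rw [h3]
        exact V.smul_mem _ hζ
      rw [h1]
      exact V'.smul_mem _ (hVV _ h2)
    by_cases h0 : lastCoord ζ = 0
    · have h1 := key' (ζ + lift x) (V.add_mem hζ hV) (by simp [h0])
      simpa using V'.sub_mem h1 (hVV x hV)
    · exact key' ζ hζ h0
  exact le_antisymm (key W W' hx fun y => (h y).1) (key W' W ((h x).1 hx) fun y => (h y).2)

theorem FlatPlane.ext {d k : ℕ} {π π' : FlatPlane d k} (h : π.carrier = π'.carrier) : π = π' := by
  cases π; cases π'; cases h; rfl

theorem flatSpan_comap_horiz {d : ℕ} {W : Submodule ℝ (E (d + 1))} {x : E d} (hx : lift x ∈ W) :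
    flatSpan x (W.comap horiz) = W := by
  refine eq_of_lift_mem_iff (x := x) (lift_mem_flatSpan.2 ?_) fun y => ?_
  · rw [sub_self]; exact Submodule.zero_mem _
  · rw [lift_mem_flatSpan, Submodule.mem_comap]
    have h1 : lift y = lift x + horiz (y - x) := by rw [← lift_add, add_sub_cancel]
    rw [h1]
    exact (W.add_mem_iff_right hx).symm

/-- The affine plane with a given linear span. -/
def flatSection {d k : ℕ} (W : Gr d k) {x : E d} (hx : lift x ∈ W.1) : FlatPlane d k where
  carrier := AffineSubspace.mk' x (W.1.comap horiz)
  nonempty := ⟨x, AffineSubspace.self_mem_mk' _ _⟩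
  finrank_direction := by
    have h := W.2
    rw [← flatSpan_comap_horiz hx, finrank_flatSpan] at h
    rw [AffineSubspace.direction_mk']
    omega

theorem mem_flatSection {d k : ℕ} {W : Gr d k} {x : E d} (hx : lift x ∈ W.1) {y : E d} :
    y ∈ (flatSection W hx).carrier ↔ lift y ∈ W.1 := by
  conv_rhs => rw [← flatSpan_comap_horiz hx, lift_mem_flatSpan]
  exact AffineSubspace.mem_mk'

open Classical in
/-- The affine plane with a given linear span, if there is one. -/
def flatOfGr {d k : ℕ} [Nonempty (FlatPlane d k)] (W : Gr d k) : FlatPlane d k :=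
  if h : ∃ x, lift x ∈ W.1 then flatSection W h.choose_spec else Classical.arbitrary _

theorem mem_flatOfGr {d k : ℕ} [Nonempty (FlatPlane d k)] {W : Gr d k}
    (hW : W ∈ hits k (cone d 0)) {y : E d} : y ∈ (flatOfGr W).carrier ↔ lift y ∈ W.1 := by
  have h := mem_hits_cone_zero.1 hW
  rw [flatOfGr, dif_pos h, mem_flatSection]

theorem measurableSet_flatPlane_hits {d k : ℕ} {U : Set (E d)} (hU : IsOpen U) :
    MeasurableSet {π : FlatPlane d k | ((π.carrier : Set (E d)) ∩ U).Nonempty} :=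
  MeasurableSpace.measurableSet_generateFrom ⟨U, hU, rfl⟩

theorem isOpen_proj_mem {d : ℕ} {U : Set (E d)} (hU : IsOpen U) :
    IsOpen {ζ : E (d + 1) | lastCoord ζ ≠ 0 ∧ proj ζ ∈ U} := by
  have h1 : IsOpen {ζ : E (d + 1) | lastCoord ζ ≠ 0} :=
    isOpen_ne_fun continuous_lastCoord continuous_const
  have h2 : ContinuousOn (proj : E (d + 1) → E d) {ζ : E (d + 1) | lastCoord ζ ≠ 0} :=
    ((continuous_lastCoord.continuousOn.inv₀ fun ζ hζ => hζ).smul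
      continuous_fstPart.continuousOn).neg
  exact h2.isOpen_inter_preimage h1 hU

theorem measurable_flatOfGr {d k : ℕ} [Nonempty (FlatPlane d k)] :
    Measurable (flatOfGr : Gr d k → FlatPlane d k) := by
  refine measurable_generateFrom ?_
  rintro _ ⟨U, hU, rfl⟩
  have h : flatOfGr ⁻¹' {π : FlatPlane d k | ((π.carrier : Set (E d)) ∩ U).Nonempty} =
      hits k {ζ : E (d + 1) | lastCoord ζ ≠ 0 ∧ proj ζ ∈ U} ∪ ((hits k (cone d 0))ᶜ ∩
        {_W | (((Classical.arbitrary (FlatPlane d k)).carrier : Set (E d)) ∩ U).Nonempty}) := by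
    ext W
    by_cases hW : W ∈ hits k (cone d 0)
    · simp only [Set.mem_preimage, Set.mem_union, Set.mem_inter_iff, Set.mem_compl_iff, hW,
        not_true, false_and, or_false]
      constructor
      · rintro ⟨y, hy, hyU⟩
        exact ⟨lift y, (mem_flatOfGr hW).1 hy, by simp, by simpa using hyU⟩
      · rintro ⟨ζ, h1, h2, h3⟩
        refine ⟨proj ζ, (mem_flatOfGr hW).2 ?_, h3⟩
        have h4 := eq_smul_lift_proj h2
        rw [h4] at h1
        have h5 := W.1.smul_mem (lastCoord ζ)⁻¹ h1
        rwa [smul_smul, inv_mul_cancel₀ h2, one_smul] at h5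
    · have h1 : W ∉ hits k {ζ : E (d + 1) | lastCoord ζ ≠ 0 ∧ proj ζ ∈ U} := by
        rintro ⟨ζ, h1, h2, -⟩
        exact hW ⟨ζ, h1, mem_cone_zero.2 h2⟩
      have h2 : flatOfGr W = Classical.arbitrary (FlatPlane d k) := by
        rw [flatOfGr, dif_neg]
        exact fun h => hW (mem_hits_cone_zero.2 h)
      simp only [Set.mem_preimage, Set.mem_union, Set.mem_inter_iff, Set.mem_compl_iff, hW, h1, h2,
        not_false_eq_true, true_and, false_or, Set.mem_ofPred_eq]
  rw [h]
  exact (measurableSet_hits (isOpen_proj_mem hU)).union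
    ((measurableSet_hits (isOpen_cone d 0)).compl.inter (MeasurableSet.const _))

theorem toGr_mem_hits {d k : ℕ} (π : FlatPlane d k) : π.toGr ∈ hits k (cone d 0) :=
  mem_hits_cone_zero.2 ⟨π.foot, π.lift_mem_flatLift.2 π.foot_mem⟩

theorem toGr_move {d k : ℕ} {g : GL (Fin (d + 1)) ℝ} {T : E d ≃ᵃⁱ[ℝ] E d} {a : ℝ} (ha : a ≠ 0)
    (h : ∀ x, mv g.val (lift x) = a • lift (T x)) (π : FlatPlane d k) :
    (π.move T).toGr = act g π.toGr := by
  refine Subtype.ext (eq_of_lift_mem_iff (x := (π.move T).foot)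
    ((π.move T).lift_mem_flatLift.2 (π.move T).foot_mem) fun y => ?_)
  obtain ⟨x, rfl⟩ := T.surjective y
  change lift (T x) ∈ flatLift (π.move T) ↔ _
  rw [FlatPlane.lift_mem_flatLift, mem_act]
  have h1 : mv (g⁻¹).val (lift (T x)) = a⁻¹ • lift x := by
    have h2 : lift (T x) = a⁻¹ • mv g.val (lift x) := by
      rw [h, smul_smul, inv_mul_cancel₀ ha, one_smul]
    rw [h2, map_smul, mv_inv_mv]
  rw [h1]
  change T x ∈ (π.move T).carrier ↔ a⁻¹ • lift x ∈ flatLift π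
  rw [Submodule.smul_mem_iff _ (inv_ne_zero ha), FlatPlane.lift_mem_flatLift]
  exact AffineSubspace.mem_map_iff_mem_of_injective T.injective

end KPlane

end

/-! ### Rigid motions as isometries of the degenerate form -/

noncomputable section

namespace KPlane

open scoped Matrix

/-- The upper left block. -/
def topBlock {d : ℕ} (g : Matrix (Fin (d + 1)) (Fin (d + 1)) ℝ) : Matrix (Fin d) (Fin d) ℝ :=
  g.submatrix Fin.castSucc Fin.castSucc

theorem det_eq_of_lastRow {d : ℕ} {g : Matrix (Fin (d + 1)) (Fin (d + 1)) ℝ}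
    (h : ∀ j : Fin d, g (Fin.last d) j.castSucc = 0) :
    g.det = g (Fin.last d) (Fin.last d) * (topBlock g).det := by
  rw [Matrix.det_succ_row g (Fin.last d), Fin.sum_univ_castSucc]
  have h1 : ((-1 : ℝ)) ^ (d + d) = 1 := by rw [← two_mul, pow_mul]; simp
  simp [h, topBlock, h1, Fin.succAbove_last]

/-- For `κ = 0` the form sees only the first `d` columns. The last diagonal entry of the equation is
a sum of squares and kills the last row there; the rest makes the upper block orthogonal, and the
determinant condition leaves `±1` in the corner. -/
theorem mem_isoGroup_zero {d : ℕ} {g : GL (Fin (d + 1)) ℝ} : g ∈ isoGroup d 0 ↔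
    (∀ j : Fin d, g.val (Fin.last d) j.castSucc = 0) ∧ topBlock g.val * (topBlock g.val)ᵀ = 1 ∧
      g.val (Fin.last d) (Fin.last d) ^ 2 = 1 := by
  have hform : g.val * J d 0 * g.valᵀ = headCols g.val * (headCols g.val)ᵀ := gram_J_zero g.val
  have hent : ∀ i j, (headCols g.val * (headCols g.val)ᵀ) i j =
      ∑ l : Fin d, g.val i l.castSucc * g.val j l.castSucc := by
    intro i j
    simp [Matrix.mul_apply, headCols]
  have htop : ∀ i j, (topBlock g.val * (topBlock g.val)ᵀ) i j =
      ∑ l : Fin d, g.val i.castSucc l.castSucc * g.val j.castSucc l.castSucc := by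
    intro i j
    simp [Matrix.mul_apply, topBlock]
  have hdet : topBlock g.val * (topBlock g.val)ᵀ = 1 → (topBlock g.val).det ^ 2 = 1 := by
    intro h
    have := congrArg Matrix.det h
    rwa [Matrix.det_mul, Matrix.det_transpose, Matrix.det_one, ← sq] at this
  rw [mem_isoGroup, hform]
  constructor
  · rintro ⟨h1, h2⟩
    have h3 : ∀ j : Fin d, g.val (Fin.last d) j.castSucc = 0 := by
      have h4 := congrFun (congrFun h1 (Fin.last d)) (Fin.last d)
      rw [hent] at h4
      simp only [J, Matrix.diagonal_apply_eq, if_true] at h4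
      intro j
      exact mul_self_eq_zero.1
        ((Finset.sum_eq_zero_iff_of_nonneg fun i _ => mul_self_nonneg _).1 h4 j (Finset.mem_univ _))
    have h5 : topBlock g.val * (topBlock g.val)ᵀ = 1 := by
      ext i j
      have h4 := congrFun (congrFun h1 i.castSucc) j.castSucc
      rw [hent] at h4
      rw [htop, h4]
      simp [J, Matrix.diagonal_apply, Matrix.one_apply, Fin.castSucc_ne_last]
    refine ⟨h3, h5, ?_⟩
    rw [det_eq_of_lastRow h3, mul_pow, hdet h5, mul_one] at h2
    exact h2
  · rintro ⟨h1, h2, h3⟩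
    refine ⟨?_, ?_⟩
    · ext i j
      rw [hent]
      refine Fin.lastCases ?_ (fun i => ?_) i <;> refine Fin.lastCases ?_ (fun j => ?_) j
      · simp [J, h1]
      · simp [J, h1, Matrix.diagonal_apply]
      · simp [J, h1]
      · rw [← htop, h2]
        simp [J, Matrix.diagonal_apply, Matrix.one_apply, Fin.castSucc_ne_last]
    · rw [det_eq_of_lastRow h1, mul_pow, hdet h2, h3, one_mul]

theorem norm_mv_of_mul_transpose {n : ℕ} {A : Matrix (Fin n) (Fin n) ℝ} (h : A * Aᵀ = 1) (x : E n) :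
    ‖mv A x‖ = ‖x‖ := by
  have h1 : Aᵀ * A = 1 := mul_eq_one_comm.1 h
  have h2 : ‖mv A x‖ ^ 2 = ‖x‖ ^ 2 := by
    rw [← real_inner_self_eq_norm_sq, ← real_inner_self_eq_norm_sq]
    have h3 := inner_mv_transpose Aᵀ x (mv A x)
    rw [Matrix.transpose_transpose] at h3
    rw [h3, ← mv_mul, h1, mv_one]
  exact (sq_eq_sq₀ (norm_nonneg _) (norm_nonneg _)).1 h2

theorem mul_transpose_of_norm_mv {n : ℕ} {A : Matrix (Fin n) (Fin n) ℝ}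
    (h : ∀ x y, inner ℝ (mv A x) (mv A y) = inner ℝ x y) : A * Aᵀ = 1 := by
  refine mul_eq_one_comm.1 (mv_eq_iff.1 fun x => ?_)
  rw [mv_one]
  refine ext_inner_right ℝ fun y => ?_
  have h3 := inner_mv_transpose A (mv A x) y
  rw [mv_mul, h3, h]

theorem fstPart_mv_lift {d : ℕ} {g : Matrix (Fin (d + 1)) (Fin (d + 1)) ℝ} (x : E d) :
    fstPart (mv g (lift x)) = fstPart (mv g (lift 0)) - mv (topBlock g) x := by
  ext i
  simp only [fstPart, mv_apply, PiLp.sub_apply, Fin.sum_univ_castSucc, topBlock, lift]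
  simp
  ring

theorem lastCoord_mv_lift {d : ℕ} {g : Matrix (Fin (d + 1)) (Fin (d + 1)) ℝ}
    (h : ∀ j : Fin d, g (Fin.last d) j.castSucc = 0) (x : E d) :
    lastCoord (mv g (lift x)) = g (Fin.last d) (Fin.last d) := by
  simp [lastCoord, mv_apply, Fin.sum_univ_castSucc, h, lift]

/-- The elements of the flat isometry group act by rigid motions. -/
theorem exists_affineIsometry {d : ℕ} (g : isoGroup d 0) : ∃ (T : E d ≃ᵃⁱ[ℝ] E d) (a : ℝ), a ≠ 0 ∧
    ∀ x, mv g.1.val (lift x) = a • lift (T x) := by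
  obtain ⟨h1, h2, h3⟩ := mem_isoGroup_zero.1 g.2
  set a := g.1.val (Fin.last d) (Fin.last d) with ha
  have ha0 : a ≠ 0 := by
    intro h
    rw [h] at h3
    norm_num at h3
  have haa : a * a = 1 := by rw [← sq, h3]
  -- As `a = ±1`, dividing by the last coordinate `a` is the same as multiplying by it.
  let L : E d →ₗᵢ[ℝ] E d := ⟨a • mv (topBlock g.1.val), fun x => by
    rw [LinearMap.smul_apply, norm_smul, norm_mv_of_mul_transpose h2, Real.norm_eq_abs,
      (pow_eq_one_iff_of_nonneg (abs_nonneg a) two_ne_zero).1 (by rw [sq_abs, h3]), one_mul]⟩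
  let L' : E d ≃ₗᵢ[ℝ] E d := L.toLinearIsometryEquiv rfl
  have hL : ∀ x, L' x = a • mv (topBlock g.1.val) x := fun x => rfl
  let b : E d := -(a • fstPart (mv g.1.val (lift 0)))
  refine ⟨L'.toAffineIsometryEquiv.trans (AffineIsometryEquiv.vaddConst ℝ b), a, ha0, fun x => ?_⟩
  have hT : (L'.toAffineIsometryEquiv.trans (AffineIsometryEquiv.vaddConst ℝ b)) x = L' x + b := rfl
  rw [hT]
  refine ext_parts ?_ ?_
  · rw [fstPart_mv_lift, fstPart_smul, fstPart_lift, hL]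
    simp only [b, smul_neg, smul_add, neg_add, smul_smul, haa, one_smul, neg_neg]
    abel
  · rw [lastCoord_mv_lift h1, lastCoord_smul, lastCoord_lift, mul_one]

/-- Rigid motions are induced by elements of the flat isometry group. -/
theorem exists_isoGroup_zero {d : ℕ} (T : E d ≃ᵃⁱ[ℝ] E d) :
    ∃ g : isoGroup d 0, ∀ x, mv g.1.val (lift x) = (1 : ℝ) • lift (T x) := by
  obtain ⟨R, hR⟩ := exists_mv_eq (T.linearIsometryEquiv.toLinearEquiv : E d →ₗ[ℝ] E d)
  have hR' : ∀ x, mv R x = T.linearIsometryEquiv x := fun x => congrArg (· x) hR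
  have hT : ∀ x, T x = mv R x + T 0 := by
    intro x
    have h := T.map_vadd 0 x
    rw [vadd_eq_add, add_zero, vadd_eq_add] at h
    rw [h, hR']
  -- The block matrix with linear part `R`, last column `(-T 0, 1)` and last row `(0, 1)`. The minus
  -- sign comes from `lift x = (-x, 1)`.
  let A : Matrix (Fin (d + 1)) (Fin (d + 1)) ℝ := Matrix.of fun i j =>
    Fin.lastCases (motive := fun _ => ℝ) (Fin.lastCases (motive := fun _ => ℝ) 1 (fun _ => 0) j)
      (fun i => Fin.lastCases (motive := fun _ => ℝ) (-(T 0) i) (fun j => R i j) j) i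
  have h1 : ∀ j : Fin d, A (Fin.last d) j.castSucc = 0 := fun j => by simp [A]
  have h2 : A (Fin.last d) (Fin.last d) = 1 := by simp [A]
  have h3 : topBlock A = R := by
    ext i j
    simp [A, topBlock]
  have h4 : R * Rᵀ = 1 := mul_transpose_of_norm_mv fun x y => by
    rw [hR', hR', LinearIsometryEquiv.inner_map_map]
  have h5 : A.det ≠ 0 := by
    rw [det_eq_of_lastRow h1, h2, h3, one_mul]
    intro h
    have := congrArg Matrix.det h4
    rw [Matrix.det_mul, h, zero_mul, Matrix.det_one] at this
    exact zero_ne_one this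
  have h6 : A (Fin.last d) (Fin.last d) ^ 2 = 1 := by rw [h2, one_pow]
  refine ⟨⟨Matrix.GeneralLinearGroup.mkOfDetNeZero A h5, mem_isoGroup_zero.2
    ⟨h1, by rw [← h3] at h4; exact h4, h6⟩⟩, fun x => ?_⟩
  change mv A (lift x) = _
  rw [one_smul]
  refine ext_parts ?_ ?_
  · rw [fstPart_mv_lift, fstPart_lift, h3, hT x]
    have h7 : fstPart (mv A (lift 0)) = -(T 0) := by
      ext i
      simp [fstPart, mv_apply, Fin.sum_univ_castSucc, lift, A]
    rw [h7]
    abel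
  · rw [lastCoord_mv_lift h1, lastCoord_lift, h2]

theorem isChart_flat {d k : ℕ} [Nonempty (FlatPlane d k)] :
    IsChart 0 (FlatPlane.toGr : FlatPlane d k → Gr d k) flatOfGr FlatPlane.move where
  separated := countablySeparated_of_carrier (fun π : FlatPlane d k => (π.carrier : Set (E d)))
    (fun π => π.carrier.closed_of_finiteDimensional)
    (fun π π' h => FlatPlane.ext (SetLike.coe_injective h))
    (fun U hU => measurableSet_flatPlane_hits hU)
  measurable_ofGr := measurable_flatOfGr
  left_inv π := FlatPlane.ext (AffineSubspace.ext fun y => by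
    rw [mem_flatOfGr (toGr_mem_hits π)]
    exact π.lift_mem_flatLift)
  mem_hits := toGr_mem_hits
  right_inv W hW := by
    refine Subtype.ext (eq_of_lift_mem_iff (x := (flatOfGr W).foot)
      ((flatOfGr W).lift_mem_flatLift.2 (flatOfGr W).foot_mem) fun y => ?_)
    rw [← mem_flatOfGr hW]
    exact (flatOfGr W).lift_mem_flatLift
  exists_move g := by
    obtain ⟨T, a, ha, h⟩ := exists_affineIsometry g
    exact ⟨T, toGr_move ha h⟩
  exists_iso T := by
    obtain ⟨g, hg⟩ := exists_isoGroup_zero T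
    exact ⟨g, toGr_move one_ne_zero hg⟩

end KPlane

end

noncomputable section

namespace KPlane

/-! ### The spaces of planes of the curved space forms -/

theorem mem_cone_sgn {ν : Curv} {d : ℕ} {ζ : E (d + 1)} :
    ζ ∈ cone d ν.sgn ↔ 0 < form ν ζ ζ := by
  rw [form, real_inner_self_eq_norm_sq, ← sq]
  rfl

theorem form_pos_of_mem_space {ν : Curv} {d : ℕ} {ζ : E (d + 1)} (h : ζ ∈ space ν d) :
    0 < form ν ζ ζ := by
  cases ν
  · exact (show form .plus ζ ζ = 1 from h) ▸ one_pos
  · exact h.1 ▸ one_pos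

theorem lastCoord_ne_zero_of_form_minus {d : ℕ} {ζ : E (d + 1)} (h : 0 < form .minus ζ ζ) :
    lastCoord ζ ≠ 0 := by
  intro h0
  have := real_inner_self_nonneg (x := fstPart ζ)
  simp only [form, Curv.sgn, h0] at h
  linarith

/-- The points of the space form on the line through a point of the cone. -/
def normalize (ν : Curv) {d : ℕ} (ζ : E (d + 1)) : E (d + 1) :=
  match ν with
  | .plus => radial .plus ζ
  | .minus => (lastCoord ζ / |lastCoord ζ|) • radial .minus ζ

theorem exists_normalize_eq {ν : Curv} {d : ℕ} {ζ : E (d + 1)} (h : 0 < form ν ζ ζ) :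
    ∃ c : ℝ, c ≠ 0 ∧ normalize ν ζ = c • ζ := by
  have h1 : (√(form ν ζ ζ))⁻¹ ≠ 0 := inv_ne_zero (Real.sqrt_pos.2 h).ne'
  cases ν
  · exact ⟨_, h1, rfl⟩
  · have h0 := lastCoord_ne_zero_of_form_minus h
    exact ⟨lastCoord ζ / |lastCoord ζ| * (√(form .minus ζ ζ))⁻¹,
      mul_ne_zero (div_ne_zero h0 (abs_ne_zero.2 h0)) h1, by rw [normalize, radial, smul_smul]⟩

theorem normalize_mem_space {ν : Curv} {d : ℕ} {ζ : E (d + 1)} (h : 0 < form ν ζ ζ) :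
    normalize ν ζ ∈ space ν d := by
  cases ν
  · exact radial_mem_space_plus h
  · have h0 := lastCoord_ne_zero_of_form_minus h
    have h1 : 0 < (√(form .minus ζ ζ))⁻¹ := inv_pos.2 (Real.sqrt_pos.2 h)
    have h2 : lastCoord ζ / |lastCoord ζ| * (lastCoord ζ / |lastCoord ζ|) = 1 := by
      rw [div_mul_div_comm, abs_mul_abs_self, div_self (mul_ne_zero h0 h0)]
    refine ⟨?_, ?_⟩
    · rw [normalize, form_smul_left, form_smul_right, form_radial h, mul_one, h2]
    · rw [normalize, lastCoord_smul, radial, lastCoord_smul]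
      have h3 : lastCoord ζ / |lastCoord ζ| * ((√(form .minus ζ ζ))⁻¹ * lastCoord ζ) =
          (√(form .minus ζ ζ))⁻¹ * (lastCoord ζ ^ 2 / |lastCoord ζ|) := by ring
      rw [h3]
      have := abs_pos.2 h0
      positivity

theorem normalize_of_mem_space {ν : Curv} {d : ℕ} {ζ : E (d + 1)} (h : ζ ∈ space ν d) :
    normalize ν ζ = ζ := by
  cases ν
  · have h1 : form .plus ζ ζ = 1 := h
    simp [normalize, radial, h1]
  · have h1 : form .minus ζ ζ = 1 := h.1
    rw [normalize, abs_of_pos h.2, div_self h.2.ne']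
    simp [radial, h1]

theorem continuousOn_normalize (ν : Curv) {d : ℕ} :
    ContinuousOn (normalize ν : E (d + 1) → E (d + 1)) {ζ | 0 < form ν ζ ζ} := by
  have h1 : ∀ ν : Curv, ContinuousOn (radial ν : E (d + 1) → E (d + 1)) {ζ | 0 < form ν ζ ζ} :=
    fun ν => (((continuous_form ν).sqrt.continuousOn).inv₀
      fun ζ hζ => (Real.sqrt_pos.2 hζ).ne').smul continuousOn_id
  cases ν
  · exact h1 .plus
  · exact (continuous_lastCoord.continuousOn.div continuous_lastCoord.abs.continuousOn
      fun ζ hζ => abs_ne_zero.2 (lastCoord_ne_zero_of_form_minus hζ)).smul (h1 .minus)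

theorem isOpen_normalize_mem (ν : Curv) {d : ℕ} {U : Set (E (d + 1))} (hU : IsOpen U) :
    IsOpen {ζ : E (d + 1) | 0 < form ν ζ ζ ∧ normalize ν ζ ∈ U} :=
  (continuousOn_normalize ν).isOpen_inter_preimage
    (isOpen_lt continuous_const (continuous_form ν)) hU

theorem normalize_mem {ν : Curv} {d : ℕ} {W : Submodule ℝ (E (d + 1))} {ζ : E (d + 1)}
    (h : 0 < form ν ζ ζ) (hζ : ζ ∈ W) : normalize ν ζ ∈ W := by
  obtain ⟨c, -, hc⟩ := exists_normalize_eq h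
  rw [hc]
  exact W.smul_mem c hζ

/-- Seen inside `W`, the span contains a nonempty open set, and a subspace with nonempty interior is
everything. -/
theorem span_eq_of_isOpen {n : ℕ} {W : Submodule ℝ (E n)} {U S : Set (E n)} (hU : IsOpen U)
    (hWU : ((W : Set (E n)) ∩ U).Nonempty) (hS : S ⊆ W)
    (h : ∀ ζ ∈ W, ζ ∈ U → ζ ∈ Submodule.span ℝ S) : Submodule.span ℝ S = W := by
  refine le_antisymm (Submodule.span_le.2 hS) ?_
  have h1 : (Submodule.span ℝ S).comap W.subtype = ⊤ := by
    refine Submodule.eq_top_of_nonempty_interior' _ ?_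
    obtain ⟨ζ, h2, h3⟩ := hWU
    refine ⟨⟨ζ, h2⟩, mem_interior.2 ⟨W.subtype ⁻¹' U, fun w hw => h w w.2 hw,
      hU.preimage continuous_subtype_val, h3⟩⟩
  intro ζ hζ
  have : (⟨ζ, hζ⟩ : W) ∈ (Submodule.span ℝ S).comap W.subtype := by rw [h1]; trivial
  exact this

/-- The vectors of `W` on which the form is positive are an open set and are multiples of points of
the section. So a plane determines the subspace that cuts it out. -/
theorem span_inter_space {ν : Curv} {d : ℕ} {W : Submodule ℝ (E (d + 1))}
    (h : ((W : Set (E (d + 1))) ∩ space ν d).Nonempty) :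
    Submodule.span ℝ ((W : Set (E (d + 1))) ∩ space ν d) = W := by
  obtain ⟨ζ, h1, h2⟩ := h
  refine span_eq_of_isOpen (isOpen_lt continuous_const (continuous_form ν))
    ⟨ζ, h1, form_pos_of_mem_space h2⟩ Set.inter_subset_left fun η hη hηU => ?_
  obtain ⟨c, hc, hcη⟩ := exists_normalize_eq hηU
  have h3 : normalize ν η ∈ Submodule.span ℝ ((W : Set (E (d + 1))) ∩ space ν d) :=
    Submodule.subset_span ⟨normalize_mem hηU hη, normalize_mem_space hηU⟩
  rw [hcη] at h3
  exact (Submodule.smul_mem_iff _ hc).1 h3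

namespace Plane

variable {ν : Curv} {d k : ℕ}

theorem ext {π π' : Plane ν d k} (h : π.carrier = π'.carrier) : π = π' := by
  cases π; cases π'; cases h; rfl

theorem carrier_eq (π : Plane ν d k) :
    π.carrier = (Submodule.span ℝ π.carrier : Set (E (d + 1))) ∩ space ν d := by
  obtain ⟨W, -, h⟩ := π.exists_section
  have h1 : Submodule.span ℝ π.carrier = W := by
    rw [h]
    exact span_inter_space (h ▸ π.nonempty)
  rw [h1, ← h]

theorem finrank_span (π : Plane ν d k) : Module.finrank ℝ (Submodule.span ℝ π.carrier) = k + 1 := by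
  obtain ⟨W, hW, h⟩ := π.exists_section
  rw [h, span_inter_space (h ▸ π.nonempty), hW]

/-- The linear span of a plane, as a point of the Grassmannian. -/
def toGr (π : Plane ν d k) : Gr d k := ⟨Submodule.span ℝ π.carrier, π.finrank_span⟩

theorem toGr_mem_hits (π : Plane ν d k) : π.toGr ∈ hits k (cone d ν.sgn) := by
  obtain ⟨ζ, hζ⟩ := π.nonempty
  refine ⟨ζ, Submodule.subset_span hζ, mem_cone_sgn.2 (form_pos_of_mem_space (ν := ν) ?_)⟩
  rw [π.carrier_eq] at hζ
  exact hζ.2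

theorem isClosed_carrier (π : Plane ν d k) : IsClosed π.carrier := by
  rw [π.carrier_eq]
  refine (Submodule.closed_of_finiteDimensional _).inter ?_
  cases ν
  · exact isClosed_eq (continuous_form .plus) continuous_const
  · have : space .minus d = {ζ | form .minus ζ ζ = 1} ∩ {ζ | 0 ≤ lastCoord ζ} := by
      ext ζ
      refine and_congr_right fun h => ⟨fun h0 => le_of_lt h0, fun h0 => ?_⟩
      exact lt_of_le_of_ne h0 (lastCoord_ne_zero_of_form_minus
        ((show form .minus ζ ζ = 1 from h) ▸ one_pos)).symm
    rw [this]
    exact (isClosed_eq (continuous_form .minus) continuous_const).inter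
      (isClosed_le continuous_const continuous_lastCoord)

end Plane

theorem inter_space_nonempty {ν : Curv} {d k : ℕ} {W : Gr d k} (h : W ∈ hits k (cone d ν.sgn)) :
    ((W.1 : Set (E (d + 1))) ∩ space ν d).Nonempty := by
  obtain ⟨ζ, h1, h2⟩ := h
  have h3 := mem_cone_sgn.1 h2
  exact ⟨normalize ν ζ, normalize_mem h3 h1, normalize_mem_space h3⟩

open Classical in
/-- The plane with a given linear span, if there is one. -/
def planeOfGr (ν : Curv) {d k : ℕ} [Nonempty (Plane ν d k)] (W : Gr d k) : Plane ν d k :=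
  if h : W ∈ hits k (cone d ν.sgn) then
    ⟨(W.1 : Set (E (d + 1))) ∩ space ν d, inter_space_nonempty h, W.1, W.2, rfl⟩
  else Classical.arbitrary _

theorem carrier_planeOfGr {ν : Curv} {d k : ℕ} [Nonempty (Plane ν d k)] {W : Gr d k}
    (h : W ∈ hits k (cone d ν.sgn)) :
    (planeOfGr ν W).carrier = (W.1 : Set (E (d + 1))) ∩ space ν d := by
  rw [planeOfGr, dif_pos h]

theorem measurableSet_plane_hits {ν : Curv} {d k : ℕ} {U : Set (E (d + 1))} (hU : IsOpen U) :
    MeasurableSet {π : Plane ν d k | (π.carrier ∩ U).Nonempty} :=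
  MeasurableSpace.measurableSet_generateFrom ⟨U, hU, rfl⟩

theorem measurable_planeOfGr (ν : Curv) {d k : ℕ} [Nonempty (Plane ν d k)] :
    Measurable (planeOfGr ν : Gr d k → Plane ν d k) := by
  refine measurable_generateFrom ?_
  rintro _ ⟨U, hU, rfl⟩
  have h : planeOfGr ν ⁻¹' {π : Plane ν d k | (π.carrier ∩ U).Nonempty} =
      hits k {ζ : E (d + 1) | 0 < form ν ζ ζ ∧ normalize ν ζ ∈ U} ∪ ((hits k (cone d ν.sgn))ᶜ ∩
        {_W | ((Classical.arbitrary (Plane ν d k)).carrier ∩ U).Nonempty}) := by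
    ext W
    by_cases hW : W ∈ hits k (cone d ν.sgn)
    · simp only [Set.mem_preimage, Set.mem_union, Set.mem_inter_iff, Set.mem_compl_iff, hW,
        not_true, false_and, or_false, Set.mem_ofPred_eq, carrier_planeOfGr hW]
      constructor
      · rintro ⟨y, ⟨hy, hys⟩, hyU⟩
        exact ⟨y, hy, form_pos_of_mem_space hys, by rwa [normalize_of_mem_space hys]⟩
      · rintro ⟨ζ, h1, h2, h3⟩
        exact ⟨normalize ν ζ, ⟨normalize_mem h2 h1, normalize_mem_space h2⟩, h3⟩
    · have h1 : W ∉ hits k {ζ : E (d + 1) | 0 < form ν ζ ζ ∧ normalize ν ζ ∈ U} := by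
        rintro ⟨ζ, h1, h2, -⟩
        exact hW ⟨ζ, h1, mem_cone_sgn.2 h2⟩
      have h2 : planeOfGr ν W = Classical.arbitrary (Plane ν d k) := by
        rw [planeOfGr, dif_neg hW]
      simp only [Set.mem_preimage, Set.mem_union, Set.mem_inter_iff, Set.mem_compl_iff, hW, h1, h2,
        not_false_eq_true, true_and, false_or, Set.mem_ofPred_eq]
  rw [h]
  exact (measurableSet_hits (isOpen_normalize_mem ν hU)).union
    ((measurableSet_hits (isOpen_cone d ν.sgn)).compl.inter (MeasurableSet.const _))

/-- A nonzero scalar does not change the image of a subspace, so the sign needed to preserve the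
upper sheet disappears on the Grassmannian. -/
theorem toGr_move_eq {ν : Curv} {d k : ℕ} {T : Isom ν d} {g : GL (Fin (d + 1)) ℝ} {ε : ℝ}
    (hε : ε ≠ 0) (h : ∀ ζ, T.toEquiv ζ = ε • mv g.val ζ) (π : Plane ν d k) :
    (π.move T).toGr = act g π.toGr := by
  have h1 : Submodule.span ℝ (T.toEquiv '' π.carrier) =
      (Submodule.span ℝ π.carrier).map (T.toEquiv : E (d + 1) →ₗ[ℝ] E (d + 1)) :=
    Submodule.span_image _
  refine Subtype.ext ?_
  change Submodule.span ℝ (T.toEquiv '' π.carrier) = (Submodule.span ℝ π.carrier).map (mv g.val)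
  have h2 : (T.toEquiv : E (d + 1) →ₗ[ℝ] E (d + 1)) = ε • mv g.val := LinearMap.ext h
  rw [h1, h2, Submodule.map_smul _ _ _ hε]

theorem isChart_plane (ν : Curv) {d k : ℕ} [Nonempty (Plane ν d k)] :
    IsChart ν.sgn (Plane.toGr : Plane ν d k → Gr d k) (planeOfGr ν) Plane.move where
  separated := countablySeparated_of_carrier (fun π : Plane ν d k => π.carrier)
    (fun π => π.isClosed_carrier) (fun π π' h => Plane.ext h)
    (fun U hU => measurableSet_plane_hits hU)
  measurable_ofGr := measurable_planeOfGr ν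
  left_inv π := Plane.ext (by
    rw [carrier_planeOfGr π.toGr_mem_hits]
    exact π.carrier_eq.symm)
  mem_hits π := π.toGr_mem_hits
  right_inv W hW := Subtype.ext (by
    change Submodule.span ℝ (planeOfGr ν W).carrier = W.1
    rw [carrier_planeOfGr hW, span_inter_space (inter_space_nonempty hW)])
  exists_move g := by
    obtain ⟨T, ε, hε, -, h⟩ := exists_isom_eq ν g
    have hε0 : ε ≠ 0 := by rcases hε with rfl | rfl <;> norm_num
    exact ⟨T, toGr_move_eq hε0 h⟩
  exists_iso T := by
    obtain ⟨g, hg⟩ := exists_isoGroup_eq T.toEquiv T.form_map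
    exact ⟨g, toGr_move_eq one_ne_zero fun ζ => by rw [hg, one_smul]⟩

theorem nonempty_plane (ν : Curv) {d k : ℕ} (hk : k ≤ d) : Nonempty (Plane ν d k) := by
  obtain ⟨π⟩ := nonempty_flatPlane hk
  refine ⟨⟨(flatSpan 0 π.carrier.direction : Set (E (d + 1))) ∩ space ν d,
    ⟨lift 0, lift_mem_flatSpan.2 ?_, lift_zero_mem_space ν d⟩, _, ?_, rfl⟩⟩
  · rw [sub_self]
    exact Submodule.zero_mem _
  · rw [finrank_flatSpan, π.finrank_direction]

end KPlane

end

noncomputable section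

namespace KPlane

/-! ### Comparison of the transforms -/

theorem isCurv_sgn (ν : Curv) : IsCurv ν.sgn := by
  cases ν
  · exact Or.inl rfl
  · exact Or.inr (Or.inr rfl)

section Transfer

variable {d k m : ℕ} [Nonempty (Gr d k)]

/-- The null sets of the measure on the subspaces that meet the sphere are null sets of the flat
measure. -/
theorem ae_grMeasure_zero_of_ae_one (hm : m + k = d) {P : Gr d k → Prop}
    (h : ∀ᵐ W ∂grMeasure d k m 1, P W) :
    ∀ᵐ W ∂grMeasure d k m 0, P W := by
  obtain ⟨c, hc0, -, hc⟩ := exists_lintegral_grMeasure_eq (k := k) hm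
  set N := toMeasurable (grMeasure d k m 1) {W | ¬ P W} with hN
  have hNm : MeasurableSet N := measurableSet_toMeasurable _ _
  have hN0 : grMeasure d k m 1 N = 0 := by
    rw [hN, measure_toMeasurable]
    exact h
  have h1 := hc 1 (Or.inl rfl) (N.indicator 1) (measurable_one.indicator hNm)
  have h2 : ∫⁻ W in hits k (cone d 0), N.indicator 1 W ∂grMeasure d k m 1 = 0 := by
    rw [lintegral_indicator_one hNm]
    exact le_antisymm (le_trans (Measure.restrict_apply_le _ _) hN0.le) zero_le
  have h3 : hits k (cone d 1) = Set.univ := Set.eq_univ_of_forall fun W => mem_hits_cone_one W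
  rw [h2, h3, Measure.restrict_univ, mul_eq_zero, or_iff_right hc0] at h1
  have h4 : Measurable fun W : Gr d k => N.indicator 1 W * (weight 1 W.1 ^ (d + 1))⁻¹ :=
    (measurable_one.indicator hNm).mul ((measurable_weight 1).pow_const _).inv
  filter_upwards [(lintegral_eq_zero_iff h4).1 h1] with W hW
  by_contra hP
  have h5 : W ∈ N := subset_toMeasurable _ _ hP
  simp only [Set.indicator_of_mem h5, Pi.one_apply, one_mul, Pi.zero_apply,
    ENNReal.inv_eq_zero] at hW
  exact ENNReal.pow_ne_top ENNReal.ofReal_ne_top hW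

/-- The null sets of the flat measure are null sets of the other invariant measures. -/
theorem ae_grMeasure_of_ae_zero (hm : m + k = d) {κ : ℝ} (hκ : IsCurv κ) {P : Gr d k → Prop}
    (h : ∀ᵐ W ∂grMeasure d k m 0, P W) :
    ∀ᵐ W ∂grMeasure d k m κ, W ∈ hits k (cone d 0) → P W := by
  obtain ⟨c, -, -, hc⟩ := exists_lintegral_grMeasure_eq (k := k) hm
  have hS : MeasurableSet (hits k (cone d 0)) := measurableSet_hits (isOpen_cone d 0)
  rw [← ae_restrict_iff' hS]
  set N := toMeasurable (grMeasure d k m 0) {W | ¬ P W} with hN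
  have hNm : MeasurableSet N := measurableSet_toMeasurable _ _
  have hN0 : grMeasure d k m 0 N = 0 := by
    rw [hN, measure_toMeasurable]
    exact h
  have h1 := hc κ hκ (N.indicator 1) (measurable_one.indicator hNm)
  have h2 : ∫⁻ W in hits k (cone d κ), N.indicator 1 W * (weight κ W.1 ^ (d + 1))⁻¹
      ∂grMeasure d k m 0 = 0 := by
    refine lintegral_eq_zero_of_ae_eq_zero (ae_restrict_of_ae ?_)
    have h3 : ∀ᵐ W ∂grMeasure d k m 0, W ∉ N := measure_eq_zero_iff_ae_notMem.1 hN0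
    filter_upwards [h3] with W hW
    simp [hW]
  rw [h2, mul_zero, lintegral_indicator_one hNm] at h1
  refine measure_mono_null ?_ h1.symm
  exact subset_toMeasurable _ _

end Transfer

theorem one_add_mul_norm_pos {κ : ℝ} {d : ℕ} {ζ : E (d + 1)} (h : ζ ∈ cone d κ)
    (h0 : lastCoord ζ ≠ 0) : 0 < 1 + κ * ‖proj ζ‖ ^ 2 := by
  have h1 : lastCoord ζ ^ 2 + κ * ‖fstPart ζ‖ ^ 2 = lastCoord ζ ^ 2 * (1 + κ * ‖proj ζ‖ ^ 2) := by
    rw [proj, norm_neg, norm_smul, mul_pow, norm_inv, inv_pow, Real.norm_eq_abs, sq_abs]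
    field_simp
  have h2 : 0 < lastCoord ζ ^ 2 + κ * ‖fstPart ζ‖ ^ 2 := h
  rw [h1] at h2
  exact (mul_pos_iff_of_pos_left (by positivity)).1 h2

theorem lift_proj_mem {d : ℕ} {W : Submodule ℝ (E (d + 1))} {ζ : E (d + 1)} (h : ζ ∈ W)
    (h0 : lastCoord ζ ≠ 0) : lift (proj ζ) ∈ W := by
  rw [eq_smul_lift_proj h0] at h
  exact (Submodule.smul_mem_iff _ h0).1 h

theorem one_add_mul_rho_pos {ν : Curv} {d k : ℕ} {W : Gr d k} (h : W ∈ hits k (cone d ν.sgn)) :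
    0 < 1 + ν.sgn * rho W.1 ^ 2 := by
  cases ν
  · simp only [Curv.sgn]
    positivity
  · obtain ⟨ζ, h1, h2⟩ := h
    have h0 := lastCoord_ne_zero_of_form_minus (mem_cone_sgn.1 h2)
    have h3 := one_add_mul_norm_pos h2 h0
    have h4 : rho W.1 ≤ ‖proj ζ‖ := by
      have := Metric.infDist_le_dist_of_mem (x := (0 : E d))
        (show proj ζ ∈ {x : E d | lift x ∈ W.1} from lift_proj_mem h1 h0)
      rwa [dist_zero_left] at this
    have h5 : 0 ≤ rho W.1 := Metric.infDist_nonneg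
    simp only [Curv.sgn] at h3 ⊢
    nlinarith

theorem lift_mem_cone {ν : Curv} {d : ℕ} {x : E d} (h : x ∈ region ν d) :
    lift x ∈ cone d ν.sgn := by
  have h1 : 0 < 1 + ν.sgn * ‖x‖ ^ 2 := h
  simpa [cone] using h1

theorem ae_mem_hits_cone_zero_of_curv {d k m : ℕ} [Nonempty (Gr d k)] (hm : m + k = d) (hd : 0 < d)
    (ν : Curv) : ∀ᵐ W ∂grMeasure d k m ν.sgn, W ∈ hits k (cone d 0) := by
  cases ν
  · exact ae_mem_hits_cone_zero hm hd
  · filter_upwards [ae_grMeasure_hits hm (isCurv_sgn .minus)] with W hW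
    obtain ⟨ζ, h1, h2⟩ := hW
    exact ⟨ζ, h1, mem_cone_zero.2 (lastCoord_ne_zero_of_form_minus (mem_cone_sgn.1 h2))⟩

section FlatOfGr

variable {d k : ℕ}

theorem flatLift_flatOfGr [Nonempty (FlatPlane d k)] {W : Gr d k} (hW : W ∈ hits k (cone d 0)) :
    flatLift (flatOfGr W) = W.1 := congrArg Subtype.val (isChart_flat.right_inv W hW)

/-- The weighted pullback of `f` has, on almost all planes, the same properties as that of its Borel
representative `g`. -/
theorem ae_flat_good {m : ℕ} [Nonempty (FlatPlane d k)] [Nonempty (Gr d k)] (hm : m + k = d) (hd : 0 < d) {p : ℝ≥0∞}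
    (hp : p = ((d : ℝ≥0∞) + 1) / ((k : ℝ≥0∞) + 1)) {f g : E d → ℝ} (hg : MemLp g p volume)
    (hgm : Measurable g) (hfg : f =ᵐ[volume] g) :
    ∀ᵐ W ∂grMeasure d k m 0, Integrable g (flatOfGr W).measure ∧
      f =ᵐ[(flatOfGr W).measure] g := by
  -- The claim is proved for the spherical measure on the Grassmannian and transferred, since the
  -- flat measure has a density with respect to it.
  refine ae_grMeasure_zero_of_ae_one hm ?_
  have hp1 : 1 ≤ p := by
    rw [hp, ENNReal.le_div_iff_mul_le (by simp) (by simp), one_mul]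
    gcongr
    exact_mod_cast (show k ≤ d by omega)
  have hpint : Integrable (pull .plus k g) (spaceMeasure .plus d) := by
    have h1 := (memLp_pull_and_eLpNorm_eq .plus hp hg (by simp [region_plus])).1
    have : IsFiniteMeasure (Curv.plus.mult⁻¹ • spaceMeasure .plus d) :=
      Measure.smul_finite _ (ENNReal.inv_ne_top.2 (Curv.mult_ne_zero _))
    have h2 := h1.integrable hp1
    rwa [integrable_smul_measure (ENNReal.inv_ne_zero.2 (Curv.mult_ne_top _))
      (ENNReal.inv_ne_top.2 (Curv.mult_ne_zero _))] at h2
  set N := toMeasurable volume {x | f x ≠ g x} with hN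
  have hNm : MeasurableSet N := measurableSet_toMeasurable _ _
  have hN0 : volume N = 0 := by
    rw [hN, measure_toMeasurable]
    exact hfg
  have hind : Measurable (N.indicator (1 : E d → ℝ)) := measurable_one.indicator hNm
  have hind0 : N.indicator (1 : E d → ℝ) =ᵐ[volume] 0 := by
    filter_upwards [measure_eq_zero_iff_ae_notMem.1 hN0] with x hx
    simp [hx]
  -- The exceptional set lifts to a null set of the sphere, hence of almost every spherical section;
  -- projecting back shows that it is null in almost every affine plane.
  have hpull : ∀ᵐ ζ ∂spaceMeasure .plus d, pull .plus k (N.indicator 1) ζ = pull .plus k 0 ζ :=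
    (isWeightedImage_spaceMeasure .plus d).ae_pull_eq k (ae_restrict_of_ae hind0)
  filter_upwards [ae_integrable_sectionMeasure hm (measurable_pull .plus k hgm) hpint,
    ae_ae_sectionMeasure hm hpull, ae_mem_hits_cone_zero hm hd] with W h1 h2 h3
  rw [← flatLift_flatOfGr h3] at h1 h2
  have H := isWeightedImage_flatLift .plus (flatOfGr W)
  have hC0 := weightFactor_plus_ne_zero (rho (flatLift (flatOfGr W)))
  have hCt : Curv.plus.mult * ENNReal.ofReal √|1 + Curv.plus.sgn * rho (flatLift (flatOfGr W)) ^ 2|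
      ≠ ∞ := ENNReal.mul_ne_top (Curv.mult_ne_top _) ENNReal.ofReal_ne_top
  rw [H.integrable_pull_iff hgm, integrable_smul_measure hC0 hCt, region_plus,
    Measure.restrict_univ] at h1
  refine ⟨h1, ?_⟩
  have h4 := H (N.indicator 1) (measurable_one.indicator hNm)
  rw [lintegral_indicator_one hNm, region_plus, Measure.restrict_univ] at h4
  have h5 : ∫⁻ ζ, ENNReal.ofReal (bracket .plus (proj ζ)) ^ (k + 1) * N.indicator 1 (proj ζ)
      ∂sectionMeasure .plus (flatLift (flatOfGr W)) = 0 := by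
    refine lintegral_eq_zero_of_ae_eq_zero ?_
    filter_upwards [h2] with ζ hζ
    by_cases hζN : proj ζ ∈ N
    · simp only [pull, Set.indicator_of_mem hζN, Pi.one_apply, mul_one, Pi.zero_apply,
        mul_zero] at hζ
      have h6 := eq_zero_of_pow_eq_zero hζ
      simp [h6]
    · simp [hζN]
  rw [h5, zero_eq_mul, or_iff_right hC0] at h4
  exact measure_mono_null (subset_toMeasurable _ _) h4

/-- The flat transform of a Borel function, as a function on the Grassmannian. -/
def grTransform (f : E d → ℝ) (W : Gr d k) : ℝ :=
  (2 * √(1 + rho W.1 ^ 2))⁻¹ * ∫ ζ, pull .plus k f ζ ∂sectionMeasure .plus W.1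

/-- The detour through the sphere in `grTransform` serves this purpose: spherical sections have
finite measures that depend measurably on the subspace. -/
theorem measurable_grTransform {m : ℕ} (hm : m + k = d) {f : E d → ℝ} (hf : Measurable f) :
    Measurable (grTransform f : Gr d k → ℝ) :=
  ((measurable_const.mul ((measurable_const.add (measurable_rho.pow_const 2)).sqrt)).inv).mul
    (measurable_integral_sectionMeasure hm (measurable_pull .plus k hf))

/-- The prefactor `(2 √(1 + ρ²))⁻¹` undoes the multiplicity and the Jacobian of the projection from
the sphere. -/
theorem flatTransform_eq {f : E d → ℝ} (hf : Measurable f) (π : FlatPlane d k) :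
    flatTransform f π = grTransform f π.toGr := by
  have h1 := (isWeightedImage_flatLift .plus π).integral_pull hf
  have h2 : (Curv.plus.mult * ENNReal.ofReal √|1 + Curv.plus.sgn * rho (flatLift π) ^ 2|).toReal =
      2 * √(1 + rho (flatLift π) ^ 2) := by
    have h3 : (0 : ℝ) ≤ 1 + rho (flatLift π) ^ 2 := by positivity
    rw [ENNReal.toReal_mul, ENNReal.toReal_ofReal (Real.sqrt_nonneg _)]
    simp [Curv.mult, Curv.sgn, abs_of_nonneg h3]
  have h3 : 2 * √(1 + rho (flatLift π) ^ 2) ≠ 0 := by positivity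
  rw [h2, region_plus, Measure.restrict_univ] at h1
  change _ = (2 * √(1 + rho (flatLift π) ^ 2))⁻¹ * ∫ ζ, pull .plus k f ζ
    ∂sectionMeasure .plus (flatLift π)
  rw [h1, ← mul_assoc, inv_mul_cancel₀ h3, one_mul]
  rfl

theorem grTransform_eq [Nonempty (FlatPlane d k)] {f : E d → ℝ} (hf : Measurable f) {W : Gr d k}
    (hW : W ∈ hits k (cone d 0)) : grTransform f W = ∫ x, f x ∂(flatOfGr W).measure := by
  rw [← isChart_flat.right_inv W hW, ← flatTransform_eq hf, isChart_flat.right_inv W hW]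
  rfl

theorem FlatPlane.ae_mem (π : FlatPlane d k) : ∀ᵐ x ∂π.measure, x ∈ π.carrier := by
  have h : Measurable fun v : π.carrier.direction => π.foot + (v : E d) :=
    measurable_const.add measurable_subtype_coe
  rw [π.measure_eq]
  refine (ae_map_iff h.aemeasurable π.carrier.closed_of_finiteDimensional.measurableSet).2
    (Filter.Eventually.of_forall fun v => π.mem_iff.2 ?_)
  rw [add_sub_cancel_left]
  exact v.2

theorem grTransform_eq_zero [Nonempty (FlatPlane d k)] {ν : Curv} {f : E d → ℝ} (hf : Measurable f)
    (h0 : ∀ x, x ∉ region ν d → f x = 0) {W : Gr d k} (hW : W ∈ hits k (cone d 0))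
    (hW' : W ∉ hits k (cone d ν.sgn)) : grTransform f W = 0 := by
  rw [grTransform_eq hf hW]
  refine integral_eq_zero_of_ae ?_
  filter_upwards [(flatOfGr W).ae_mem] with x hx
  exact h0 x fun hxr => hW' ⟨lift x, (mem_flatOfGr hW).1 hx, lift_mem_cone hxr⟩

/-- Spherical or hyperbolic, the section projects to the affine plane with the same span. The
restriction to the region covered by the projection is void because `f` vanishes outside. -/
theorem transform_eq [Nonempty (FlatPlane d k)] {ν : Curv} {f : E d → ℝ} (hf : Measurable f)
    (h0 : ∀ x, x ∉ region ν d → f x = 0) (π : Plane ν d k) (hπ : π.toGr ∈ hits k (cone d 0)) :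
    transform (pull ν k f) π =
      ν.mult.toReal * √|1 + ν.sgn * rho π.toGr.1 ^ 2| * grTransform f π.toGr := by
  have h1 := (isWeightedImage_flatLift ν (flatOfGr π.toGr)).integral_pull hf
  rw [flatLift_flatOfGr hπ] at h1
  rw [grTransform_eq hf hπ]
  refine h1.trans ?_
  rw [ENNReal.toReal_mul, ENNReal.toReal_ofReal (Real.sqrt_nonneg _),
    setIntegral_eq_integral_of_forall_compl_eq_zero h0]

end FlatOfGr

end KPlane

end

/-! ### The `L^q` norms -/

noncomputable section

namespace KPlane

theorem exists_measurable_rep {ν : Curv} {d : ℕ} {p : ℝ≥0∞} {f : E d → ℝ} (hf : MemLp f p volume)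
    (h0 : ∀ᵐ x, x ∉ region ν d → f x = 0) :
    ∃ g : E d → ℝ, Measurable g ∧ f =ᵐ[volume] g ∧ ∀ x, x ∉ region ν d → g x = 0 := by
  refine ⟨(region ν d).indicator (hf.1.mk f),
    hf.1.stronglyMeasurable_mk.measurable.indicator (measurableSet_region ν d), ?_,
    fun x hx => Set.indicator_of_notMem hx _⟩
  filter_upwards [h0, hf.1.ae_eq_mk] with x h1 h2
  by_cases hx : x ∈ region ν d
  · rw [Set.indicator_of_mem hx, h2]
  · rw [Set.indicator_of_notMem hx, h1 hx]

/-- The power `d + 1` of the factor `√(1 + κρ²)` from the planes cancels the density `weight ^ (-(d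
+ 1))` between the invariant measures. This cancellation forces `q = d + 1`. -/
theorem lintegral_grTransform {ν : Curv} {d k m : ℕ} [Nonempty (FlatPlane d k)]
    [Nonempty (Gr d k)] (hm : m + k = d) (hd : 0 < d) {c : ℝ≥0∞}
    (hc : ∀ φ : Gr d k → ℝ≥0∞, Measurable φ →
      c * ∫⁻ W in hits k (cone d ν.sgn), φ W * (weight ν.sgn W.1 ^ (d + 1))⁻¹ ∂grMeasure d k m 0 =
        ∫⁻ W in hits k (cone d 0), φ W ∂grMeasure d k m ν.sgn)
    {g : E d → ℝ} (hgm : Measurable g) (hg0 : ∀ x, x ∉ region ν d → g x = 0) :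
    ∫⁻ W : Gr d k, ‖ν.mult.toReal * √|1 + ν.sgn * rho W.1 ^ 2| * grTransform g W‖ₑ ^ (d + 1)
      ∂grMeasure d k m ν.sgn =
      c * ν.mult ^ (d + 1) * ∫⁻ W : Gr d k, ‖grTransform g W‖ₑ ^ (d + 1) ∂grMeasure d k m 0 := by
  have hS : MeasurableSet (hits k (cone d 0)) := measurableSet_hits (isOpen_cone d 0)
  have hSκ : MeasurableSet (hits k (cone d ν.sgn)) := measurableSet_hits (isOpen_cone d ν.sgn)
  have hΦ : Measurable (grTransform g : Gr d k → ℝ) := measurable_grTransform hm hgm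
  have hw : Measurable fun W : Gr d k => √|1 + ν.sgn * rho W.1 ^ 2| :=
    (continuous_abs.measurable.comp
      (measurable_const.add (measurable_const.mul (measurable_rho.pow_const 2)))).sqrt
  have hφ : Measurable fun W : Gr d k =>
      ‖ν.mult.toReal * √|1 + ν.sgn * rho W.1 ^ 2| * grTransform g W‖ₑ ^ (d + 1) :=
    (((measurable_const.mul hw).mul hΦ).enorm).pow_const _
  have h1 : (grMeasure d k m ν.sgn).restrict (hits k (cone d 0)) = grMeasure d k m ν.sgn :=
    Measure.restrict_eq_self_of_ae_mem (ae_mem_hits_cone_zero_of_curv hm hd ν)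
  have h2 : ∀ W ∈ hits k (cone d ν.sgn),
      ‖ν.mult.toReal * √|1 + ν.sgn * rho W.1 ^ 2| * grTransform g W‖ₑ ^ (d + 1) *
        (weight ν.sgn W.1 ^ (d + 1))⁻¹ =
      ν.mult ^ (d + 1) * ‖grTransform g W‖ₑ ^ (d + 1) := by
    intro W hW
    have h3 := one_add_mul_rho_pos hW
    have h4 : weight ν.sgn W.1 ≠ 0 := by
      simpa [weight] using h3
    have h5 : weight ν.sgn W.1 ≠ ∞ := ENNReal.ofReal_ne_top
    have h6 : ‖ν.mult.toReal * √|1 + ν.sgn * rho W.1 ^ 2| * grTransform g W‖ₑ =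
        ν.mult * weight ν.sgn W.1 * ‖grTransform g W‖ₑ := by
      rw [enorm_mul, enorm_mul, Real.enorm_of_nonneg ENNReal.toReal_nonneg,
        Real.enorm_of_nonneg (Real.sqrt_nonneg _), ENNReal.ofReal_toReal ν.mult_ne_top,
        abs_of_pos h3, weight]
    rw [h6, mul_pow, mul_pow]
    have h7 : weight ν.sgn W.1 ^ (d + 1) * (weight ν.sgn W.1 ^ (d + 1))⁻¹ = 1 :=
      ENNReal.mul_inv_cancel (pow_ne_zero _ h4) (ENNReal.pow_ne_top h5)
    calc _ = ν.mult ^ (d + 1) * ‖grTransform g W‖ₑ ^ (d + 1) *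
          (weight ν.sgn W.1 ^ (d + 1) * (weight ν.sgn W.1 ^ (d + 1))⁻¹) := by ring
      _ = _ := by rw [h7, mul_one]
  -- Affine planes that miss the covered region, which exist in the hyperbolic case, contribute
  -- nothing because `g` vanishes on them.
  have h3 : ∫⁻ W in hits k (cone d ν.sgn), ‖grTransform g W‖ₑ ^ (d + 1) ∂grMeasure d k m 0 =
      ∫⁻ W : Gr d k, ‖grTransform g W‖ₑ ^ (d + 1) ∂grMeasure d k m 0 := by
    rw [← lintegral_indicator hSκ]
    refine lintegral_congr_ae ?_
    filter_upwards [ae_grMeasure_hits hm (Or.inr (Or.inl rfl))] with W hW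
    by_cases hW' : W ∈ hits k (cone d ν.sgn)
    · rw [Set.indicator_of_mem hW']
    · rw [Set.indicator_of_notMem hW', grTransform_eq_zero hgm hg0 hW hW']
      simp
  conv_lhs => rw [← h1]
  rw [← hc _ hφ, setLIntegral_congr_fun hSκ h2, lintegral_const_mul _ (hΦ.enorm.pow_const _), h3,
    mul_assoc]

/-- The weighted pullback relates the `L^q` norms of the transforms. -/
theorem exists_transform_norm_eq (ν : Curv) {d k : ℕ} (hkd : k < d) {p q : ℝ≥0∞}
    (hp : p = ((d : ℝ≥0∞) + 1) / ((k : ℝ≥0∞) + 1)) (hq : q = (d : ℝ≥0∞) + 1)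
    (μ₀ : Measure (FlatPlane d k)) (μ : Measure (Plane ν d k)) (hμ₀ : IsInvariantFlat μ₀)
    (hμ : IsInvariant μ) :
    ∃ c : ℝ≥0∞, c ≠ 0 ∧ c ≠ ∞ ∧ ∀ f : E d → ℝ, MemLp f p volume →
      (∀ᵐ x, x ∉ region ν d → f x = 0) →
      (∀ᵐ π ∂μ₀, Integrable f π.measure) ∧
      (∀ᵐ π ∂μ, Integrable (pull ν k f) π.measure) ∧
      AEStronglyMeasurable (flatTransform f) μ₀ ∧
      AEStronglyMeasurable (transform (pull ν k f)) μ ∧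
      eLpNorm (transform (pull ν k f)) q (c • μ) = eLpNorm (flatTransform f) q μ₀ := by
  have hm : (d - k) + k = d := by omega
  have hd : 0 < d := by omega
  have hF := nonempty_flatPlane hkd.le
  have hG := nonempty_Gr hkd.le
  have hP := nonempty_plane ν hkd.le
  have hκ := isCurv_sgn ν
  have hκ0 : IsCurv 0 := Or.inr (Or.inl rfl)
  obtain ⟨c₀, hc₀, hc₀t, hμ₀c⟩ := isChart_flat.exists_map_eq_smul hm hκ0 hμ₀.ne_zero
    hμ₀.sigmaFinite hμ₀.map_move
  obtain ⟨c₁, hc₁, hc₁t, hμc⟩ := (isChart_plane ν).exists_map_eq_smul hm hκ hμ.ne_zero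
    hμ.sigmaFinite hμ.map_move
  obtain ⟨c₂, hc₂, hc₂t, hrel⟩ := exists_lintegral_grMeasure_eq (k := k) hm
  have hι₀ : Measurable (FlatPlane.toGr : FlatPlane d k → Gr d k) :=
    isChart_flat.measurable_toGr hm hκ0
  have hι : Measurable (Plane.toGr : Plane ν d k → Gr d k) :=
    (isChart_plane ν).measurable_toGr hm hκ
  -- The constants `c₀` and `c₁` compare the given invariant measures with the reference measures on
  -- the Grassmannian, `c₂` compares the reference measures, and `mult ^ (d + 1)` is the effect of
  -- the two-to-one projection on the norm. None of them involves `f`.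
  set C := c₁ * (c₂ * ν.mult ^ (d + 1)) with hC
  have hC0 : C ≠ 0 := mul_ne_zero hc₁ (mul_ne_zero hc₂ (pow_ne_zero _ ν.mult_ne_zero))
  have hCt : C ≠ ∞ :=
    ENNReal.mul_ne_top hc₁t (ENNReal.mul_ne_top hc₂t (ENNReal.pow_ne_top ν.mult_ne_top))
  refine ⟨C⁻¹ * c₀, mul_ne_zero (ENNReal.inv_ne_zero.2 hCt) hc₀,
    ENNReal.mul_ne_top (ENNReal.inv_ne_top.2 hC0) hc₀t, fun f hf h0 => ?_⟩
  obtain ⟨g, hgm, hfg, hg0⟩ := exists_measurable_rep hf h0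
  have hgood := ae_flat_good hm hd hp (hf.ae_eq hfg) hgm hfg
  have hΦ : Measurable (grTransform g : Gr d k → ℝ) := measurable_grTransform hm hgm
  have hw : Measurable fun W : Gr d k =>
      ν.mult.toReal * √|1 + ν.sgn * rho W.1 ^ 2| * grTransform g W :=
    (measurable_const.mul (continuous_abs.measurable.comp
      (measurable_const.add (measurable_const.mul (measurable_rho.pow_const 2)))).sqrt).mul hΦ
  -- almost all affine planes
  have hae₀ : ∀ᵐ π ∂μ₀, Integrable g π.measure ∧ f =ᵐ[π.measure] g := by
    have h1 : ∀ᵐ W ∂μ₀.map FlatPlane.toGr, Integrable g (flatOfGr W).measure ∧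
        f =ᵐ[(flatOfGr W).measure] g := by
      rw [hμ₀c]
      exact Measure.ae_smul_measure hgood c₀
    filter_upwards [ae_of_ae_map hι₀.aemeasurable h1] with π hπ
    rwa [isChart_flat.left_inv π] at hπ
  have htr₀ : flatTransform f =ᵐ[μ₀] fun π => grTransform g π.toGr := by
    filter_upwards [hae₀] with π hπ
    rw [← flatTransform_eq hgm]
    exact integral_congr_ae hπ.2
  -- almost all planes of the space form
  have hae : ∀ᵐ π ∂μ, π.toGr ∈ hits k (cone d 0) ∧
      Integrable g (flatOfGr π.toGr).measure ∧ f =ᵐ[(flatOfGr π.toGr).measure] g := by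
    have h1 : ∀ᵐ W ∂μ.map Plane.toGr, W ∈ hits k (cone d 0) ∧
        Integrable g (flatOfGr W).measure ∧ f =ᵐ[(flatOfGr W).measure] g := by
      rw [hμc]
      refine Measure.ae_smul_measure ?_ c₁
      filter_upwards [ae_mem_hits_cone_zero_of_curv hm hd ν,
        ae_grMeasure_of_ae_zero hm hκ hgood] with W h2 h3
      exact ⟨h2, h3 h2⟩
    exact ae_of_ae_map hι.aemeasurable h1
  have hpull : ∀ᵐ π ∂μ, pull ν k f =ᵐ[π.measure] pull ν k g := by
    filter_upwards [hae] with π hπ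
    have H := isWeightedImage_flatLift ν (flatOfGr π.toGr)
    rw [flatLift_flatOfGr hπ.1] at H
    exact H.ae_pull_eq k (ae_restrict_of_ae hπ.2.2)
  have htr : transform (pull ν k f) =ᵐ[μ] fun π =>
      ν.mult.toReal * √|1 + ν.sgn * rho π.toGr.1 ^ 2| * grTransform g π.toGr := by
    filter_upwards [hae, hpull] with π h1 h2
    rw [← transform_eq hgm hg0 π h1.1]
    exact integral_congr_ae h2
  refine ⟨?_, ?_, ?_, ?_, ?_⟩
  · filter_upwards [hae₀] with π hπ
    exact hπ.1.congr hπ.2.symm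
  · filter_upwards [hae, hpull] with π h1 h2
    have H := isWeightedImage_flatLift ν (flatOfGr π.toGr)
    rw [flatLift_flatOfGr h1.1] at H
    refine Integrable.congr ((H.integrable_pull_iff hgm).2 ?_) h2.symm
    exact (h1.2.1.mono_measure Measure.restrict_le_self).smul_measure
      (ENNReal.mul_ne_top ν.mult_ne_top ENNReal.ofReal_ne_top)
  · exact (hΦ.comp hι₀).aestronglyMeasurable.congr htr₀.symm
  · exact (hw.comp hι).aestronglyMeasurable.congr htr.symm
  · have hq0 : q ≠ 0 := by rw [hq]; simp
    have hqt : q ≠ ∞ := by rw [hq]; simp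
    have hqr : q.toReal = ((d + 1 : ℕ) : ℝ) := by
      rw [hq, ENNReal.toReal_add (by simp) (by simp)]
      simp
    have h1 : ∫⁻ π, ‖flatTransform f π‖ₑ ^ (d + 1) ∂μ₀ =
        c₀ * ∫⁻ W : Gr d k, ‖grTransform g W‖ₑ ^ (d + 1) ∂grMeasure d k (d - k) 0 := by
      rw [← smul_eq_mul, ← lintegral_smul_measure, ← hμ₀c,
        lintegral_map (hΦ.enorm.pow_const _) hι₀]
      refine lintegral_congr_ae (htr₀.mono fun π hπ => ?_)
      simp only [hπ]
    have h2 : ∫⁻ π, ‖transform (pull ν k f) π‖ₑ ^ (d + 1) ∂μ =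
        C * ∫⁻ W : Gr d k, ‖grTransform g W‖ₑ ^ (d + 1) ∂grMeasure d k (d - k) 0 := by
      rw [hC, mul_assoc, ← lintegral_grTransform hm hd (hrel ν.sgn hκ) hgm hg0, ← smul_eq_mul,
        ← lintegral_smul_measure, ← hμc, lintegral_map (hw.enorm.pow_const _) hι]
      refine lintegral_congr_ae (htr.mono fun π hπ => ?_)
      simp only [hπ]
    rw [eLpNorm_eq_lintegral_rpow_enorm_toReal hq0 hqt,
      eLpNorm_eq_lintegral_rpow_enorm_toReal hq0 hqt, hqr]
    simp only [ENNReal.rpow_natCast]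
    rw [lintegral_smul_measure, smul_eq_mul, h1, h2]
    congr 1
    generalize ∫⁻ W : Gr d k, ‖grTransform g W‖ₑ ^ (d + 1) ∂grMeasure d k (d - k) 0 = I
    calc _ = c₀ * I * (C⁻¹ * C) := by ring
      _ = _ := by rw [ENNReal.inv_mul_cancel hC0 hCt, mul_one]

end KPlane

end

theorem proposition1 (d k : ℕ) (hk : 1 ≤ k) (hkd : k < d) (p q : ℝ≥0∞)
    (hp : p = ((d : ℝ≥0∞) + 1) / ((k : ℝ≥0∞) + 1)) (hq : q = (d : ℝ≥0∞) + 1) :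
    -- the three invariant measures exist
    (∃ μ₀ : Measure (KPlane.FlatPlane d k), KPlane.IsInvariantFlat μ₀) ∧
    (∃ μ : Measure (KPlane.Plane .plus d k), KPlane.IsInvariant μ) ∧
    (∃ μ : Measure (KPlane.Plane .minus d k), KPlane.IsInvariant μ) ∧
    -- (i), norms in `L^p`
    (∀ f : KPlane.E d → ℝ, MemLp f p volume →
      MemLp (KPlane.pull .plus k f) p ((2 : ℝ≥0∞)⁻¹ • KPlane.spaceMeasure .plus d) ∧
      eLpNorm (KPlane.pull .plus k f) p ((2 : ℝ≥0∞)⁻¹ • KPlane.spaceMeasure .plus d) =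
        eLpNorm f p volume) ∧
    -- (i), norms in `L^q`
    (∀ (μ₀ : Measure (KPlane.FlatPlane d k)) (μ : Measure (KPlane.Plane .plus d k)),
      KPlane.IsInvariantFlat μ₀ → KPlane.IsInvariant μ →
      ∃ c : ℝ≥0∞, c ≠ 0 ∧ c ≠ ∞ ∧ ∀ f : KPlane.E d → ℝ, MemLp f p volume →
        (∀ᵐ π ∂μ₀, Integrable f π.measure) ∧
        (∀ᵐ π ∂μ, Integrable (KPlane.pull .plus k f) π.measure) ∧
        AEStronglyMeasurable (KPlane.flatTransform f) μ₀ ∧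
        AEStronglyMeasurable (KPlane.transform (KPlane.pull .plus k f)) μ ∧
        eLpNorm (KPlane.transform (KPlane.pull .plus k f)) q (c • μ) =
          eLpNorm (KPlane.flatTransform f) q μ₀) ∧
    -- (ii), norms in `L^p`
    (∀ f : KPlane.E d → ℝ, MemLp f p volume → (∀ᵐ x, x ∉ Metric.ball 0 1 → f x = 0) →
      MemLp (KPlane.pull .minus k f) p (KPlane.spaceMeasure .minus d) ∧
      eLpNorm (KPlane.pull .minus k f) p (KPlane.spaceMeasure .minus d) =
        eLpNorm f p volume) ∧
    -- (ii), norms in `L^q`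
    (∀ (μ₀ : Measure (KPlane.FlatPlane d k)) (μ : Measure (KPlane.Plane .minus d k)),
      KPlane.IsInvariantFlat μ₀ → KPlane.IsInvariant μ →
      ∃ c : ℝ≥0∞, c ≠ 0 ∧ c ≠ ∞ ∧ ∀ f : KPlane.E d → ℝ, MemLp f p volume →
        (∀ᵐ x, x ∉ Metric.ball 0 1 → f x = 0) →
        (∀ᵐ π ∂μ₀, Integrable f π.measure) ∧
        (∀ᵐ π ∂μ, Integrable (KPlane.pull .minus k f) π.measure) ∧
        AEStronglyMeasurable (KPlane.flatTransform f) μ₀ ∧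
        AEStronglyMeasurable (KPlane.transform (KPlane.pull .minus k f)) μ ∧
        eLpNorm (KPlane.transform (KPlane.pull .minus k f)) q (c • μ) =
          eLpNorm (KPlane.flatTransform f) q μ₀) := by
  have hm : (d - k) + k = d := by omega
  have hF := KPlane.nonempty_flatPlane hkd.le
  have hG := KPlane.nonempty_Gr hkd.le
  have hPp := KPlane.nonempty_plane .plus hkd.le
  have hPm := KPlane.nonempty_plane .minus hkd.le
  refine ⟨?_, ?_, ?_, fun f hf => ?_, fun μ₀ μ hμ₀ hμ => ?_, fun f hf h0 => ?_,
    fun μ₀ μ hμ₀ hμ => ?_⟩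
  · obtain ⟨μ, h1, h2, h3⟩ := KPlane.isChart_flat.exists_invariant hm (Or.inr (Or.inl rfl))
    exact ⟨μ, h1, h2, h3⟩
  · obtain ⟨μ, h1, h2, h3⟩ :=
      (KPlane.isChart_plane .plus).exists_invariant hm (KPlane.isCurv_sgn .plus)
    exact ⟨μ, h1, h2, h3⟩
  · obtain ⟨μ, h1, h2, h3⟩ :=
      (KPlane.isChart_plane .minus).exists_invariant hm (KPlane.isCurv_sgn .minus)
    exact ⟨μ, h1, h2, h3⟩
  · exact KPlane.memLp_pull_and_eLpNorm_eq .plus hp hf (by simp [KPlane.region_plus])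
  · obtain ⟨c, hc, hct, h⟩ := KPlane.exists_transform_norm_eq .plus hkd hp hq μ₀ μ hμ₀ hμ
    exact ⟨c, hc, hct, fun f hf => h f hf (by simp [KPlane.region_plus])⟩
  · rw [← KPlane.region_minus] at h0
    have h := KPlane.memLp_pull_and_eLpNorm_eq .minus hp hf h0
    rwa [KPlane.Curv.mult, inv_one, one_smul] at h
  · obtain ⟨c, hc, hct, h⟩ := KPlane.exists_transform_norm_eq .minus hkd hp hq μ₀ μ hμ₀ hμ
    rw [KPlane.region_minus] at h
    exact ⟨c, hc, hct, h⟩
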